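/- **Theorem (tangential trace estimates).** Let $n \ge 1$, $0 \le k \le n$, $r \ge 0$ be integers, $\gamma > 0$ and let $s \ge 0$ be a real number. There is a constant $C$, depending only on $n, k, r, s, \gamma$, such that the following holds. *Setting.* Let $\Omega \subset \mathbb{R}^n$ be a bounded polyhedral (Lipschitz) domain — more generally a bounded open set — and let $\mathcal{T}_h$ be a conforming mesh by finitely many nondegenerate $n$-simplices whose union is $\overline\Omega$ and whose interiors lie in $\Omega$. Put $h_K = \operatorname{diam} K$, $h = \max_K h_K$, and assume that $\mathcal{T}_h$ is shape-regular with constant $\gamma$: each $K \in \mathcal{T}_h$ contains a ball of some radius $\rho_K>0$ with $h_K \le \gamma \rho_K$. Let $H\Lambda^k(\Omega)$ be the space of $L^2$ $k$-forms with weak exterior derivative in $L^2$, let $\mathcal{P}_r\Lambda^k$ be the $k$-forms with polynomial coefficients of degree $\le r$, and let $\mathcal{P}_r^-\Lambda^k = \mathcal{P}_{r-1}\Lambda^k + \kappa \mathcal{P}_{r-1}\Lambda^{k+1}$, where $\kappa$ is contraction with the vector field $x \mapsto x$. Let $$W_h^{k-1}(K) = \mathcal{P}_{r+1}\Lambda^{k-1}(K)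 \text{ for all } K, \quad\text{or}\quad W_h^{k-1}(K) = \mathcal{P}_{r+1}^-\Lambda^{k-1}(K) \text{ for all } K,$$ $$W_h^{k}(K) = \mathcal{P}_{r}\Lambda^{k}(K) \text{ for all } K \ (\text{if } r \ge 1), \quad\text{or}\quad W_h^{k}(K) = \mathcal{P}_{r+1}^-\Lambda^{k}(K) \text{ for all } K,$$ and $V_h^{\ell} = \{ v \in H\Lambda^{\ell}(\Omega) : v|_K \in W_h^{\ell}(K)\ \forall K \in \mathcal{T}_h\}$ for $\ell = k-1, k$. For $f \in L^2\Lambda^k(\Omega)$ let $(\sigma,u,p)$ solve the mixed Hodge–Laplace problem: $\sigma \in V^{k-1}$, $u \in V^k$, $p \in \mathfrak{H}^k$ with $$(\sigma,\tau)_\Omega - (u,\mathrm{d}\tau)_\Omega = 0,\qquad (\mathrm{d}\sigma,v)_\Omega + (\mathrm{d}u,\mathrm{d}v)_\Omega + (p,v)_\Omega = (f,v)_\Omega,\qquad (u,q)_\Omega = 0$$ for all $\tau \in V^{k-1}$, $v \in V^k$, $q \in \mathfrak{H}^k$, where $V^{\ell} = H\Lambda^{\ell}(\Omega)$ and $\mathfrak{H}^k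 = \{ q \in V^k : \mathrm{d}q = 0,\ (q,\mathrm{d}\tau)_\Omega = 0\ \forall \tau \in V^{k-1}\}$; and let $(\sigma_h,u_h,p_h)$ solve the same problem with $V^{k-1},V^k$ replaced by $V_h^{k-1},V_h^k$. (For $k=0$ the variables $\sigma,\sigma_h$ are absent.) Assume that $\sigma$ and $u$ are in $H^1(K)$ for each $K \in \mathcal{T}_h$. For a form $v$ that is in $H^1$ on $K$, the tangential trace $v^{\mathrm{tan}}$ on $\partial K$ is its trace, restricted on each facet to vectors tangent to that facet. Let $|\!|\!|\cdot|\!|\!|_{\partial K} = h_K^{1/2} \|\cdot\|_{L^2(\partial K)}$ and $|\!|\!|\cdot|\!|\!|_{\partial\mathcal{T}_h} = \bigl(\sum_K |\!|\!|\cdot|\!|\!|_{\partial K}^2\bigr)^{1/2}$. Let $|\cdot|_{t}$ be the Sobolev seminorm of real order $t$ (Sobolev–Slobodeckij if $t$ is not an integer), taken to be $+\infty$ on forms that are not in $H^t$. *Conclusion.* The traces of $\sigma,\sigma_h,u,u_h$ exist in $L^2(\partial K)$ in each of the cases below, and for each $K \in \mathcal{T}_h$, $$|\!|\!|\sigma^{\mathrm{tan}}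 - \sigma_h^{\mathrm{tan}}|\!|\!|_{\partial K} \le C\bigl( \|\sigma-\sigma_h\|_K + h_K^{s+1} |\sigma|_{s+1,K}\bigr),\quad\text{if } \begin{cases} s \le r+1, & W_h^{k-1}(K) = \mathcal{P}_{r+1}\Lambda^{k-1}(K),\\ s \le r, & W_h^{k-1}(K) = \mathcal{P}_{r+1}^-\Lambda^{k-1}(K),\end{cases}$$ $$|\!|\!|u^{\mathrm{tan}} - u_h^{\mathrm{tan}}|\!|\!|_{\partial K} \le C\Bigl( \|u-u_h\|_K + \begin{cases} h_K |u|_{1,K}, & \text{if } W_h^{k}(K) = \mathcal{P}_{1}^-\Lambda^{k}(K),\\ h_K^{s+2} |u|_{s+2,K}, & \text{if } s \le r-1.\end{cases}\Bigr)$$ Moreover, under the same conditions on $s$ and on the spaces, $$|\!|\!|\sigma^{\mathrm{tan}} - \sigma_h^{\mathrm{tan}}|\!|\!|_{\partial\mathcal{T}_h} \le C\bigl( \|\sigma-\sigma_h\|_\Omega + h^{s+1} |\sigma|_{s+1,\Omega}\bigr),$$ $$|\!|\!|u^{\mathrm{tan}} - u_h^{\mathrm{tan}}|\!|\!|_{\partial\mathcal{T}_h}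 \le C\Bigl( \|u-u_h\|_\Omega + \begin{cases} h |u|_{1,\Omega}, & \text{if } W_h^{k}(K) = \mathcal{P}_{1}^-\Lambda^{k}(K) \text{ for all } K,\\ h^{s+2} |u|_{s+2,\Omega}, & \text{if } s \le r-1.\end{cases}\Bigr)$$ -/

import Mathlib

open MeasureTheory Filter Topology Set
open scoped ENNReal ContDiff

noncomputable section

namespace TanTrace

/-- The ambient space `ℝⁿ` with its Euclidean structure. -/
abbrev Pt (n : ℕ) := EuclideanSpace ℝ (Fin n)

/-- `Alt^k V`, the alternating `k`-linear forms on `V`. -/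
abbrev Alt (V : Type*) [NormedAddCommGroup V] [NormedSpace ℝ V] (k : ℕ) := V [⋀^Fin k]→L[ℝ] ℝ

/-- Differential `k`-forms on `ℝⁿ` (no regularity); forms on a subset are given by such a function,
of which only the values on the subset matter. -/
abbrev Form (n k : ℕ) := Pt n → Alt (Pt n) k

/-- The standard basis vector `e_i`. -/
abbrev stdVec {n : ℕ} (i : Fin n) : Pt n := EuclideanSpace.basisFun (Fin n) ℝ i

/-- The inner product on `Alt^k V` induced by the inner product of `V`:
`∑_{i₁ < ⋯ < i_k} α(b_{i₁}, …, b_{i_k}) β(b_{i₁}, …, b_{i_k})` for an orthonormal basis `b`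
(the value does not depend on `b`). -/
def altInner {V : Type*} [NormedAddCommGroup V] [InnerProductSpace ℝ V] [FiniteDimensional ℝ V]
    {k : ℕ} (α β : Alt V k) : ℝ :=
  ∑ I : Fin k ↪o Fin (Module.finrank ℝ V),
    α (fun a => stdOrthonormalBasis ℝ V (I a)) * β (fun a => stdOrthonormalBasis ℝ V (I a))

/-- The `L²` norm, as an extended nonnegative real, of a field of alternating forms. -/
def l2Norm {X V : Type*} [MeasurableSpace X]
    [NormedAddCommGroup V] [InnerProductSpace ℝ V] [FiniteDimensional ℝ V] {k : ℕ}
    (μ : Measure X) (v : X → Alt V k) : ℝ≥0∞ :=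
  (∫⁻ x, ENNReal.ofReal (altInner (v x) (v x)) ∂μ) ^ (1 / 2 : ℝ)

/-- The `L²` inner product `(v, w)_Ω` of two forms. -/
def l2Inner {n k : ℕ} (Ω : Set (Pt n)) (v w : Form n k) : ℝ :=
  ∫ x in Ω, altInner (v x) (w x)

/-- `v ∈ L²Λ^k(Ω)`. -/
def MemL2 {n k : ℕ} (Ω : Set (Pt n)) (v : Form n k) : Prop :=
  MemLp v 2 (volume.restrict Ω)

/-! ### Weak exterior derivative -/

/-- The codifferential of a smooth form, `δη = -∑ᵢ ι_{eᵢ} ∂ᵢη`; this is the formal adjoint of the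
exterior derivative. -/
def codiff {n k : ℕ} (η : Form n (k + 1)) : Form n k := fun x =>
  -∑ i : Fin n, (fderiv ℝ η x (stdVec i)).curryLeft (stdVec i)

/-- `v ∈ L²Λ^k(Ω)` has the weak exterior derivative `w ∈ L²Λ^{k+1}(Ω)`:
`(w, η)_Ω = (v, δη)_Ω` for all smooth `η` with compact support in `Ω`. -/
structure HasWeakExtDeriv {n k : ℕ} (Ω : Set (Pt n)) (v : Form n k) (w : Form n (k + 1)) :
    Prop where
  memL2 : MemL2 Ω v
  memL2_deriv : MemL2 Ω w
  eq : ∀ η : Form n (k + 1), ContDiff ℝ ∞ η → HasCompactSupport η → tsupport η ⊆ Ω →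
    l2Inner Ω w η = l2Inner Ω v (codiff η)

/-- The space `HΛ^k(Ω)`. -/
def HLambda {n : ℕ} (Ω : Set (Pt n)) (k : ℕ) : Set (Form n k) :=
  {v | ∃ w, HasWeakExtDeriv Ω v w}

/-! ### Sobolev seminorms of forms -/

/-- `D` consists of weak partial derivatives in `L²(U)` of all orders `≤ m` of the form `v`:
`D i α = ∂_{α₁} ⋯ ∂_{αᵢ} v` weakly in `U`, for `i ≤ m`. -/
structure IsWeakJet {n k : ℕ} (U : Set (Pt n)) (m : ℕ) (v : Form n k)
    (D : (i : ℕ) → (Fin i → Fin n) → Form n k) : Prop where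
  memL2 : MemL2 U v
  memL2_deriv : ∀ i ≤ m, ∀ α, MemL2 U (D i α)
  eq : ∀ i ≤ m, ∀ α : Fin i → Fin n, ∀ φ : Pt n → ℝ,
    ContDiff ℝ ∞ φ → HasCompactSupport φ → tsupport φ ⊆ U →
      ∫ x in U, (iteratedFDeriv ℝ i φ x (fun a => stdVec (α a))) • v x =
        (-1 : ℝ) ^ i • ∫ x in U, φ x • D i α x

/-- The square of the `L²(U)` norm (if `θ = 0`), respectively of the Sobolev–Slobodeckij seminorm
of order `θ` (if `0 < θ < 1`), of a form. -/
def slobodeckijSq {n k : ℕ} (U : Set (Pt n)) (θ : ℝ) (v : Form n k) : ℝ≥0∞ :=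
  if θ = 0 then l2Norm (volume.restrict U) v ^ 2
  else ∫⁻ x in U, ∫⁻ y in U,
    ENNReal.ofReal (altInner (v x - v y) (v x - v y) / ‖x - y‖ ^ ((n : ℝ) + 2 * θ))

/-- The Sobolev seminorm `|v|_{t,U}` of real order `t ≥ 0` on an open set `U`: with `t = m + θ`,
`m` integer and `0 ≤ θ < 1`, the order-`θ` seminorm of the derivatives of order `m`.
Weak derivatives are unique almost everywhere, so that the infimum is over a single value, or over
the empty set; hence the value is `∞` when `v` is not in `H^t`. -/
def sobolevSeminorm {n k : ℕ} (U : Set (Pt n)) (t : ℝ) (v : Form n k) : ℝ≥0∞ :=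
  ⨅ (D : (i : ℕ) → (Fin i → Fin n) → Form n k) (_ : IsWeakJet U ⌊t⌋₊ v D),
    (∑ α : Fin ⌊t⌋₊ → Fin n, slobodeckijSq U (t - ⌊t⌋₊) (D ⌊t⌋₊ α)) ^ (1 / 2 : ℝ)

/-- `v ∈ H^tΛ^k(U)`. -/
def MemSobolev {n k : ℕ} (U : Set (Pt n)) (t : ℝ) (v : Form n k) : Prop :=
  sobolevSeminorm U t v < ⊤

/-! ### Simplicial meshes -/

/-- The interior of the simplex with vertex set `K`. -/
def cell {n : ℕ} (K : Finset (Pt n)) : Set (Pt n) := interior (convexHull ℝ (K : Set (Pt n)))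

/-- The facet of the simplex `K` opposite to the vertex `z`. -/
def facet {n : ℕ} (K : Finset (Pt n)) (z : Pt n) : Set (Pt n) :=
  convexHull ℝ ((K : Set (Pt n)) \ {z})

/-- The tangent space of the facet of `K` opposite to `z`. -/
abbrev facetDir {n : ℕ} (K : Finset (Pt n)) (z : Pt n) : Submodule ℝ (Pt n) :=
  vectorSpan ℝ ((K : Set (Pt n)) \ {z})

/-- The diameter `h_K`. -/
def cellDiam {n : ℕ} (K : Finset (Pt n)) : ℝ := Metric.diam (convexHull ℝ (K : Set (Pt n)))

/-- The mesh size `h = max_K h_K`. -/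
def meshSize {n : ℕ} (T : Finset (Finset (Pt n))) : ℝ :=
  sSup (cellDiam '' (T : Set (Finset (Pt n))))

/-- `T` is a conforming mesh of `Ω` by nondegenerate `n`-simplices, each given by its vertices. -/
structure IsMesh {n : ℕ} (Ω : Set (Pt n)) (T : Finset (Finset (Pt n))) : Prop where
  card : ∀ K ∈ T, K.card = n + 1
  affineIndependent : ∀ K ∈ T, AffineIndependent ℝ ((↑) : K → Pt n)
  conforming : ∀ K ∈ T, ∀ L ∈ T,
    convexHull ℝ (K : Set (Pt n)) ∩ convexHull ℝ (L : Set (Pt n)) =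
      convexHull ℝ ((K : Set (Pt n)) ∩ (L : Set (Pt n)))
  cell_subset : ∀ K ∈ T, cell K ⊆ Ω
  cover : ⋃ K ∈ T, convexHull ℝ (K : Set (Pt n)) = closure Ω

/-- Shape regularity with constant `γ`: each simplex `K` of the mesh contains a ball of some radius
`ρ > 0` with `h_K ≤ γ ρ`. -/
def IsShapeRegular {n : ℕ} (γ : ℝ) (T : Finset (Finset (Pt n))) : Prop :=
  ∀ K ∈ T, ∃ (c : Pt n) (ρ : ℝ), 0 < ρ ∧
    Metric.ball c ρ ⊆ convexHull ℝ (K : Set (Pt n)) ∧ cellDiam K ≤ γ * ρ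

/-! ### Tangential traces on the boundary of a simplex -/

/-- `k`-forms on `∂K`: for each vertex `z` of `K`, a field on the opposite facet of alternating
forms on the tangent space of that facet. -/
abbrev BdryForm {n : ℕ} (K : Finset (Pt n)) (k : ℕ) := (z : Pt n) → Pt n → Alt (facetDir K z) k

/-- Surface measure on the facet of `K` opposite to `z`. -/
def facetMeasure {n : ℕ} (K : Finset (Pt n)) (z : Pt n) : Measure (Pt n) :=
  (μHE[n - 1] : Measure (Pt n)).restrict (facet K z)

/-- The norm `‖g‖_{∂K}` of `L²Λ^k(∂K)`. -/
def bdryNorm {n k : ℕ} (K : Finset (Pt n)) (g : BdryForm K k) : ℝ≥0∞ :=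
  (∑ z ∈ K, l2Norm (facetMeasure K z) (g z) ^ 2) ^ (1 / 2 : ℝ)

/-- The scaled norm `|||g|||_{∂K} = h_K^{1/2} ‖g‖_{∂K}`. -/
def scaledBdryNorm {n k : ℕ} (K : Finset (Pt n)) (g : BdryForm K k) : ℝ≥0∞ :=
  ENNReal.ofReal (cellDiam K ^ (1 / 2 : ℝ)) * bdryNorm K g

/-- The pullback to `∂K` of a form defined everywhere: on each facet, restriction to the vectors
tangent to the facet. -/
def pullbackBdry {n k : ℕ} (K : Finset (Pt n)) (v : Form n k) : BdryForm K k := fun z x =>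
  (v x).compContinuousLinearMap (facetDir K z).subtypeL

/-- `g ∈ L²Λ^k(∂K)` is the tangential trace `v^tan` on `∂K` of the form `v ∈ H¹Λ^k(K)`: it is the
limit in `L²(∂K)` of the pullbacks of smooth forms that converge to `v` in `H¹(K)`. -/
def IsTanTrace {n k : ℕ} (K : Finset (Pt n)) (v : Form n k) (g : BdryForm K k) : Prop :=
  (∀ z ∈ K, MemLp (g z) 2 (facetMeasure K z)) ∧
  ∃ φ : ℕ → Form n k, (∀ i, ContDiff ℝ ∞ (φ i)) ∧
    Tendsto (fun i => l2Norm (volume.restrict (cell K)) (φ i - v)) atTop (𝓝 0) ∧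
    Tendsto (fun i => sobolevSeminorm (cell K) 1 (φ i - v)) atTop (𝓝 0) ∧
    Tendsto (fun i => bdryNorm K (pullbackBdry K (φ i) - g)) atTop (𝓝 0)

/-! ### Finite element spaces -/

/-- `𝒫_r Λ^k`: forms whose coefficients are polynomials of degree `≤ r`. -/
def polyForms (n r k : ℕ) : Set (Form n k) :=
  {v | ∀ I : Fin k ↪o Fin n, ∃ p : MvPolynomial (Fin n) ℝ, p.totalDegree ≤ r ∧
    ∀ x : Pt n, v x (fun a => stdVec (I a)) = MvPolynomial.eval (fun i => x i) p}

/-- The Koszul differential: contraction with the vector field `x ↦ x`. -/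
def koszul {n k : ℕ} (v : Form n (k + 1)) : Form n k := fun x => (v x).curryLeft x

/-- `𝒫_r⁻ Λ^k = 𝒫_{r-1} Λ^k + κ 𝒫_{r-1} Λ^{k+1}` (and `0` if `r = 0`). -/
def polyFormsMinus (n : ℕ) : (r k : ℕ) → Set (Form n k)
  | 0, _ => {0}
  | r + 1, k => {v | ∃ a ∈ polyForms n r k, ∃ b ∈ polyForms n r (k + 1), v = a + koszul b}

/-- The conforming finite element space of the forms in `HΛ^k(Ω)` whose restriction to each
simplex of the mesh belongs to the space `W` of polynomial forms. -/
def feSpace {n k : ℕ} (Ω : Set (Pt n)) (T : Finset (Finset (Pt n))) (W : Set (Form n k)) :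
    Set (Form n k) :=
  {v | v ∈ HLambda Ω k ∧ ∀ K ∈ T, ∃ q ∈ W, v =ᵐ[volume.restrict (cell K)] q}

/-! ### The mixed Hodge–Laplace problem -/

/-- The harmonic `(j+1)`-forms of a subcomplex of `HΛ(Ω)` that has `V'` in degree `j` and `V` in
degree `j + 1`: the closed forms in `V` that are orthogonal to `d V'`. -/
def harmonic {n j : ℕ} (Ω : Set (Pt n)) (V' : Set (Form n j)) (V : Set (Form n (j + 1))) :
    Set (Form n (j + 1)) :=
  {q | q ∈ V ∧ HasWeakExtDeriv Ω q 0 ∧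
    ∀ τ ∈ V', ∀ dτ, HasWeakExtDeriv Ω τ dτ → l2Inner Ω q dτ = 0}

/-- `(σ, u, p)` solves the mixed Hodge–Laplace problem for `k`-forms, `k = j + 1`, posed on the
subspaces `V'` of `HΛ^{k-1}(Ω)` and `V` of `HΛ^k(Ω)`. The full spaces give the exact problem, the
finite element spaces give the discrete problem. -/
structure IsMixedSolution {n j : ℕ} (Ω : Set (Pt n)) (V' : Set (Form n j))
    (V : Set (Form n (j + 1))) (f : Form n (j + 1))
    (σ : Form n j) (u p : Form n (j + 1)) : Prop where
  sigma_mem : σ ∈ V'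
  u_mem : u ∈ V
  p_mem : p ∈ harmonic Ω V' V
  eq_sigma : ∀ τ ∈ V', ∀ dτ, HasWeakExtDeriv Ω τ dτ → l2Inner Ω σ τ - l2Inner Ω u dτ = 0
  eq_u : ∀ v ∈ V, ∀ dσ du dv,
    HasWeakExtDeriv Ω σ dσ → HasWeakExtDeriv Ω u du → HasWeakExtDeriv Ω v dv →
      l2Inner Ω dσ v + l2Inner Ω du dv + l2Inner Ω p v = l2Inner Ω f v
  eq_p : ∀ q ∈ harmonic Ω V' V, l2Inner Ω u q = 0

/-- The harmonic `0`-forms of a subcomplex of `HΛ(Ω)` that has `V` in degree `0`. -/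
def harmonicZero {n : ℕ} (Ω : Set (Pt n)) (V : Set (Form n 0)) : Set (Form n 0) :=
  {q | q ∈ V ∧ HasWeakExtDeriv Ω q 0}

/-- The Hodge–Laplace problem for `k = 0`, where there is no variable `σ`. -/
structure IsMixedSolutionZero {n : ℕ} (Ω : Set (Pt n)) (V : Set (Form n 0)) (f u p : Form n 0) :
    Prop where
  u_mem : u ∈ V
  p_mem : p ∈ harmonicZero Ω V
  eq_u : ∀ v ∈ V, ∀ du dv, HasWeakExtDeriv Ω u du → HasWeakExtDeriv Ω v dv →
    l2Inner Ω du dv + l2Inner Ω p v = l2Inner Ω f v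
  eq_p : ∀ q ∈ harmonicZero Ω V, l2Inner Ω u q = 0

/-! ### The estimates -/

/-- The local and global estimates of order `t` for the tangential traces of `v` and `vh`:
the traces exist in `L²(∂K)` for each `K`,
`|||v^tan - vh^tan|||_{∂K} ≤ C (‖v - vh‖_K + h_K^t |v|_{t,K})` for each `K`, and
`(∑_K |||v^tan - vh^tan|||_{∂K}²)^{1/2} ≤ C (‖v - vh‖_Ω + h^t |v|_{t,Ω})`. -/
structure TraceEstimate {n k : ℕ} (Ω : Set (Pt n)) (T : Finset (Finset (Pt n))) (C t : ℝ)
    (v vh : Form n k) : Prop where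
  exists_trace : ∀ K ∈ T, ∃ g : BdryForm K k, IsTanTrace K v g
  exists_trace_discrete : ∀ K ∈ T, ∃ gh : BdryForm K k, IsTanTrace K vh gh
  local_estimate : ∀ K ∈ T, ∀ g gh : BdryForm K k, IsTanTrace K v g → IsTanTrace K vh gh →
    scaledBdryNorm K (g - gh) ≤ ENNReal.ofReal C *
      (l2Norm (volume.restrict (cell K)) (v - vh) +
        ENNReal.ofReal (cellDiam K ^ t) * sobolevSeminorm (cell K) t v)
  global_estimate : ∀ g gh : (K : Finset (Pt n)) → BdryForm K k,
    (∀ K ∈ T, IsTanTrace K v (g K)) → (∀ K ∈ T, IsTanTrace K vh (gh K)) →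
    (∑ K ∈ T, scaledBdryNorm K (g K - gh K) ^ 2) ^ (1 / 2 : ℝ) ≤ ENNReal.ofReal C *
      (l2Norm (volume.restrict Ω) (v - vh) +
        ENNReal.ofReal (meshSize T ^ t) * sobolevSeminorm Ω t v)

end TanTrace

end

open MeasureTheory Filter Topology Set
open scoped ENNReal ContDiff

noncomputable section

/-! Fix a simplex `K` of diameter `h`, a form `v` with weak derivatives up to the required order,
and a discrete form `vh`, which on `K` is a polynomial of bounded degree. For any polynomial form
`q`, write `v - vh = (v - q) + (q - vh)`. The two summands have small traces for different reasons.

The first is controlled by the trace inequality `h^{1/2} ‖w‖_{∂K} ≤ C (‖w‖_K + h ‖∇w‖_K)`. The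
second is a polynomial, and the inverse trace inequality `h^{1/2} ‖p‖_{∂K} ≤ C ‖p‖_K` dispenses with
its gradient; moreover `‖q - vh‖_K ≤ ‖v - vh‖_K + ‖v - q‖_K`. What remains is to choose `q` with `‖v
- q‖_K + h ‖∇(v - q)‖_K ≤ C h^t |v|_{t,K}`, which is the Bramble–Hilbert lemma
(`exists_poly_approx`). The polynomial `q` need not lie in the finite element space, since the
inverse inequality asks for a bounded degree only. Restriction to tangent vectors does not increase
norms, so everything is proved for full traces and then restricted.

No reference simplex is used. Both trace inequalities come from slicing `K` by hyperplanes parallel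
to a facet (`cone_slices_le`): the slices at relative heights between `1/2` and `1` have at least
`2^{-(n-1)}` times the area of the facet, and the height over the facet is at least `h/γ`. Hence the
integral over the facet of the averages over these ray segments is at most `C/h` times the integral
over `K`. On each ray, a polynomial is controlled at the endpoint by equivalence of norms in finite
dimension, and a smooth function by the fundamental theorem of calculus.

The trace inequality reaches `H¹` forms through density of smooth forms, which on a convex set
follows from averaging over points contracted into the set (`regAvg`). For the Bramble–Hilbert
lemma, `q` is chosen so that all derivatives of `v - q` up to order `m = ⌊t⌋` have mean zero. The
Poincaré inequality for convex sets then descends from order `m` to orders `0` and `1`, and at order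
`m` a mean-zero function is bounded by its double integral of differences, hence by the Slobodeckij
seminorm.

The global estimate sums the squared local ones over the disjoint cells. -/

namespace TanTrace

/-! ### Norms of alternating forms and their `L²` norms -/

section AltNorm

variable {V : Type*} [NormedAddCommGroup V] [InnerProductSpace ℝ V] [FiniteDimensional ℝ V]
  {k : ℕ}

/-- Evaluation of an alternating form on increasing tuples of basis vectors is injective. -/
theorem alt_ext_of_basis {V : Type*} [NormedAddCommGroup V] [NormedSpace ℝ V]
    {k : ℕ} {ι : Type*} [LinearOrder ι] (b : Module.Basis ι ℝ V)
    {α β : Alt V k} (h : ∀ I : Fin k ↪o ι, α (fun a => b (I a)) = β (fun a => b (I a))) :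
    α = β := by
  apply ContinuousAlternatingMap.toAlternatingMap_injective
  refine Module.Basis.ext_alternating b fun v hv => ?_
  classical
  -- Sorting an injective tuple of indices makes it increasing; both forms change by the same sign.
  let σ : Equiv.Perm (Fin k) := Tuple.sort v
  have hm : StrictMono (v ∘ σ) :=
    (Tuple.monotone_sort v).strictMono_of_injective (hv.comp σ.injective)
  have h1 := h (OrderEmbedding.ofStrictMono _ hm)
  have e : ∀ g : V [⋀^Fin k]→ₗ[ℝ] ℝ, g (fun i => b (v i)) =
      (Equiv.Perm.sign σ) • g (fun i => b (v (σ i))) := by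
    intro g
    have := g.map_perm (fun i => b (v i)) σ
    simp only [Function.comp_def] at this
    rw [this, smul_smul, ← Units.ext_iff.mpr (by simp : ((1 : ℤˣ) : ℤ) =
      ((Equiv.Perm.sign σ * Equiv.Perm.sign σ : ℤˣ) : ℤ)), one_smul]
  rw [e, e]
  congr 1

instance finiteDimensional_alt : FiniteDimensional ℝ (Alt V k) := by
  refine FiniteDimensional.of_injective (V₂ := (Fin k ↪o Fin (Module.finrank ℝ V)) → ℝ)
    { toFun := fun α I => α (fun a => (stdOrthonormalBasis ℝ V).toBasis (I a))
      map_add' := fun _ _ => rfl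
      map_smul' := fun _ _ => rfl } ?_
  intro α β h
  exact alt_ext_of_basis (stdOrthonormalBasis ℝ V).toBasis fun I => congrFun h I

variable (V k) in
/-- Coefficients of an alternating form in the standard orthonormal basis. -/
def altEval : Alt V k →L[ℝ] EuclideanSpace ℝ (Fin k ↪o Fin (Module.finrank ℝ V)) :=
  LinearMap.toContinuousLinearMap
    { toFun := fun α => WithLp.toLp 2 fun I => α (fun a => stdOrthonormalBasis ℝ V (I a))
      map_add' := fun _ _ => rfl
      map_smul' := fun _ _ => rfl }

theorem altEval_apply (α : Alt V k) (I : Fin k ↪o Fin (Module.finrank ℝ V)) :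
    altEval V k α I = α (fun a => stdOrthonormalBasis ℝ V (I a)) := rfl

theorem altEval_injective : Function.Injective (altEval V k) := by
  intro α β h
  refine alt_ext_of_basis (stdOrthonormalBasis ℝ V).toBasis fun I => ?_
  rw [OrthonormalBasis.coe_toBasis, ← altEval_apply, ← altEval_apply, h]

theorem altInner_self (α : Alt V k) : altInner α α = ‖altEval V k α‖ ^ 2 := by
  rw [EuclideanSpace.norm_sq_eq]
  simp [altInner, altEval_apply, sq]

/-- There are at most `n^k` increasing tuples of basis vectors. Asking only that the dimension be at
most `n` gives one constant for the ambient space and for the tangent spaces of all facets. -/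
theorem norm_altEval_le (α : Alt V k) {n : ℕ} (hn : Module.finrank ℝ V ≤ n) :
    ‖altEval V k α‖ ≤ ((n ^ k : ℕ) : ℝ) * ‖α‖ := by
  have h1 : ‖altEval V k α‖ ^ 2 ≤ ((n ^ k : ℕ) : ℝ) * ‖α‖ ^ 2 := by
    rw [EuclideanSpace.norm_sq_eq]
    calc _ ≤ ∑ _I : Fin k ↪o Fin (Module.finrank ℝ V), ‖α‖ ^ 2 := by
          refine Finset.sum_le_sum fun I _ => ?_
          gcongr
          rw [altEval_apply]
          refine (α.le_opNorm _).trans ?_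
          simp
      _ = (Fintype.card (Fin k ↪o Fin (Module.finrank ℝ V)) : ℝ) * ‖α‖ ^ 2 := by
          rw [Finset.sum_const, Finset.card_univ, nsmul_eq_mul]
      _ ≤ _ := by
          gcongr
          have := Fintype.card_le_of_injective
            (fun I : Fin k ↪o Fin (Module.finrank ℝ V) => (I : Fin k → Fin _))
            DFunLike.coe_injective
          simp only [Fintype.card_fun, Fintype.card_fin] at this
          exact this.trans (Nat.pow_le_pow_left hn k)
  rcases Nat.eq_zero_or_pos (n ^ k) with h0 | h0
  · rw [h0] at h1 ⊢
    simp at h1 ⊢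
    exact h1
  -- Counting tuples bounds the square with factor `n^k`; as `n^k ≥ 1`, this is at most its square,
  -- which avoids a root in the constant.
  · have h2 : (1 : ℝ) ≤ (n ^ k : ℕ) := by exact_mod_cast h0
    refine abs_le_of_sq_le_sq' ?_ (by positivity) |>.2
    rw [mul_pow]
    refine h1.trans ?_
    gcongr
    nlinarith

variable {X : Type*} [MeasurableSpace X]

theorem l2Norm_eq_eLpNorm (μ : Measure X) (v : X → Alt V k) :
    l2Norm μ v = eLpNorm (fun x => altEval V k (v x)) 2 μ := by
  rw [eLpNorm_eq_lintegral_rpow_enorm_toReal (by norm_num) (by norm_num)]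
  unfold l2Norm
  simp only [ENNReal.toReal_ofNat]
  congr 1
  refine lintegral_congr fun x => ?_
  rw [altInner_self, ← ofReal_norm, ENNReal.ofReal_rpow_of_nonneg (norm_nonneg _)
    (by norm_num)]
  norm_num

theorem l2Norm_le_eLpNorm (μ : Measure X) (v : X → Alt V k) {n : ℕ}
    (hn : Module.finrank ℝ V ≤ n) :
    l2Norm μ v ≤ ENNReal.ofReal (n ^ k : ℕ) * eLpNorm v 2 μ := by
  rw [l2Norm_eq_eLpNorm]
  exact eLpNorm_le_mul_eLpNorm_of_ae_le_mul (ae_of_all _ fun x => norm_altEval_le (v x) hn) 2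

-- The coefficient map is injective on a finite-dimensional space, hence bounded below. The constant
-- depends on `V`: for the ambient space this is a legitimate constant of the estimates, while for
-- the tangent space of a facet it serves only to transfer convergence.
variable (V k) in
theorem exists_eLpNorm_le_l2Norm : ∃ c : ℝ, 0 < c ∧ ∀ {X : Type} [MeasurableSpace X]
    (μ : Measure X) (v : X → Alt V k), eLpNorm v 2 μ ≤ ENNReal.ofReal c * l2Norm μ v := by
  obtain ⟨K, hK, h⟩ := (altEval V k).toLinearMap.exists_antilipschitzWith
    (LinearMap.ker_eq_bot.2 altEval_injective)
  refine ⟨K, hK, fun μ v => ?_⟩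
  rw [l2Norm_eq_eLpNorm]
  refine eLpNorm_le_mul_eLpNorm_of_ae_le_mul (ae_of_all _ fun x => ?_) 2
  simpa using h.le_mul_dist (v x) 0

theorem l2Norm_congr_ae {μ : Measure X} {v w : X → Alt V k} (h : v =ᵐ[μ] w) :
    l2Norm μ v = l2Norm μ w := by
  simp only [l2Norm_eq_eLpNorm]
  exact eLpNorm_congr_ae (h.fun_comp (altEval V k))

end AltNorm

theorem norm_restrict_le {V : Type*} [NormedAddCommGroup V] [NormedSpace ℝ V] {k : ℕ}
    (H : Submodule ℝ V) (α : Alt V k) : ‖α.compContinuousLinearMap H.subtypeL‖ ≤ ‖α‖ := by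
  refine ContinuousAlternatingMap.opNorm_le_bound _ (norm_nonneg _) fun m => ?_
  exact (α.le_opNorm _).trans (by simp)

/-! ### Slicing a cone parallel to its base -/

section Cone

variable {n : ℕ}

/-- The volume of the part of a cone between heights `1/2` and `1`, by slicing. -/
theorem cone_slices_le {z v : Pt n} {d : ℝ} (hv : ‖v‖ = 1) (hd : 0 < d) {C F : Set (Pt n)}
    (hC : Convex ℝ C) (hCm : MeasurableSet C) (hz : z ∈ C) (hFC : F ⊆ C)
    (hF : ∀ x ∈ F, inner ℝ v (x - z) = d) {t : Set (Pt n)} (ht : MeasurableSet t) :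
    ENNReal.ofReal d * ∫⁻ s in Ioo (1 / 2 : ℝ) 1,
        (μHE[n - 1] : Measure (Pt n)) (F ∩ AffineMap.homothety z s ⁻¹' t) ≤
      2 ^ (n - 1) * volume (t ∩ C) := by
  have hv0 : v ≠ 0 := by
    rintro rfl
    simp at hv
  have hfr : Module.finrank ℝ (Pt n) = n := finrank_euclideanSpace_fin
  have key := EuclideanGeometry.euclideanHausdorffMeasure_eq_lintegral z hv0 (ht.inter hCm)
  rw [InnerProductSpace.euclideanHausdorffMeasure_eq_volume, hfr] at key
  have hv1 : ‖v‖ₑ = 1 := by rw [← ofReal_norm, hv]; simp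
  -- Heights are rescaled to `d * s`, so that `s` is the ratio of the homothety carrying the base to
  -- the slice.
  have hsub : ∀ f : ℝ → ℝ≥0∞, ∫⁻ x, f x = ENNReal.ofReal d * ∫⁻ s, f (d * s) := by
    intro f
    have h := congrArg (fun μ => ∫⁻ x, f x ∂μ) (Real.smul_map_volume_mul_left hd.ne')
    simp only [lintegral_smul_measure, abs_of_pos hd, smul_eq_mul] at h
    rw [← h, show (fun x : ℝ => d * x) = (MeasurableEquiv.mulLeft₀ d hd.ne' : ℝ → ℝ) from rfl,
      lintegral_map_equiv]
    rfl
  rw [key, hv1, one_mul, hsub, mul_left_comm]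
  gcongr
  rw [← lintegral_const_mul' _ _ (by simp)]
  refine (setLIntegral_mono' measurableSet_Ioo fun s hs => ?_).trans
    (setLIntegral_le_lintegral (Ioo (1 / 2 : ℝ) 1) _)
  have hs0 : 0 < s := by linarith [hs.1]
  set G := F ∩ AffineMap.homothety z s ⁻¹' t with hG
  -- Contracting the base towards the apex `z` by the factor `s` stays in `C` by convexity and lands
  -- in the slice at height `d * s`.
  have h1 : AffineMap.homothety z s '' G ⊆ t ∩ C ∩
      AffineSubspace.mk' ((d * s) • v +ᵥ z) (ℝ ∙ v)ᗮ := by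
    rintro _ ⟨x, hx, rfl⟩
    refine ⟨⟨hx.2, ?_⟩, ?_⟩
    · rw [AffineMap.homothety_eq_lineMap]
      exact hC.lineMap_mem hz (hFC hx.1) ⟨hs0.le, hs.2.le⟩
    · rw [SetLike.mem_coe, AffineSubspace.mem_mk', Submodule.mem_orthogonal_singleton_iff_inner_right]
      have := hF x hx.1
      simp only [AffineMap.homothety_apply, vsub_eq_sub, vadd_eq_add]
      rw [show s • (x - z) + z - ((d * s) • v + z) = s • (x - z) - (d * s) • v by abel,
        inner_sub_right, inner_smul_right, inner_smul_right, this, real_inner_self_eq_norm_sq, hv]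
      ring
  have h2 := measure_mono (μ := (μHE[n - 1] : Measure (Pt n))) h1
  rw [euclideanHausdorffMeasure_homothety_image _ _ hs0.ne'] at h2
  refine le_trans ?_ (mul_le_mul_right h2 _)
  rw [ENNReal.smul_def, smul_eq_mul, ← mul_assoc]
  -- The homothety scales area by `s^(n-1)`, and `2 * s ≥ 1` on the interval of integration.
  refine le_mul_of_one_le_left zero_le ?_
  rw [ENNReal.coe_pow, ← mul_pow]
  refine one_le_pow₀ ?_
  rw [show ((‖s‖₊ : NNReal) : ℝ≥0∞) = ENNReal.ofReal s by
    rw [← Real.enorm_of_nonneg hs0.le]; rfl, show (2 : ℝ≥0∞) = ENNReal.ofReal 2 by simp,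
    ← ENNReal.ofReal_mul (by norm_num)]
  rw [ENNReal.one_le_ofReal]
  linarith [hs.1]

/-- An infinite area of the base would make the left side of the slicing inequality with `t = univ`
infinite, against the finite volume of the compact cone. Finiteness is needed for Tonelli's theorem
on the base. -/
theorem cone_measure_lt_top {z v : Pt n} {d : ℝ} (hv : ‖v‖ = 1) (hd : 0 < d) {C F : Set (Pt n)}
    (hC : Convex ℝ C) (hCc : IsCompact C) (hz : z ∈ C) (hFC : F ⊆ C)
    (hF : ∀ x ∈ F, inner ℝ v (x - z) = d) :
    (μHE[n - 1] : Measure (Pt n)) F < ⊤ := by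
  have h := cone_slices_le hv hd hC hCc.measurableSet hz hFC hF MeasurableSet.univ
  have hlt : (2 : ℝ≥0∞) ^ (n - 1) * volume (univ ∩ C) < ⊤ := by
    rw [univ_inter]
    exact ENNReal.mul_lt_top (by simp) hCc.measure_lt_top
  by_contra htop
  rw [not_lt, top_le_iff] at htop
  refine absurd (h.trans_lt hlt) ?_
  simp only [preimage_univ, inter_univ, htop, setLIntegral_const, Real.volume_Ioo]
  rw [ENNReal.top_mul (by simp; norm_num), ENNReal.mul_top (by simpa using hd)]
  simp

/-- The slicing inequality compares volume on `C` with the image of the product measure on heights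
and base under `(s, x) ↦ z + s (x - z)`; comparing measures passes from sets to all integrands. -/
theorem cone_lintegral_le {z v : Pt n} {d : ℝ} (hv : ‖v‖ = 1) (hd : 0 < d) {C F : Set (Pt n)}
    (hC : Convex ℝ C) (hCc : IsCompact C) (hz : z ∈ C) (hFC : F ⊆ C)
    (hF : ∀ x ∈ F, inner ℝ v (x - z) = d) {g : Pt n → ℝ≥0∞} (hg : Measurable g) :
    ENNReal.ofReal d * ∫⁻ x in F, (∫⁻ s in Ioo (1 / 2 : ℝ) 1, g (z + s • (x - z)))
        ∂(μHE[n - 1] : Measure (Pt n)) ≤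
      2 ^ (n - 1) * ∫⁻ y in C, g y := by
  have : IsFiniteMeasure ((μHE[n - 1] : Measure (Pt n)).restrict F) :=
    ⟨by simpa using cone_measure_lt_top hv hd hC hCc hz hFC hF⟩
  have hΦ : Measurable fun p : ℝ × Pt n => z + p.1 • (p.2 - z) := by fun_prop
  set ν := (((volume : Measure ℝ).restrict (Ioo (1 / 2 : ℝ) 1)).prod
    ((μHE[n - 1] : Measure (Pt n)).restrict F)).map fun p : ℝ × Pt n => z + p.1 • (p.2 - z) with hν
  have hle : ENNReal.ofReal d • ν ≤ (2 ^ (n - 1) : ℝ≥0∞) • volume.restrict C := by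
    refine Measure.le_iff.2 fun t ht => ?_
    rw [Measure.smul_apply, Measure.smul_apply, smul_eq_mul, smul_eq_mul,
      Measure.map_apply hΦ ht, Measure.prod_apply (hΦ ht), Measure.restrict_apply ht]
    refine le_trans (le_of_eq ?_) (cone_slices_le hv hd hC hCc.measurableSet hz hFC hF ht)
    congr 1
    refine lintegral_congr fun s => ?_
    rw [Measure.restrict_apply (measurable_prodMk_left (hΦ ht)), inter_comm]
    congr 2
    ext x
    simp [AffineMap.homothety_apply, add_comm]
  have h := lintegral_mono' hle (le_refl g)
  rw [lintegral_smul_measure, lintegral_smul_measure, smul_eq_mul, smul_eq_mul, hν,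
    lintegral_map hg hΦ, lintegral_prod_symm' (fun p : ℝ × Pt n => g (z + p.1 • (p.2 - z)))
      (hg.comp hΦ)] at h
  exact h

end Cone

/-! ### Geometry of simplices and their facets -/

section Simplex

variable {n : ℕ} {K : Finset (Pt n)}

theorem vectorSpan_ne_top_of_card_le {s : Finset (Pt n)} (hn : 0 < n) (hs : s.card ≤ n) :
    vectorSpan ℝ (s : Set (Pt n)) ≠ ⊤ := by
  classical
  intro h
  have hfr : Module.finrank ℝ (vectorSpan ℝ (s : Set (Pt n))) = n := by
    rw [h, finrank_top]; exact finrank_euclideanSpace_fin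
  rcases Nat.eq_zero_or_pos s.card with h0 | h0
  · rw [Finset.card_eq_zero] at h0
    subst h0
    rw [Finset.coe_empty, vectorSpan_empty, finrank_bot] at hfr
    omega
  · have := finrank_vectorSpan_image_finset_le ℝ (id : Pt n → Pt n) s
      (n := s.card - 1) (by omega)
    rw [Finset.image_id, hfr] at this
    omega

theorem isCompact_hull (s : Set (Pt n)) (hs : s.Finite) : IsCompact (convexHull ℝ s) :=
  hs.isCompact_convexHull (𝕜 := ℝ)

theorem facet_subset (z : Pt n) : facet K z ⊆ convexHull ℝ (K : Set (Pt n)) :=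
  convexHull_mono sdiff_subset

theorem isCompact_facet (z : Pt n) : IsCompact (facet K z) :=
  isCompact_hull _ (K.finite_toSet.subset sdiff_subset)

/-- Each facet lies in a hyperplane, at a distance from the opposite vertex that is at least the
radius of any ball in the simplex. -/
theorem exists_unit_normal (hn : 0 < n) (hK : K.card = n + 1) {c : Pt n} {ρ : ℝ} (hρ : 0 < ρ)
    (hball : Metric.ball c ρ ⊆ convexHull ℝ (K : Set (Pt n))) {z : Pt n} (hz : z ∈ K) :
    ∃ (v : Pt n) (d : ℝ), ‖v‖ = 1 ∧ ρ ≤ d ∧ ∀ x ∈ facet K z, inner ℝ v (x - z) = d := by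
  classical
  have hne : facetDir K z ≠ ⊤ := by
    have := vectorSpan_ne_top_of_card_le (s := K.erase z) hn (by
      rw [Finset.card_erase_of_mem hz, hK]; simp)
    rwa [Finset.coe_erase] at this
  obtain ⟨w, hw, hw0⟩ := Submodule.exists_mem_ne_zero_of_ne_bot
    (mt (Submodule.orthogonal_eq_bot_iff (K := facetDir K z)).1 hne)
  -- For a normal `u` of the facet, the function `x ↦ ⟨u, x - z⟩` vanishes at `z` and takes one
  -- value at all other vertices. With the sign of `u` chosen to make that value nonnegative, the
  -- simplex lies in the slab between `0` and it.
  have key : ∀ u : Pt n, ‖u‖ = 1 → u ∈ (facetDir K z)ᗮ → ∀ y₀ ∈ (K : Set (Pt n)) \ {z},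
      0 ≤ inner ℝ u (y₀ - z) → ρ ≤ inner ℝ u (y₀ - z) ∧
        ∀ x ∈ facet K z, inner ℝ u (x - z) = inner ℝ u (y₀ - z) := by
    intro u hu huo y₀ hy₀ h0
    have hv : ∀ y ∈ (K : Set (Pt n)) \ {z}, inner ℝ u (y - z) = inner ℝ u (y₀ - z) := by
      intro y hy
      have := (Submodule.mem_orthogonal' _ _).1 huo (y - y₀) (vsub_mem_vectorSpan ℝ hy hy₀)
      rw [← sub_eq_zero, ← inner_sub_right]
      simpa using this
    constructor
    · have hsub : convexHull ℝ (K : Set (Pt n)) ⊆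
          {x | 0 ≤ inner ℝ u (x - z) ∧ inner ℝ u (x - z) ≤ inner ℝ u (y₀ - z)} := by
        refine convexHull_min ?_ ?_
        · intro y hy
          by_cases hyz : y = z
          · simpa [hyz] using h0
          · have := hv y ⟨hy, hyz⟩
            simp [this, h0]
        · intro x hx y hy a b ha hb hab
          have e : inner ℝ u (a • x + b • y - z) = a * inner ℝ u (x - z) + b * inner ℝ u (y - z) := by
            rw [← inner_smul_right, ← inner_smul_right, ← inner_add_right]
            congr 1
            have : z = a • z + b • z := by rw [← add_smul, hab, one_smul]
            conv_lhs => rw [this]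
            module
          simp only [mem_ofPred_eq] at hx hy ⊢
          rw [e]
          constructor
          · have := mul_nonneg ha hx.1
            have := mul_nonneg hb hy.1
            linarith
          · have h1 := mul_le_mul_of_nonneg_left hx.2 ha
            have h2 := mul_le_mul_of_nonneg_left hy.2 hb
            calc _ ≤ (a + b) * inner ℝ u (y₀ - z) := by linarith
              _ = _ := by rw [hab, one_mul]
      -- Moving from the centre of the ball by `r` along `u` stays in the slab, so the slab has
      -- width at least `r`.
      have hlt : ∀ r, 0 < r → r < ρ → r ≤ inner ℝ u (y₀ - z) := by
        intro r hr0 hr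
        have h1 := hsub (hball (show c + r • u ∈ Metric.ball c ρ by
          simp [Metric.mem_ball, dist_eq_norm, norm_smul, hu, abs_of_pos hr0, hr]))
        have h2 := hsub (hball (Metric.mem_ball_self hρ))
        have e : inner ℝ u (c + r • u - z) = inner ℝ u (c - z) + r := by
          rw [show c + r • u - z = (c - z) + r • u by abel, inner_add_right, inner_smul_right,
            real_inner_self_eq_norm_sq, hu]
          ring
        have := h1.2
        rw [e] at this
        linarith [h2.1]
      refine le_of_forall_lt_imp_le_of_dense fun r hr => ?_
      rcases le_or_gt r 0 with h | h
      · exact h.trans h0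
      · exact hlt r h hr
    · intro x hx
      have : facet K z ⊆ {x | inner ℝ u (x - z) = inner ℝ u (y₀ - z)} := by
        refine convexHull_min hv ?_
        intro x hx y hy a b ha hb hab
        simp only [mem_ofPred_eq, inner_sub_right, inner_add_right, inner_smul_right] at hx hy ⊢
        have hx' : inner ℝ u x = inner ℝ u y₀ := by linarith
        have hy' : inner ℝ u y = inner ℝ u y₀ := by linarith
        rw [hx', hy', ← add_mul, hab, one_mul]
      exact this hx
  obtain ⟨y₀, hy₀⟩ : ∃ y₀, y₀ ∈ (K : Set (Pt n)) \ {z} := by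
    have : 0 < (K.erase z).card := by rw [Finset.card_erase_of_mem hz, hK]; omega
    obtain ⟨y, hy⟩ := Finset.card_pos.1 this
    exact ⟨y, by simpa [and_comm] using hy⟩
  have hnu : ‖(‖w‖⁻¹) • w‖ = 1 := by
    rw [norm_smul, norm_inv, norm_norm, inv_mul_cancel₀ (norm_ne_zero_iff.2 hw0)]
  have hmu : (‖w‖⁻¹) • w ∈ (facetDir K z)ᗮ := Submodule.smul_mem _ _ hw
  rcases le_total 0 (inner ℝ ((‖w‖⁻¹) • w) (y₀ - z)) with h | h
  · exact ⟨_, _, hnu, key _ hnu hmu y₀ hy₀ h⟩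
  · have h' : 0 ≤ inner ℝ (-((‖w‖⁻¹) • w)) (y₀ - z) := by rw [inner_neg_left]; linarith
    have hn' : ‖-((‖w‖⁻¹) • w)‖ = 1 := by rw [norm_neg, hnu]
    exact ⟨_, _, hn', key _ hn' (Submodule.neg_mem _ hmu) y₀ hy₀ h'⟩

theorem cell_ae_eq_hull : (cell K : Set (Pt n)) =ᵐ[volume] convexHull ℝ (K : Set (Pt n)) :=
  interior_ae_eq_of_null_frontier ((convex_convexHull ℝ _).addHaar_frontier volume)

theorem restrict_hull_eq : (volume : Measure (Pt n)).restrict (convexHull ℝ (K : Set (Pt n))) =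
    volume.restrict (cell K) := (Measure.restrict_congr_set cell_ae_eq_hull).symm

/-- Integration over a facet of the values on the rays from the opposite vertex. -/
theorem facet_lintegral_le (hn : 0 < n) (hK : K.card = n + 1) {c : Pt n} {ρ : ℝ} (hρ : 0 < ρ)
    (hball : Metric.ball c ρ ⊆ convexHull ℝ (K : Set (Pt n))) {z : Pt n} (hz : z ∈ K)
    {g : Pt n → ℝ≥0∞} (hg : Measurable g) :
    ENNReal.ofReal ρ * ∫⁻ x, (∫⁻ s in Ioo (1 / 2 : ℝ) 1, g (z + s • (x - z))) ∂facetMeasure K z ≤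
      2 ^ (n - 1) * ∫⁻ y in cell K, g y := by
  obtain ⟨v, d, hv, hd, hF⟩ := exists_unit_normal hn hK hρ hball hz
  have := cone_lintegral_le hv (hρ.trans_le hd) (convex_convexHull ℝ (K : Set (Pt n)))
    (isCompact_hull _ K.finite_toSet) (subset_convexHull ℝ _ hz) (facet_subset z)
    hF hg
  rw [restrict_hull_eq] at this
  refine le_trans ?_ this
  unfold facetMeasure
  gcongr

theorem isFiniteMeasure_facetMeasure (hn : 0 < n) (hK : K.card = n + 1) {c : Pt n} {ρ : ℝ}
    (hρ : 0 < ρ) (hball : Metric.ball c ρ ⊆ convexHull ℝ (K : Set (Pt n))) {z : Pt n}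
    (hz : z ∈ K) : IsFiniteMeasure (facetMeasure K z) := by
  obtain ⟨v, d, hv, hd, hF⟩ := exists_unit_normal hn hK hρ hball hz
  refine ⟨?_⟩
  rw [facetMeasure, Measure.restrict_apply_univ]
  exact cone_measure_lt_top hv (hρ.trans_le hd) (convex_convexHull ℝ (K : Set (Pt n)))
    (isCompact_hull _ K.finite_toSet) (subset_convexHull ℝ _ hz) (facet_subset z) hF

theorem isOpen_cell : IsOpen (cell K) := isOpen_interior

theorem convex_cell : Convex ℝ (cell K) := (convex_convexHull ℝ _).interior

theorem isBounded_hull : Bornology.IsBounded (convexHull ℝ (K : Set (Pt n))) :=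
  (isCompact_hull _ K.finite_toSet).isBounded

theorem isBounded_cell : Bornology.IsBounded (cell K) := isBounded_hull.subset interior_subset

theorem ball_subset_cell {c : Pt n} {ρ : ℝ}
    (hball : Metric.ball c ρ ⊆ convexHull ℝ (K : Set (Pt n))) : Metric.ball c ρ ⊆ cell K :=
  interior_maximal hball Metric.isOpen_ball

theorem dist_le_cellDiam {x y : Pt n} (hx : x ∈ convexHull ℝ (K : Set (Pt n)))
    (hy : y ∈ convexHull ℝ (K : Set (Pt n))) : dist x y ≤ cellDiam K :=
  Metric.dist_le_diam_of_mem isBounded_hull hx hy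

theorem cellDiam_pos (hn : 0 < n) {c : Pt n} {ρ : ℝ} (hρ : 0 < ρ)
    (hball : Metric.ball c ρ ⊆ convexHull ℝ (K : Set (Pt n))) : 0 < cellDiam K := by
  let e : Pt n := stdVec ⟨0, hn⟩
  have he : ‖e‖ = 1 := (EuclideanSpace.basisFun (Fin n) ℝ).norm_eq_one _
  have h1 : c + (ρ / 2) • e ∈ Metric.ball c ρ := by
    simp [Metric.mem_ball, dist_eq_norm, norm_smul, he, abs_of_pos hρ]; linarith
  have := dist_le_cellDiam (hball h1) (hball (Metric.mem_ball_self hρ))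
  simp [dist_eq_norm, norm_smul, he, abs_of_pos hρ] at this
  linarith

/-- Distinct simplices share at most `n` vertices, so by conformity the intersection of their
interiors lies in a proper affine subspace. It is open and null, hence empty. -/
theorem disjoint_cell (hn : 0 < n) {K L : Finset (Pt n)} (hK : K.card = n + 1)
    (hL : L.card = n + 1) (hKL : K ≠ L)
    (hc : convexHull ℝ (K : Set (Pt n)) ∩ convexHull ℝ (L : Set (Pt n)) =
      convexHull ℝ ((K : Set (Pt n)) ∩ (L : Set (Pt n)))) : Disjoint (cell K) (cell L) := by
  classical
  rw [Set.disjoint_iff_inter_eq_empty]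
  by_contra hne
  have hopen : IsOpen (cell K ∩ cell L) := isOpen_cell.inter isOpen_cell
  have hpos := hopen.measure_pos volume (Set.nonempty_iff_ne_empty.2 hne)
  have hcard : (K ∩ L).card ≤ n := by
    have h1 : K ∩ L ⊂ K := by
      refine Finset.ssubset_iff_subset_ne.2 ⟨Finset.inter_subset_left, fun h => hKL ?_⟩
      exact Finset.eq_of_subset_of_card_le (Finset.inter_eq_left.1 h) (by omega)
    have := Finset.card_lt_card h1
    omega
  have hsub : cell K ∩ cell L ⊆ affineSpan ℝ ((K ∩ L : Finset (Pt n)) : Set (Pt n)) := by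
    refine (inter_subset_inter interior_subset interior_subset).trans ?_
    rw [hc, Finset.coe_inter]
    exact convexHull_subset_affineSpan _
  have hne' : affineSpan ℝ ((K ∩ L : Finset (Pt n)) : Set (Pt n)) ≠ ⊤ := by
    intro h
    apply vectorSpan_ne_top_of_card_le hn hcard
    rw [← direction_affineSpan, h, AffineSubspace.direction_top]
  have := measure_mono_null hsub (Measure.addHaar_affineSubspace volume _ hne')
  exact hpos.ne' this

end Simplex

/-! ### Vector-valued polynomials and their restriction to lines -/

section PolySpan

variable {n : ℕ} {E : Type*} [NormedAddCommGroup E] [NormedSpace ℝ E]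

/-- Polynomial functions of degree at most `R` on `ℝⁿ` with values in `E`. -/
def polySpan (n R : ℕ) (E : Type*) [NormedAddCommGroup E] [NormedSpace ℝ E] :
    Submodule ℝ (Pt n → E) :=
  Submodule.span ℝ {f | ∃ p : MvPolynomial (Fin n) ℝ, p.totalDegree ≤ R ∧ ∃ e : E,
    f = fun x : Pt n => MvPolynomial.eval (fun i => x i) p • e}

theorem polySpan_mono {R S : ℕ} (h : R ≤ S) : polySpan n R E ≤ polySpan n S E :=
  Submodule.span_mono fun _ ⟨p, hp, e, hf⟩ => ⟨p, hp.trans h, e, hf⟩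

theorem contDiff_mvPolynomial_eval (p : MvPolynomial (Fin n) ℝ) :
    ContDiff ℝ ∞ fun x : Pt n => MvPolynomial.eval (fun i => x i) p := by
  induction p using MvPolynomial.induction_on with
  | C a => simpa using contDiff_const
  | add p q hp hq => simpa using hp.add hq
  | mul_X p i hp =>
    simp only [map_mul, MvPolynomial.eval_X]
    exact hp.mul (EuclideanSpace.proj (𝕜 := ℝ) i).contDiff

theorem contDiff_of_mem_polySpan {R : ℕ} {q : Pt n → E} (hq : q ∈ polySpan n R E) :
    ContDiff ℝ ∞ q := by
  induction hq using Submodule.span_induction with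
  | mem f hf =>
    obtain ⟨p, -, e, rfl⟩ := hf
    exact (contDiff_mvPolynomial_eval p).smul contDiff_const
  | zero => exact contDiff_const
  | add f g _ _ hf hg => exact hf.add hg
  | smul a f _ hf => exact contDiff_const.smul hf

/-- On each line a polynomial function is a polynomial in the parameter. -/
theorem exists_coeff_on_line {R : ℕ} {q : Pt n → E} (hq : q ∈ polySpan n R E) (z d : Pt n) :
    ∃ a : Fin (R + 1) → E, ∀ s : ℝ, q (z + s • d) = ∑ i : Fin (R + 1), s ^ (i : ℕ) • a i := by
  induction hq using Submodule.span_induction with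
  | mem f hf =>
    obtain ⟨p, hp, e, rfl⟩ := hf
    -- Substituting polynomials of degree at most one for the variables does not raise the degree.
    let P : Polynomial ℝ := MvPolynomial.aeval
      (fun i => Polynomial.C (z i) + Polynomial.X * Polynomial.C (d i)) p
    have hP : P.natDegree ≤ R := by
      have := MvPolynomial.aeval_natDegree_le p hp
        (fun i => Polynomial.C (z i) + Polynomial.X * Polynomial.C (d i)) (n := 1) (fun i => by
          compute_degree)
      simpa only [mul_one] using this
    refine ⟨fun i => P.coeff i • e, fun s => ?_⟩
    have h1 : MvPolynomial.eval (fun i => (z + s • d) i) p = P.eval s := by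
      change _ = (Polynomial.evalRingHom s) (MvPolynomial.aeval _ p)
      rw [MvPolynomial.aeval_def, MvPolynomial.hom_eval₂]
      have hc : (Polynomial.evalRingHom s).comp (algebraMap ℝ (Polynomial ℝ)) = RingHom.id ℝ := by
        ext; simp
      rw [hc, MvPolynomial.eval₂_id]
      congr 2
      ext i
      simp
      ring
    change MvPolynomial.eval (fun i => (z + s • d) i) p • e = ∑ i : Fin (R + 1), s ^ (i : ℕ) • P.coeff i • e
    rw [h1, Polynomial.eval_eq_sum_range' (Nat.lt_succ_of_le hP), Finset.sum_smul,
      Finset.sum_range]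
    refine Finset.sum_congr rfl fun i _ => ?_
    rw [mul_comm, mul_smul]
  | zero => exact ⟨0, fun s => by simp⟩
  | add f g _ _ hf hg =>
    obtain ⟨a, ha⟩ := hf
    obtain ⟨b, hb⟩ := hg
    exact ⟨a + b, fun s => by simp [ha, hb, Finset.sum_add_distrib]⟩
  | smul c f _ hf =>
    obtain ⟨a, ha⟩ := hf
    exact ⟨c • a, fun s => by simp [ha, Finset.smul_sum, smul_comm c]⟩

/-- Continuous linear functionals reduce the claim to real polynomials, which have finitely many
roots unless they vanish. -/
theorem eq_zero_of_forall_sum_pow_smul_eq_zero {R : ℕ} {a : Fin (R + 1) → E} {S : Set ℝ}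
    (hS : S.Infinite) (h : ∀ s ∈ S, ∑ i : Fin (R + 1), s ^ (i : ℕ) • a i = 0) : a = 0 := by
  ext i
  refine (SeparatingDual.eq_zero_iff_forall_dual_eq_zero (R := ℝ) (a i)).2 fun f => ?_
  let P : Polynomial ℝ := ∑ j : Fin (R + 1), Polynomial.monomial (j : ℕ) (f (a j))
  have hP : P = 0 := by
    refine Polynomial.eq_zero_of_infinite_isRoot _ (hS.mono fun s hs => ?_)
    have := congrArg f (h s hs)
    simp only [map_sum, map_smul, map_zero, smul_eq_mul] at this
    simp only [P, mem_ofPred_eq, Polynomial.IsRoot, Polynomial.eval_finsetSum,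
      Polynomial.eval_monomial]
    rw [← this]
    exact Finset.sum_congr rfl fun _ _ => mul_comm _ _
  have := congrArg (fun Q => Q.coeff (i : ℕ)) hP
  simpa [P, Polynomial.finsetSum_coeff, Polynomial.coeff_monomial, Fin.val_inj] using this

theorem eLpNorm_two_sq {X E : Type*} [MeasurableSpace X] [NormedAddCommGroup E] (f : X → E) (μ : Measure X) :
    eLpNorm f 2 μ ^ 2 = ∫⁻ x, ‖f x‖ₑ ^ 2 ∂μ := by
  rw [eLpNorm_eq_lintegral_rpow_enorm_toReal (by norm_num) (by norm_num), ← ENNReal.rpow_natCast,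
    ← ENNReal.rpow_mul]
  simp

variable (E) in
/-- The value of a polynomial at `1` is bounded by its `L²` norm on `(1/2, 1)`. -/
theorem exists_eval_one_le [FiniteDimensional ℝ E] (R : ℕ) : ∃ C : ℝ, 0 < C ∧
    ∀ a : Fin (R + 1) → E, ‖∑ i, a i‖ₑ ^ 2 ≤
      ENNReal.ofReal C * ∫⁻ s in Ioo (1 / 2 : ℝ) 1, ‖∑ i : Fin (R + 1), s ^ (i : ℕ) • a i‖ₑ ^ 2 := by
  set μ : Measure ℝ := volume.restrict (Ioo (1 / 2 : ℝ) 1) with hμ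
  have hcont : ∀ a : Fin (R + 1) → E, Continuous fun s : ℝ => ∑ i : Fin (R + 1), s ^ (i : ℕ) • a i :=
    fun a => by fun_prop
  have hmem : ∀ a : Fin (R + 1) → E, MemLp (fun s : ℝ => ∑ i : Fin (R + 1), s ^ (i : ℕ) • a i) 2 μ := by
    intro a
    obtain ⟨M, hM⟩ := (isCompact_Icc (a := (1 / 2 : ℝ)) (b := 1)).exists_bound_of_continuousOn
      (hcont a).continuousOn
    refine MemLp.of_bound (hcont a).aestronglyMeasurable M ?_
    filter_upwards [ae_restrict_mem measurableSet_Ioo] with s hs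
    exact hM s (Ioo_subset_Icc_self hs)
  let A : (Fin (R + 1) → E) →ₗ[ℝ] Lp E 2 μ :=
    { toFun := fun a => (hmem a).toLp
      map_add' := fun a b => by
        rw [← MemLp.toLp_add]
        exact MemLp.toLp_congr _ _ (ae_of_all _ fun s => by simp [Finset.sum_add_distrib])
      map_smul' := fun c a => by
        rw [RingHom.id_apply, ← MemLp.toLp_const_smul]
        exact MemLp.toLp_congr _ _
          (ae_of_all _ fun s => by simp [Finset.smul_sum, smul_comm c]) }
  have hker : A.ker = ⊥ := by
    rw [LinearMap.ker_eq_bot']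
    intro a ha
    have h0 : (fun s : ℝ => ∑ i : Fin (R + 1), s ^ (i : ℕ) • a i) =ᵐ[μ] 0 :=
      (MemLp.toLp_eq_toLp_iff (hmem a) MemLp.zero).1 (by simpa [A] using ha)
    have h1 : EqOn (fun s : ℝ => ∑ i : Fin (R + 1), s ^ (i : ℕ) • a i) 0 (Ioo (1 / 2 : ℝ) 1) :=
      Measure.eqOn_open_of_ae_eq h0 isOpen_Ioo (hcont a).continuousOn continuousOn_const
    exact eq_zero_of_forall_sum_pow_smul_eq_zero (Ioo_infinite (by norm_num)) h1
  obtain ⟨L, hL, h⟩ := A.exists_antilipschitzWith hker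
  -- The value at `1` is the sum of `R + 1` coefficients, each at most the sup norm, which is at
  -- most `L` times the `L²` norm.
  refine ⟨((R + 1) * L) ^ 2, by positivity, fun a => ?_⟩
  have h1 : ‖a‖ ≤ L * ‖A a‖ := by simpa using h.le_mul_dist a 0
  have h2 : ‖∑ i, a i‖ ≤ (R + 1) * L * ‖A a‖ := by
    calc _ ≤ ∑ i, ‖a i‖ := norm_sum_le _ _
      _ ≤ ∑ _i : Fin (R + 1), ‖a‖ := Finset.sum_le_sum fun i _ => norm_le_pi_norm a i
      _ = (R + 1) * ‖a‖ := by simp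
      _ ≤ (R + 1) * (L * ‖A a‖) := by gcongr
      _ = _ := by ring
  have h3 : ‖A a‖ₑ = eLpNorm (fun s : ℝ => ∑ i : Fin (R + 1), s ^ (i : ℕ) • a i) 2 μ := Lp.enorm_toLp (hmem a)
  rw [← eLpNorm_two_sq, ← h3, ← ofReal_norm, ← ofReal_norm, ← ENNReal.ofReal_pow (by positivity),
    ← ENNReal.ofReal_pow (by positivity), ← ENNReal.ofReal_mul (by positivity), ← mul_pow]
  gcongr

end PolySpan

/-! ### The finite element shape functions have polynomial coefficients -/

section PolyForms

variable {n k : ℕ}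

/-- A form is recovered linearly from its values on increasing tuples of basis vectors, so
polynomial values yield a polynomial with values in forms. -/
theorem polyForms_subset_polySpan (r : ℕ) :
    polyForms n r k ⊆ (polySpan n r (Alt (Pt n) k) : Set (Form n k)) := by
  intro v hv
  choose p hp hv using hv
  let b := (EuclideanSpace.basisFun (Fin n) ℝ).toBasis
  let ev : Alt (Pt n) k →ₗ[ℝ] ((Fin k ↪o Fin n) → ℝ) :=
    { toFun := fun α I => α (fun a => stdVec (I a))
      map_add' := fun _ _ => rfl
      map_smul' := fun _ _ => rfl }
  have hinj : Function.Injective ev := fun α β h =>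
    alt_ext_of_basis b fun I => by
      rw [OrthonormalBasis.coe_toBasis]
      exact congrFun h I
  obtain ⟨L, hL⟩ := ev.exists_leftInverse_of_injective (LinearMap.ker_eq_bot.2 hinj)
  have hform : v = ∑ I : Fin k ↪o Fin n, fun x : Pt n =>
      MvPolynomial.eval (fun i => x i) (p I) • L (Pi.single I 1) := by
    ext1 x
    have h1 : v x = L (ev (v x)) := by
      rw [← LinearMap.comp_apply, hL, LinearMap.id_apply]
    have h2 : ev (v x) = ∑ I, ev (v x) I • Pi.single I (1 : ℝ) := by
      ext J
      simp [Finset.sum_apply, Pi.single_apply]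
    rw [h1, h2, map_sum, Finset.sum_apply]
    refine Finset.sum_congr rfl fun I _ => ?_
    rw [map_smul]
    congr 1
    exact hv I x
  rw [hform]
  exact Submodule.sum_mem _ fun I _ => Submodule.subset_span ⟨p I, hp I, _, rfl⟩

/-- Expanding `x = ∑ xᵢ eᵢ` in the contraction multiplies each coefficient by one more coordinate.
-/
theorem koszul_mem_polySpan {r : ℕ} {b : Form n (k + 1)}
    (hb : b ∈ polySpan n r (Alt (Pt n) (k + 1))) :
    koszul b ∈ polySpan n (r + 1) (Alt (Pt n) k) := by
  induction hb using Submodule.span_induction with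
  | mem f hf =>
    obtain ⟨p, hp, e, rfl⟩ := hf
    have : (koszul fun x : Pt n => MvPolynomial.eval (fun i => x i) p • e) =
        ∑ i : Fin n, fun x : Pt n =>
          MvPolynomial.eval (fun i => x i) (p * MvPolynomial.X i) • e.curryLeft (stdVec i) := by
      ext1 x
      have hx : x = ∑ i, x i • stdVec i := by
        have := (EuclideanSpace.basisFun (Fin n) ℝ).sum_repr x
        simpa using this.symm
      rw [Finset.sum_apply]
      have hcx : e.curryLeft x = ∑ i, x i • e.curryLeft (stdVec i) := by
        conv_lhs => rw [hx]
        rw [map_sum]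
        exact Finset.sum_congr rfl fun i _ => map_smul _ _ _
      have h1 : koszul (fun x : Pt n => MvPolynomial.eval (fun i => x i) p • e) x =
          MvPolynomial.eval (fun i => x i) p • e.curryLeft x := by
        ext m
        simp [koszul]
      rw [h1, hcx, Finset.smul_sum]
      refine Finset.sum_congr rfl fun i _ => ?_
      rw [smul_smul, map_mul, MvPolynomial.eval_X]
    rw [this]
    refine Submodule.sum_mem _ fun i _ => Submodule.subset_span ⟨_, ?_, _, rfl⟩
    refine (MvPolynomial.totalDegree_mul _ _).trans ?_
    simpa using hp
  | zero =>
    convert Submodule.zero_mem _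
    ext x m
    simp [koszul]
  | add f g _ _ hf hg =>
    have : koszul (f + g) = koszul f + koszul g := by ext x m; simp [koszul]
    rw [this]
    exact Submodule.add_mem _ hf hg
  | smul a f _ hf =>
    have : koszul (a • f) = a • koszul f := by ext x m; simp [koszul]
    rw [this]
    exact Submodule.smul_mem _ _ hf

theorem polyFormsMinus_subset_polySpan (r : ℕ) :
    polyFormsMinus n (r + 1) k ⊆ (polySpan n (r + 1) (Alt (Pt n) k) : Set (Form n k)) := by
  rintro v ⟨a, ha, b, hb, rfl⟩
  exact Submodule.add_mem _ (polySpan_mono (Nat.le_succ r) (polyForms_subset_polySpan r ha))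
    (koszul_mem_polySpan (polyForms_subset_polySpan r hb))

end PolyForms

/-! ### Inverse trace inequality for polynomials -/

section FacetEstimates

variable {n : ℕ} {E : Type*} [NormedAddCommGroup E] [NormedSpace ℝ E]

/-- `K` is the vertex set of an `n`-simplex that is shape-regular with constant `γ`. -/
structure IsRegularSimplex (γ : ℝ) (K : Finset (Pt n)) : Prop where
  card : K.card = n + 1
  ball : ∃ (c : Pt n) (ρ : ℝ), 0 < ρ ∧
    Metric.ball c ρ ⊆ convexHull ℝ (K : Set (Pt n)) ∧ cellDiam K ≤ γ * ρ

theorem IsRegularSimplex.cellDiam_pos {γ : ℝ} {K : Finset (Pt n)} (hn : 0 < n)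
    (hK : IsRegularSimplex γ K) : 0 < cellDiam K := by
  obtain ⟨c, ρ, hρ, hb, -⟩ := hK.ball
  exact TanTrace.cellDiam_pos hn hρ hb

theorem IsRegularSimplex.pos {γ : ℝ} {K : Finset (Pt n)} (hn : 0 < n)
    (hK : IsRegularSimplex γ K) : 0 < γ := by
  obtain ⟨c, ρ, hρ, hb, h⟩ := hK.ball
  have := TanTrace.cellDiam_pos hn hρ hb
  exact pos_of_mul_pos_left (this.trans_le h) hρ.le

/-- Integration over a facet of the values on the rays from the opposite vertex. -/
theorem IsRegularSimplex.facet_lintegral_le {γ : ℝ} {K : Finset (Pt n)} (hn : 0 < n)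
    (hK : IsRegularSimplex γ K) {z : Pt n} (hz : z ∈ K) {g : Pt n → ℝ≥0∞} (hg : Measurable g) :
    ENNReal.ofReal (cellDiam K) *
        ∫⁻ x, (∫⁻ s in Ioo (1 / 2 : ℝ) 1, g (z + s • (x - z))) ∂facetMeasure K z ≤
      ENNReal.ofReal (γ * 2 ^ (n - 1)) * ∫⁻ y in cell K, g y := by
  obtain ⟨c, ρ, hρ, hb, h⟩ := hK.ball
  have hγ := hK.pos hn
  have := TanTrace.facet_lintegral_le hn hK.card hρ hb hz hg
  refine (mul_le_mul_left (ENNReal.ofReal_le_ofReal h) _).trans ?_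
  rw [ENNReal.ofReal_mul hγ.le, mul_assoc, ENNReal.ofReal_mul hγ.le, mul_assoc,
    ENNReal.ofReal_pow (by norm_num), ENNReal.ofReal_ofNat]
  exact mul_le_mul_right this _

theorem sqrt_mul_le_of_mul_sq_le {h c : ℝ} (hh : 0 ≤ h) (hc : 0 ≤ c) {a b : ℝ≥0∞}
    (hab : ENNReal.ofReal h * a ^ 2 ≤ ENNReal.ofReal c * b ^ 2) :
    ENNReal.ofReal (h ^ (1 / 2 : ℝ)) * a ≤ ENNReal.ofReal (c ^ (1 / 2 : ℝ)) * b := by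
  have h1 : ∀ x : ℝ, 0 ≤ x → ∀ y : ℝ≥0∞,
      (ENNReal.ofReal x * y ^ 2) ^ (1 / 2 : ℝ) = ENNReal.ofReal (x ^ (1 / 2 : ℝ)) * y := by
    intro x hx y
    rw [ENNReal.mul_rpow_of_nonneg _ _ (by norm_num), ENNReal.ofReal_rpow_of_nonneg hx (by norm_num),
      ← ENNReal.rpow_natCast, ← ENNReal.rpow_mul]
    simp
  rw [← h1 h hh, ← h1 c hc]
  exact ENNReal.rpow_le_rpow hab (by norm_num)

variable (E) in
/-- Inverse trace estimate: the `L²` norm of a polynomial on a facet is bounded by its `L²` norm on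
the simplex. -/
theorem exists_poly_facet_le [FiniteDimensional ℝ E] (hn : 0 < n) (R : ℕ) (γ : ℝ) :
    ∃ C : ℝ, 0 < C ∧ ∀ (K : Finset (Pt n)), IsRegularSimplex γ K → ∀ z ∈ K,
      ∀ q ∈ polySpan n R E,
        ENNReal.ofReal (cellDiam K ^ (1 / 2 : ℝ)) * eLpNorm q 2 (facetMeasure K z) ≤
          ENNReal.ofReal C * eLpNorm q 2 (volume.restrict (cell K)) := by
  obtain ⟨C, hC, h⟩ := exists_eval_one_le E R
  -- Positivity of `γ` follows only once a regular simplex is given; `max γ 1` keeps the constant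
  -- positive beforehand.
  refine ⟨(C * (max γ 1 * 2 ^ (n - 1))) ^ (1 / 2 : ℝ), by positivity, fun K hK z hz q hq => ?_⟩
  have hγ := hK.pos hn
  refine sqrt_mul_le_of_mul_sq_le (hK.cellDiam_pos hn).le (by positivity) ?_
  have hqc := (contDiff_of_mem_polySpan hq).continuous
  rw [eLpNorm_two_sq, eLpNorm_two_sq]
  -- Along the ray from `z`, the parameter `s = 1` is the point `x` itself, so the one-dimensional
  -- bound for the value at `1` applies.
  have hpt : ∀ x, ‖q x‖ₑ ^ 2 ≤ ENNReal.ofReal C *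
      ∫⁻ s in Ioo (1 / 2 : ℝ) 1, ‖q (z + s • (x - z))‖ₑ ^ 2 := by
    intro x
    obtain ⟨a, ha⟩ := exists_coeff_on_line hq z (x - z)
    have h1 := ha 1
    simp only [one_smul, one_pow, add_sub_cancel] at h1
    simp only [ha]
    rw [h1]
    exact h a
  calc _ ≤ ENNReal.ofReal (cellDiam K) * ∫⁻ x, ENNReal.ofReal C *
        (∫⁻ s in Ioo (1 / 2 : ℝ) 1, ‖q (z + s • (x - z))‖ₑ ^ 2) ∂facetMeasure K z := by
        gcongr
        exact hpt _
    _ = ENNReal.ofReal C * (ENNReal.ofReal (cellDiam K) * ∫⁻ x,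
        (∫⁻ s in Ioo (1 / 2 : ℝ) 1, ‖q (z + s • (x - z))‖ₑ ^ 2) ∂facetMeasure K z) := by
        rw [lintegral_const_mul' _ _ (by simp), mul_left_comm]
    _ ≤ ENNReal.ofReal C * (ENNReal.ofReal (γ * 2 ^ (n - 1)) *
        ∫⁻ y in cell K, ‖q y‖ₑ ^ 2) := by
        exact mul_le_mul_right (hK.facet_lintegral_le hn hz (g := fun y => ‖q y‖ₑ ^ 2)
          (hqc.enorm.measurable.pow_const 2)) _
    _ ≤ _ := by
        rw [← mul_assoc, ← ENNReal.ofReal_mul hC.le]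
        gcongr
        exact le_max_left _ _

end FacetEstimates

/-! ### Integral inequalities and integrals over convex combinations -/

section Aux

theorem sq_lintegral_le_mul {X : Type*} [MeasurableSpace X] {μ : Measure X}
    {f : X → ℝ≥0∞} (hf : AEMeasurable f μ) :
    (∫⁻ x, f x ∂μ) ^ 2 ≤ μ univ * ∫⁻ x, f x ^ 2 ∂μ := by
  have h := ENNReal.lintegral_mul_le_Lp_mul_Lq μ Real.HolderConjugate.two_two hf
    (aemeasurable_const (b := (1 : ℝ≥0∞)))
  simp only [ENNReal.rpow_ofNat, one_pow, lintegral_const, one_mul, Pi.mul_apply, mul_one] at h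
  calc _ ≤ ((∫⁻ x, f x ^ 2 ∂μ) ^ (1 / 2 : ℝ) * μ univ ^ (1 / 2 : ℝ)) ^ 2 := by gcongr
    _ = _ := by
      rw [mul_pow, ← ENNReal.rpow_natCast, ← ENNReal.rpow_mul, ← ENNReal.rpow_natCast,
        ← ENNReal.rpow_mul, mul_comm]
      simp

theorem sq_lintegral_le {X : Type*} [MeasurableSpace X] {μ : Measure X} (hμ : μ univ ≤ 1)
    {f : X → ℝ≥0∞} (hf : AEMeasurable f μ) : (∫⁻ x, f x ∂μ) ^ 2 ≤ ∫⁻ x, f x ^ 2 ∂μ :=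
  (sq_lintegral_le_mul hf).trans (mul_le_of_le_one_left zero_le hμ)

theorem add_sq_le_two_mul (a b : ℝ≥0∞) : (a + b) ^ 2 ≤ 2 * (a ^ 2 + b ^ 2) := by
  have := ENNReal.rpow_add_le_mul_rpow_add_rpow a b (p := 2) (by norm_num)
  norm_num at this
  exact this

theorem add_sq_le_sq_add (a b : ℝ≥0∞) : a ^ 2 + b ^ 2 ≤ (a + b) ^ 2 := by
  rw [add_sq']
  exact le_self_add

variable {n : ℕ}

theorem lintegral_comp_affine {s : ℝ} (hs : 0 < s) (c : Pt n) {f : Pt n → ℝ≥0∞}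
    (hf : Measurable f) :
    ∫⁻ y, f (c + s • y) = ENNReal.ofReal ((s ^ n)⁻¹) * ∫⁻ y, f y := by
  have h := Measure.map_addHaar_smul (volume : Measure (Pt n)) hs.ne'
  rw [finrank_euclideanSpace_fin, abs_of_pos (by positivity)] at h
  have hg : Measurable fun y => f (c + y) := by fun_prop
  calc _ = ∫⁻ y, f (c + y) ∂(Measure.map (s • ·) (volume : Measure (Pt n))) := by
        rw [lintegral_map hg (by fun_prop)]
    _ = _ := by
        rw [h, lintegral_smul_measure, lintegral_add_left_eq_self, smul_eq_mul]

theorem lintegral_convex_comb_le {U : Set (Pt n)} (hU : Convex ℝ U) (hUm : MeasurableSet U)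
    {s : ℝ} (hs : s ∈ Ioo (0 : ℝ) 1) {x : Pt n} (hx : x ∈ U) {g : Pt n → ℝ≥0∞}
    (hg : Measurable g) :
    ∫⁻ y in U, g ((1 - s) • x + s • y) ≤ ENNReal.ofReal ((s ^ n)⁻¹) * ∫⁻ y in U, g y := by
  rw [← lintegral_indicator hUm g, ← lintegral_comp_affine hs.1 _ (hg.indicator hUm),
    ← lintegral_indicator hUm]
  refine lintegral_mono fun y => ?_
  by_cases hy : y ∈ U
  · rw [indicator_of_mem hy, indicator_of_mem]
    exact hU hx hy (by linarith [hs.2]) hs.1.le (by ring)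
  · rw [indicator_of_notMem hy]
    exact zero_le

/-- The substitution `y ↦ (1 - s) x + s y` costs a Jacobian `s^(-n)`, at most `2^n` when `s ≥ 1/2`.
For smaller `s`, the roles of `x` and `y` are exchanged. -/
theorem lintegral_lintegral_convex_comb_le {U : Set (Pt n)} (hU : Convex ℝ U)
    (hUm : MeasurableSet U) {s : ℝ} (hs : s ∈ Ioo (0 : ℝ) 1) {g : Pt n → ℝ≥0∞}
    (hg : Measurable g) :
    ∫⁻ x in U, ∫⁻ y in U, g ((1 - s) • x + s • y) ≤
      2 ^ n * volume U * ∫⁻ y in U, g y := by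
  have key : ∀ t ∈ Ioo (0 : ℝ) 1, 1 / 2 ≤ t →
      ∫⁻ x in U, ∫⁻ y in U, g ((1 - t) • x + t • y) ≤ 2 ^ n * volume U * ∫⁻ y in U, g y := by
    intro t ht ht2
    calc _ ≤ ∫⁻ x in U, 2 ^ n * ∫⁻ y in U, g y := by
          refine setLIntegral_mono' hUm fun x hx => ?_
          refine (lintegral_convex_comb_le hU hUm ht hx hg).trans ?_
          gcongr
          rw [← inv_pow, ENNReal.ofReal_pow (inv_nonneg.2 ht.1.le)]
          gcongr
          rw [← ENNReal.ofReal_ofNat]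
          refine ENNReal.ofReal_le_ofReal ?_
          rw [inv_le_comm₀ ht.1 (by norm_num)]
          linarith
      _ = _ := by
          rw [setLIntegral_const]
          ring
  rcases le_total (1 / 2) s with h | h
  · exact key s hs h
  · rw [lintegral_lintegral_swap (by fun_prop)]
    have := key (1 - s) ⟨by linarith [hs.2], by linarith [hs.1]⟩ (by linarith)
    simpa [add_comm] using this

end Aux

/-! ### Poincaré and trace inequalities for smooth functions -/

section Smooth

variable {n : ℕ} {E : Type*} [NormedAddCommGroup E] [NormedSpace ℝ E]

/-- The sum of the norms of the first partial derivatives. -/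
def gradSum (w : Pt n → E) (x : Pt n) : ℝ := ∑ j, ‖fderiv ℝ w x (stdVec j)‖

theorem continuous_gradSum {w : Pt n → E} (hw : ContDiff ℝ 1 w) : Continuous (gradSum w) := by
  have := hw.continuous_fderiv (by norm_num)
  unfold gradSum
  fun_prop

theorem norm_fderiv_le_gradSum (w : Pt n → E) (x d : Pt n) :
    ‖fderiv ℝ w x d‖ ≤ ‖d‖ * gradSum w x := by
  have hd : d = ∑ i, d i • stdVec i := by
    have := (EuclideanSpace.basisFun (Fin n) ℝ).sum_repr d
    simpa using this.symm
  conv_lhs => rw [hd]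
  rw [map_sum, gradSum, Finset.mul_sum]
  refine (norm_sum_le _ _).trans (Finset.sum_le_sum fun i _ => ?_)
  rw [map_smul, norm_smul]
  gcongr
  exact PiLp.norm_apply_le d i

theorem eLpNorm_gradSum_le {w : Pt n → E} (hw : ContDiff ℝ 1 w) (μ : Measure (Pt n)) :
    eLpNorm (gradSum w) 2 μ ≤ ∑ j, eLpNorm (fun x => fderiv ℝ w x (stdVec j)) 2 μ := by
  have hc := hw.continuous_fderiv (by norm_num)
  have h : gradSum w = ∑ j : Fin n, fun x => ‖fderiv ℝ w x (stdVec j)‖ := by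
    ext x; simp [gradSum]
  rw [h]
  refine (eLpNorm_sum_le (fun j _ => ?_) (by norm_num)).trans
    (Finset.sum_le_sum fun j _ => (eLpNorm_norm _).le)
  exact (by fun_prop : Continuous _).aestronglyMeasurable

variable [FiniteDimensional ℝ E]

/-- Increments of a smooth function along a segment. -/
theorem enorm_sub_le_lintegral {w : Pt n → E} (hw : ContDiff ℝ 1 w) {h : ℝ} (z d : Pt n)
    (hd : ‖d‖ ≤ h) {a b : ℝ} (hab : a ≤ b) :
    ‖w (z + b • d) - w (z + a • d)‖ₑ ≤
      ENNReal.ofReal h * ∫⁻ s in Ioo a b, ‖gradSum w (z + s • d)‖ₑ := by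
  have hder : ∀ s : ℝ, HasDerivAt (fun s : ℝ => w (z + s • d)) (fderiv ℝ w (z + s • d) d) s := by
    intro s
    have h1 : HasDerivAt (fun s : ℝ => z + s • d) d s := by
      simpa using ((hasDerivAt_id s).smul_const d).const_add z
    exact ((hw.differentiable (by norm_num)) _).hasFDerivAt.comp_hasDerivAt s h1
  have hcont : Continuous fun s : ℝ => fderiv ℝ w (z + s • d) d := by
    have := hw.continuous_fderiv (by norm_num)
    fun_prop
  rw [← intervalIntegral.integral_eq_sub_of_hasDerivAt (fun s _ => hder s)
    (hcont.intervalIntegrable _ _), intervalIntegral.integral_of_le hab,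
    integral_Ioc_eq_integral_Ioo]
  refine (enorm_integral_le_lintegral_enorm _).trans ?_
  rw [← lintegral_const_mul' _ _ (by simp)]
  refine lintegral_mono fun s => ?_
  have h0 : 0 ≤ gradSum w (z + s • d) := Finset.sum_nonneg fun _ _ => norm_nonneg _
  rw [Real.enorm_of_nonneg h0, ← ENNReal.ofReal_mul ((norm_nonneg d).trans hd), ← ofReal_norm]
  refine ENNReal.ofReal_le_ofReal ((norm_fderiv_le_gradSum _ _ _).trans ?_)
  gcongr

/-- The double integral form of the Poincaré inequality on a convex set, for smooth functions. -/
theorem lintegral_lintegral_sub_sq_le {U : Set (Pt n)} (hU : Convex ℝ U) (hUm : MeasurableSet U)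
    {h : ℝ} (hdiam : ∀ x ∈ U, ∀ y ∈ U, dist x y ≤ h) {w : Pt n → E} (hw : ContDiff ℝ 1 w) :
    ∫⁻ x in U, ∫⁻ y in U, ‖w x - w y‖ₑ ^ 2 ≤
      2 ^ n * volume U * (ENNReal.ofReal h ^ 2 * ∫⁻ x in U, ‖gradSum w x‖ₑ ^ 2) := by
  have hgc := continuous_gradSum hw
  have hvol : (volume.restrict (Ioo (0 : ℝ) 1)) univ ≤ 1 := by simp
  set g : Pt n → ℝ≥0∞ := fun x => ENNReal.ofReal h ^ 2 * ‖gradSum w x‖ₑ ^ 2 with hg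
  have hgm : Measurable g := by
    have := hgc.enorm.measurable
    fun_prop
  -- The fundamental theorem of calculus on the segment from `x` to `y`, then Cauchy–Schwarz; the
  -- segment has unit parameter length.
  have hpt : ∀ x ∈ U, ∀ y ∈ U, ‖w x - w y‖ₑ ^ 2 ≤
      ∫⁻ s in Ioo (0 : ℝ) 1, g ((1 - s) • x + s • y) := by
    intro x hx y hy
    have h1 := enorm_sub_le_lintegral hw x (y - x) (h := h)
      (by rw [← dist_eq_norm]; exact hdiam y hy x hx) zero_le_one
    rw [one_smul, zero_smul, add_zero, add_sub_cancel, ← lintegral_const_mul' _ _ (by simp)] at h1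
    rw [← enorm_neg, neg_sub]
    calc _ ≤ (∫⁻ s in Ioo (0 : ℝ) 1, ENNReal.ofReal h * ‖gradSum w (x + s • (y - x))‖ₑ) ^ 2 := by
          gcongr
      _ ≤ ∫⁻ s in Ioo (0 : ℝ) 1, (ENNReal.ofReal h * ‖gradSum w (x + s • (y - x))‖ₑ) ^ 2 := by
          refine sq_lintegral_le hvol ?_
          have : Continuous fun s : ℝ => gradSum w (x + s • (y - x)) := by fun_prop
          exact (this.enorm.measurable.const_mul _).aemeasurable
      _ = _ := by
          refine lintegral_congr fun s => ?_
          rw [mul_pow, hg]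
          congr 4
          module
  calc _ ≤ ∫⁻ x in U, ∫⁻ y in U, ∫⁻ s in Ioo (0 : ℝ) 1, g ((1 - s) • x + s • y) :=
        setLIntegral_mono' hUm fun x hx => setLIntegral_mono' hUm fun y hy => hpt x hx y hy
    _ = ∫⁻ s in Ioo (0 : ℝ) 1, ∫⁻ x in U, ∫⁻ y in U, g ((1 - s) • x + s • y) := by
        have h1 : ∀ x, ∫⁻ y in U, ∫⁻ s in Ioo (0 : ℝ) 1, g ((1 - s) • x + s • y) =
            ∫⁻ s in Ioo (0 : ℝ) 1, ∫⁻ y in U, g ((1 - s) • x + s • y) := fun x =>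
          lintegral_lintegral_swap (by fun_prop)
        simp_rw [h1]
        rw [lintegral_lintegral_swap]
        have : Measurable fun p : (Pt n × ℝ) × Pt n =>
            g ((1 - p.1.2) • p.1.1 + p.1.2 • p.2) := by fun_prop
        exact (this.lintegral_prod_right' (ν := volume.restrict U)).aemeasurable
    _ ≤ ∫⁻ s in Ioo (0 : ℝ) 1, 2 ^ n * volume U * ∫⁻ y in U, g y :=
        setLIntegral_mono' measurableSet_Ioo fun s hs =>
          lintegral_lintegral_convex_comb_le hU hUm hs hgm
    _ = _ := by
        rw [setLIntegral_const, hg, lintegral_const_mul' _ _ (by simp)]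
        simp

variable (E) in
/-- The trace inequality on a facet of a simplex, for smooth functions. -/
theorem exists_smooth_facet_le (hn : 0 < n) (γ : ℝ) :
    ∃ C : ℝ, 0 < C ∧ ∀ (K : Finset (Pt n)), IsRegularSimplex γ K → ∀ z ∈ K,
      ∀ w : Pt n → E, ContDiff ℝ 1 w →
        ENNReal.ofReal (cellDiam K ^ (1 / 2 : ℝ)) * eLpNorm w 2 (facetMeasure K z) ≤
          ENNReal.ofReal C * (eLpNorm w 2 (volume.restrict (cell K)) +
            ENNReal.ofReal (cellDiam K) *
              ∑ j, eLpNorm (fun x => fderiv ℝ w x (stdVec j)) 2 (volume.restrict (cell K))) := by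
  refine ⟨(4 * (max γ 1 * 2 ^ (n - 1))) ^ (1 / 2 : ℝ), by positivity, fun K hK z hz w hw => ?_⟩
  have hh := hK.cellDiam_pos hn
  set h := cellDiam K
  have hgc := continuous_gradSum hw
  have hvol : (volume.restrict (Ioo (1 / 2 : ℝ) 1)) univ ≤ 1 := by
    simp only [MeasurableSet.univ, Measure.restrict_apply, univ_inter, Real.volume_Ioo]
    rw [ENNReal.ofReal_le_one]
    norm_num
  refine (sqrt_mul_le_of_mul_sq_le hh.le (c := 4 * (max γ 1 * 2 ^ (n - 1))) (by positivity)
    (b := eLpNorm w 2 (volume.restrict (cell K)) +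
      ENNReal.ofReal h * eLpNorm (gradSum w) 2 (volume.restrict (cell K))) ?_).trans ?_
  swap
  · gcongr
    exact eLpNorm_gradSum_le hw _
  set g : Pt n → ℝ≥0∞ := fun x => ‖w x‖ₑ ^ 2 + ENNReal.ofReal h ^ 2 * ‖gradSum w x‖ₑ ^ 2 with hg
  have hgm : Measurable g := by
    have := hgc.enorm.measurable
    have := hw.continuous.enorm.measurable
    fun_prop
  have hpt : ∀ x ∈ facet K z, ‖w x‖ₑ ^ 2 ≤
      4 * ∫⁻ s in Ioo (1 / 2 : ℝ) 1, g (z + s • (x - z)) := by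
    intro x hx
    set G : ℝ≥0∞ := ∫⁻ s in Ioo (1 / 2 : ℝ) 1,
      ENNReal.ofReal h * ‖gradSum w (z + s • (x - z))‖ₑ with hG
    have hG2 : G ^ 2 ≤ ∫⁻ s in Ioo (1 / 2 : ℝ) 1,
        ENNReal.ofReal h ^ 2 * ‖gradSum w (z + s • (x - z))‖ₑ ^ 2 := by
      refine (sq_lintegral_le hvol ?_).trans (le_of_eq ?_)
      · have : Continuous fun s : ℝ => gradSum w (z + s • (x - z)) := by fun_prop
        exact (this.enorm.measurable.const_mul _).aemeasurable
      · exact lintegral_congr fun s => mul_pow _ _ _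
    have hd : ‖x - z‖ ≤ h := by
      rw [← dist_eq_norm]
      exact dist_le_cellDiam (facet_subset z hx) (subset_convexHull ℝ _ hz)
    -- The boundary value differs from the value at any inner point of the ray segment by at most
    -- `G`. Integrating over `t` gives the factor 4: one 2 from squaring a sum, one from the length
    -- `1/2` of the interval.
    have h1 : ∀ t ∈ Ioo (1 / 2 : ℝ) 1, ‖w x‖ₑ ^ 2 ≤
        2 * (‖w (z + t • (x - z))‖ₑ ^ 2 + G ^ 2) := by
      intro t ht
      have h2 := enorm_sub_le_lintegral hw z (x - z) hd ht.2.le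
      rw [one_smul, add_sub_cancel, ← lintegral_const_mul' _ _ (by simp)] at h2
      have h3 : ‖w x‖ₑ ≤ ‖w (z + t • (x - z))‖ₑ + G := by
        calc ‖w x‖ₑ = ‖w (z + t • (x - z)) + (w x - w (z + t • (x - z)))‖ₑ := by
              rw [add_sub_cancel]
          _ ≤ _ := (enorm_add_le _ _)
          _ ≤ _ := by
              gcongr
              exact h2.trans (lintegral_mono_set (Ioo_subset_Ioo_left ht.1.le))
      exact (pow_le_pow_left' h3 2).trans (add_sq_le_two_mul _ _)
    have hwm : Measurable fun s : ℝ => ‖w (z + s • (x - z))‖ₑ ^ 2 := by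
      have : Continuous fun s : ℝ => w (z + s • (x - z)) := by
        have := hw.continuous
        fun_prop
      exact this.enorm.measurable.pow_const 2
    have h4 := setLIntegral_mono' (μ := volume) measurableSet_Ioo h1
    rw [setLIntegral_const, lintegral_const_mul' _ _ (by simp), lintegral_add_left hwm,
      setLIntegral_const, Real.volume_Ioo] at h4
    have h5 : ENNReal.ofReal (1 - 1 / 2) = 2⁻¹ := by
      rw [show (1 - 1 / 2 : ℝ) = 2⁻¹ by norm_num, ENNReal.ofReal_inv_of_pos (by norm_num)]
      simp
    rw [h5] at h4
    have h6 : ∫⁻ s in Ioo (1 / 2 : ℝ) 1, g (z + s • (x - z)) =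
        (∫⁻ s in Ioo (1 / 2 : ℝ) 1, ‖w (z + s • (x - z))‖ₑ ^ 2) +
        ∫⁻ s in Ioo (1 / 2 : ℝ) 1, ENNReal.ofReal h ^ 2 * ‖gradSum w (z + s • (x - z))‖ₑ ^ 2 :=
      lintegral_add_left hwm _
    rw [h6]
    calc ‖w x‖ₑ ^ 2 = 2 * (‖w x‖ₑ ^ 2 * 2⁻¹) := by
          rw [mul_comm (‖w x‖ₑ ^ 2), ← mul_assoc, ENNReal.mul_inv_cancel (by simp) (by simp),
            one_mul]
      _ ≤ 2 * (2 * ((∫⁻ s in Ioo (1 / 2 : ℝ) 1, ‖w (z + s • (x - z))‖ₑ ^ 2) + G ^ 2 * 2⁻¹)) := by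
          gcongr
      _ ≤ 2 * (2 * ((∫⁻ s in Ioo (1 / 2 : ℝ) 1, ‖w (z + s • (x - z))‖ₑ ^ 2) + G ^ 2)) := by
          gcongr
          exact mul_le_of_le_one_right zero_le (by simp)
      _ = 4 * ((∫⁻ s in Ioo (1 / 2 : ℝ) 1, ‖w (z + s • (x - z))‖ₑ ^ 2) + G ^ 2) := by
          rw [← mul_assoc]; norm_num
      _ ≤ _ := by gcongr
  rw [eLpNorm_two_sq]
  calc _ ≤ ENNReal.ofReal h * ∫⁻ x, 4 * (∫⁻ s in Ioo (1 / 2 : ℝ) 1, g (z + s • (x - z)))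
        ∂facetMeasure K z := by
        refine mul_le_mul_right ?_ _
        exact setLIntegral_mono' (isCompact_facet z).measurableSet hpt
    _ = 4 * (ENNReal.ofReal h * ∫⁻ x, (∫⁻ s in Ioo (1 / 2 : ℝ) 1, g (z + s • (x - z)))
        ∂facetMeasure K z) := by
        rw [lintegral_const_mul' _ _ (by simp), mul_left_comm]
    _ ≤ 4 * (ENNReal.ofReal (γ * 2 ^ (n - 1)) * ∫⁻ y in cell K, g y) :=
        mul_le_mul_right (hK.facet_lintegral_le hn hz hgm) _
    _ ≤ ENNReal.ofReal (4 * (max γ 1 * 2 ^ (n - 1))) * ∫⁻ y in cell K, g y := by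
        rw [← mul_assoc, ENNReal.ofReal_mul (p := 4) (by norm_num), ENNReal.ofReal_ofNat]
        gcongr
        exact le_max_left _ _
    _ ≤ _ := by
        refine mul_le_mul_right ?_ _
        refine le_trans ?_ (add_sq_le_sq_add _ _)
        rw [mul_pow, eLpNorm_two_sq, eLpNorm_two_sq, ← lintegral_const_mul' _ _ (by simp),
          ← lintegral_add_left (hw.continuous.enorm.measurable.pow_const 2)]

end Smooth

/-! ### Weak gradients in `L²` -/

section WeakGrad

variable {n : ℕ} {E : Type*} [NormedAddCommGroup E] [NormedSpace ℝ E]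

/-- `v ∈ L²(U)` has the weak partial derivatives `G j ∈ L²(U)`. -/
structure HasWeakGrad (U : Set (Pt n)) (v : Pt n → E) (G : Fin n → Pt n → E) : Prop where
  memLp : MemLp v 2 (volume.restrict U)
  memLp_grad : ∀ j, MemLp (G j) 2 (volume.restrict U)
  eq : ∀ j, ∀ φ : Pt n → ℝ, ContDiff ℝ ∞ φ → HasCompactSupport φ → tsupport φ ⊆ U →
    ∫ x in U, fderiv ℝ φ x (stdVec j) • v x = -∫ x in U, φ x • G j x

variable {U : Set (Pt n)}

theorem integrable_restrict_of_memLp {E : Type*} [NormedAddCommGroup E] (hb : Bornology.IsBounded U) {v : Pt n → E}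
    (hv : MemLp v 2 (volume.restrict U)) : Integrable v (volume.restrict U) := by
  have : IsFiniteMeasure ((volume : Measure (Pt n)).restrict U) :=
    ⟨by simpa using hb.measure_lt_top⟩
  exact hv.integrable (by norm_num)

theorem integrable_smul_of_memLp (hb : Bornology.IsBounded U) {v : Pt n → E}
    (hv : MemLp v 2 (volume.restrict U)) {ψ : Pt n → ℝ} (hψ : Continuous ψ)
    (hc : HasCompactSupport ψ) : Integrable (fun x => ψ x • v x) (volume.restrict U) :=
  (integrable_restrict_of_memLp hb hv).locallyIntegrable.integrable_smul_left_of_hasCompactSupport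
    hψ hc

theorem continuous_fderiv_stdVec {F : Type*} [NormedAddCommGroup F] [NormedSpace ℝ F]
    {φ : Pt n → F} (hφ : ContDiff ℝ 1 φ) (j : Fin n) :
    Continuous fun x => fderiv ℝ φ x (stdVec j) := by
  have := hφ.continuous_fderiv (by norm_num)
  fun_prop

theorem HasWeakGrad.sub (hb : Bornology.IsBounded U) {v w : Pt n → E} {G H : Fin n → Pt n → E}
    (hv : HasWeakGrad U v G) (hw : HasWeakGrad U w H) :
    HasWeakGrad U (v - w) (fun j => G j - H j) := by
  refine ⟨hv.memLp.sub hw.memLp, fun j => (hv.memLp_grad j).sub (hw.memLp_grad j), ?_⟩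
  intro j φ hφ hc hs
  have h1 := hv.eq j φ hφ hc hs
  have h2 := hw.eq j φ hφ hc hs
  have hd : Continuous fun x => fderiv ℝ φ x (stdVec j) :=
    continuous_fderiv_stdVec (hφ.of_le (by simp)) j
  have hdc : HasCompactSupport fun x => fderiv ℝ φ x (stdVec j) := hc.fderiv_apply ℝ _
  simp only [Pi.sub_apply, smul_sub]
  rw [integral_sub (integrable_smul_of_memLp hb hv.memLp hd hdc)
    (integrable_smul_of_memLp hb hw.memLp hd hdc),
    integral_sub (integrable_smul_of_memLp hb (hv.memLp_grad j) hφ.continuous hc)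
    (integrable_smul_of_memLp hb (hw.memLp_grad j) hφ.continuous hc), h1, h2]
  abel

theorem HasWeakGrad.congr {v w : Pt n → E} {G H : Fin n → Pt n → E}
    (hv : HasWeakGrad U v G) (h : v =ᵐ[volume.restrict U] w)
    (hG : ∀ j, G j =ᵐ[volume.restrict U] H j) : HasWeakGrad U w H := by
  refine ⟨hv.memLp.ae_eq h, fun j => (hv.memLp_grad j).ae_eq (hG j), ?_⟩
  intro j φ hφ hc hs
  have h1 := hv.eq j φ hφ hc hs
  rw [integral_congr_ae (g := fun x => fderiv ℝ φ x (stdVec j) • w x)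
    (by filter_upwards [h] with x hx; rw [hx]),
    integral_congr_ae (f := fun x => φ x • G j x) (g := fun x => φ x • H j x)
    (by filter_upwards [hG j] with x hx; rw [hx])] at h1
  exact h1

theorem memLp_of_continuous {E : Type*} [NormedAddCommGroup E] (hb : Bornology.IsBounded U) (hUm : MeasurableSet U) {w : Pt n → E}
    (hw : Continuous w) : MemLp w 2 (volume.restrict U) := by
  have : IsFiniteMeasure ((volume : Measure (Pt n)).restrict U) :=
    ⟨by simpa using hb.measure_lt_top⟩
  obtain ⟨M, hM⟩ := hb.isCompact_closure.exists_bound_of_continuousOn hw.continuousOn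
  refine MemLp.of_bound hw.aestronglyMeasurable M ?_
  filter_upwards [ae_restrict_mem hUm] with s hs
  exact hM s (subset_closure hs)

theorem setIntegral_eq_of_tsupport_subset {f : Pt n → E} (h : tsupport f ⊆ U) :
    ∫ x in U, f x = ∫ x, f x :=
  setIntegral_eq_integral_of_forall_compl_eq_zero fun x hx => by
    by_contra h0
    exact hx (h (subset_tsupport _ h0))

theorem hasWeakGrad_of_contDiff (hb : Bornology.IsBounded U) (hUm : MeasurableSet U)
    {w : Pt n → E} (hw : ContDiff ℝ 1 w) :
    HasWeakGrad U w fun j x => fderiv ℝ w x (stdVec j) := by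
  refine ⟨memLp_of_continuous hb hUm hw.continuous, fun j =>
    memLp_of_continuous hb hUm (continuous_fderiv_stdVec hw j), ?_⟩
  intro j φ hφ hc hs
  have hd : Continuous fun x => fderiv ℝ φ x (stdVec j) :=
    continuous_fderiv_stdVec (hφ.of_le (by simp)) j
  have hdc : HasCompactSupport fun x => fderiv ℝ φ x (stdVec j) := hc.fderiv_apply ℝ _
  have hwc := hw.continuous
  have hwd := continuous_fderiv_stdVec hw j
  rw [setIntegral_eq_of_tsupport_subset, setIntegral_eq_of_tsupport_subset,
    integral_smul_fderiv_eq_neg_fderiv_smul_of_integrable, neg_neg]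
  · exact (hd.smul hwc).integrable_of_hasCompactSupport hdc.smul_right
  · exact (hφ.continuous.smul hwd).integrable_of_hasCompactSupport hc.smul_right
  · exact (hφ.continuous.smul hwc).integrable_of_hasCompactSupport hc.smul_right
  · exact fun x _ => (hφ.differentiable (by simp)) x
  · exact fun x _ => (hw.differentiable (by norm_num)) x
  · exact (tsupport_smul_subset_left _ _).trans hs
  · exact (tsupport_smul_subset_left _ _).trans ((tsupport_fderiv_apply_subset ℝ _).trans hs)

/-- The fundamental lemma of the calculus of variations, applied to the difference of two
candidates. -/
theorem HasWeakGrad.unique [CompleteSpace E] (hU : IsOpen U) (hb : Bornology.IsBounded U)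
    {v : Pt n → E} {G H : Fin n → Pt n → E} (hG : HasWeakGrad U v G) (hH : HasWeakGrad U v H)
    (j : Fin n) : G j =ᵐ[volume.restrict U] H j := by
  have hint := integrable_restrict_of_memLp hb ((hG.memLp_grad j).sub (hH.memLp_grad j))
  have := hU.ae_eq_zero_of_integral_contDiff_smul_eq_zero (f := G j - H j) (μ := volume)
    (IntegrableOn.locallyIntegrableOn hint) (by
      intro g hg hc hs
      have h1 := hG.eq j g hg hc hs
      rw [hH.eq j g hg hc hs, neg_inj] at h1
      rw [← setIntegral_eq_of_tsupport_subset (U := U)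
        ((tsupport_smul_subset_left g (G j - H j)).trans hs)]
      simp only [Pi.sub_apply, smul_sub]
      rw [integral_sub (integrable_smul_of_memLp hb (hG.memLp_grad j) hg.continuous hc)
        (integrable_smul_of_memLp hb (hH.memLp_grad j) hg.continuous hc), h1, sub_self])
  rw [EventuallyEq, ae_restrict_iff' hU.measurableSet]
  filter_upwards [this] with x hx hxU
  exact sub_eq_zero.1 (hx hxU)

end WeakGrad

/-! ### Smoothing by contracted averages -/

section Regularization

variable {n : ℕ} {E : Type*} [NormedAddCommGroup E] [NormedSpace ℝ E]

/-- The average of `W` with weight `η` over points contracted towards `x`. -/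
def regAvg (η : Pt n → ℝ) (l : ℝ) (W : Pt n → E) (x : Pt n) : E :=
  ∫ y, η y • W (l • x + (1 - l) • y)

/-- The kernel of `regAvg`. -/
def regKernel (η : Pt n → ℝ) (l : ℝ) (u : Pt n) : ℝ :=
  ((1 - l) ^ n)⁻¹ * η (-((1 - l)⁻¹ • u))

variable {η : Pt n → ℝ} {l : ℝ}

/-- The substitution `t = l x + (1 - l) y` moves all dependence on `x` into the smooth kernel, which
makes the average a convolution evaluated at `l x`, smooth for merely integrable `W`. -/
theorem regAvg_eq_integral (hl : l < 1) (W : Pt n → E) (x : Pt n) :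
    regAvg η l W x = ∫ t, regKernel η l (l • x - t) • W t := by
  have h0 : 0 < 1 - l := by linarith
  have h1 := Measure.integral_comp_smul (volume : Measure (Pt n))
    (fun u => regKernel η l (-u) • W (l • x + u)) (1 - l)
  rw [finrank_euclideanSpace_fin, abs_of_pos (by positivity)] at h1
  have h2 : ∫ u, regKernel η l (-u) • W (l • x + u) = ∫ t, regKernel η l (l • x - t) • W t := by
    rw [← integral_add_left_eq_self (fun t => regKernel η l (l • x - t) • W t) (l • x)]
    simp
  rw [← h2, ← inv_smul_smul₀ (show ((1 - l) ^ n)⁻¹ ≠ 0 by positivity)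
    (∫ u, regKernel η l (-u) • W (l • x + u)), ← h1, inv_inv, ← integral_smul, regAvg]
  congr 1
  ext y
  rw [regKernel, smul_neg, neg_neg, smul_smul, inv_smul_smul₀ h0.ne', ← mul_assoc,
    mul_inv_cancel₀ (by positivity), one_mul]

theorem contDiff_regKernel (hη : ContDiff ℝ ∞ η) : ContDiff ℝ ∞ (regKernel η l) := by
  unfold regKernel
  fun_prop

theorem hasCompactSupport_regKernel (hη : HasCompactSupport η) (hl : l < 1) :
    HasCompactSupport (regKernel η l) := by
  have h0 : (1 - l)⁻¹ ≠ 0 := inv_ne_zero (by linarith)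
  have h1 : HasCompactSupport fun u => η (-((1 - l)⁻¹ • u)) :=
    hη.comp_homeomorph ((Homeomorph.smulOfNeZero _ h0).trans (Homeomorph.neg (Pt n)))
  exact h1.mul_left

theorem regAvg_eq_convolution (hl : l < 1) (W : Pt n → E) (x : Pt n) :
    regAvg η l W x =
      (convolution (regKernel η l) W (ContinuousLinearMap.lsmul ℝ ℝ) volume) (l • x) := by
  rw [regAvg_eq_integral hl, convolution_eq_swap]
  rfl

theorem contDiff_regAvg (hη : ContDiff ℝ ∞ η) (hc : HasCompactSupport η) (hl : l < 1)
    {W : Pt n → E} (hW : LocallyIntegrable W volume) : ContDiff ℝ ∞ (regAvg η l W) := by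
  have h1 := (hasCompactSupport_regKernel hc hl).contDiff_convolution_left
    (ContinuousLinearMap.lsmul ℝ ℝ (E := E)) (contDiff_regKernel (n := n) (l := l) hη) hW
  have : regAvg η l W = (convolution (regKernel η l) W (ContinuousLinearMap.lsmul ℝ ℝ) volume) ∘
      fun x => l • x := by
    ext x
    exact regAvg_eq_convolution hl W x
  rw [this]
  exact h1.comp (contDiff_const_smul l)

theorem fderiv_regAvg (hη : ContDiff ℝ ∞ η) (hc : HasCompactSupport η) (hl : l < 1)
    {W : Pt n → E} (hW : LocallyIntegrable W volume) (x d : Pt n) :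
    fderiv ℝ (regAvg η l W) x d =
      l • ∫ t, fderiv ℝ (regKernel η l) (l • x - t) d • W t := by
  have hk : ContDiff ℝ 1 (regKernel η l) := (contDiff_regKernel hη).of_le (by simp)
  have hkc := hasCompactSupport_regKernel hc hl
  have h1 := hkc.hasFDerivAt_convolution_left (ContinuousLinearMap.lsmul ℝ ℝ (E := E)) hk hW (l • x)
  have h2 : HasFDerivAt (fun x : Pt n => l • x) (l • ContinuousLinearMap.id ℝ (Pt n)) x :=
    (hasFDerivAt_id x).const_smul l
  have h3 := h1.comp x h2
  have h4 : regAvg η l W = (convolution (regKernel η l) W (ContinuousLinearMap.lsmul ℝ ℝ) volume) ∘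
      fun x => l • x := by
    ext x
    exact regAvg_eq_convolution hl W x
  rw [h4, h3.fderiv, ContinuousLinearMap.comp_apply, smul_apply, map_smul,
    ContinuousLinearMap.id_apply, convolution_eq_swap]
  congr 1
  have hex := (hkc.fderiv ℝ).convolutionExists_left
    (ContinuousLinearMap.precompL (Pt n) (ContinuousLinearMap.lsmul ℝ ℝ (E := E)))
    (hk.continuous_fderiv (by norm_num)) hW (l • x)
  rw [ContinuousLinearMap.integral_apply hex.integrable_swap]
  rfl

/-- The regularization commutes with weak derivatives. -/
theorem HasWeakGrad.fderiv_regAvg {U : Set (Pt n)} (hUo : IsOpen U) (hU : Convex ℝ U)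
    (hb : Bornology.IsBounded U) {v : Pt n → E} {G : Fin n → Pt n → E} (hv : HasWeakGrad U v G)
    (hη : ContDiff ℝ ∞ η) (hc : HasCompactSupport η) (hs : tsupport η ⊆ U)
    (hl0 : 0 ≤ l) (hl : l < 1) {x : Pt n} (hx : x ∈ U) (j : Fin n) :
    fderiv ℝ (regAvg η l (U.indicator v)) x (stdVec j) =
      l • regAvg η l (U.indicator (G j)) x := by
  have h0 : 0 < 1 - l := by linarith
  have hW : LocallyIntegrable (U.indicator v) volume :=
    ((integrable_indicator_iff hUo.measurableSet).2
      (integrable_restrict_of_memLp hb hv.memLp)).locallyIntegrable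
  rw [TanTrace.fderiv_regAvg hη hc hl hW, regAvg_eq_integral hl]
  congr 1
  set ψ : Pt n → ℝ := fun t => regKernel η l (l • x - t) with hψ
  have hψs : ContDiff ℝ ∞ ψ := (contDiff_regKernel hη).comp (contDiff_const.sub contDiff_id)
  -- As a function of `t`, the kernel is supported in the points `l x + (1 - l) y` with `y` in the
  -- support of `η`. By convexity these lie in `U`, so `ψ` is an admissible test function and no
  -- extension of `v` across the boundary is needed.
  have hsub : tsupport ψ ⊆ (fun y => l • x + (1 - l) • y) '' tsupport η := by
    refine closure_minimal ?_ ?_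
    · intro t ht
      refine ⟨(1 - l)⁻¹ • (t - l • x), subset_tsupport _ ?_, ?_⟩
      · rw [Function.mem_support] at ht ⊢
        intro h
        apply ht
        simp only [hψ, regKernel, ← smul_neg, neg_sub, h, mul_zero]
      · simp [smul_inv_smul₀ h0.ne']
    · exact (IsCompact.image hc (by fun_prop)).isClosed
  have himg : (fun y => l • x + (1 - l) • y) '' tsupport η ⊆ U := by
    rintro _ ⟨y, hy, rfl⟩
    exact hU hx (hs hy) hl0 h0.le (by ring)
  have hψc : HasCompactSupport ψ :=
    HasCompactSupport.of_support_subset_isCompact (IsCompact.image hc (by fun_prop))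
      ((subset_tsupport _).trans hsub)
  have key := hv.eq j ψ hψs hψc (hsub.trans himg)
  have hder : ∀ t, fderiv ℝ ψ t (stdVec j) = -fderiv ℝ (regKernel η l) (l • x - t) (stdVec j) := by
    intro t
    have h1 : HasFDerivAt ψ ((fderiv ℝ (regKernel η l) (l • x - t)).comp
        (-ContinuousLinearMap.id ℝ (Pt n))) t := by
      have hk : DifferentiableAt ℝ (regKernel η l) (l • x - t) :=
        (contDiff_regKernel hη).differentiable (by simp) _
      exact hk.hasFDerivAt.comp t ((hasFDerivAt_id t).const_sub (l • x))
    rw [h1.fderiv]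
    simp
  simp only [hder, neg_smul, integral_neg, neg_inj] at key
  have hind : ∀ (f : Pt n → ℝ) (w : Pt n → E),
      ∫ t, f t • U.indicator w t = ∫ t in U, f t • w t := by
    intro f w
    rw [← integral_indicator hUo.measurableSet]
    congr 1
    ext t
    by_cases ht : t ∈ U <;> simp [ht]
  rw [hind, hind, key]

end Regularization

/-! ### Density of smooth functions on bounded convex open sets -/

section Density

variable {n : ℕ} {E : Type*} [NormedAddCommGroup E] [NormedSpace ℝ E] [FiniteDimensional ℝ E]
  {U : Set (Pt n)} {η : Pt n → ℝ}

/-- Minkowski's integral inequality for the regularization error. -/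
theorem eLpNorm_regAvg_sub_le (hUo : IsOpen U) (hb : Bornology.IsBounded U)
    (hη : Continuous η) (hc : HasCompactSupport η) (hη0 : ∀ y, 0 ≤ η y) (hη1 : ∫ y, η y = 1)
    (hs : tsupport η ⊆ U) {w : Pt n → E} (hwm : StronglyMeasurable w)
    (hw : MemLp w 2 (volume.restrict U)) {l : ℝ} (hl : l < 1) {M : ℝ≥0∞}
    (hM : ∀ y ∈ U, eLpNorm (fun x => U.indicator w (l • x + (1 - l) • y) - U.indicator w x) 2
      (volume.restrict U) ≤ M) :
    eLpNorm (regAvg η l (U.indicator w) - w) 2 (volume.restrict U) ≤ M := by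
  have h0 : 1 - l ≠ 0 := by linarith
  set W := U.indicator w with hW
  have hWm : StronglyMeasurable W := hwm.indicator hUo.measurableSet
  have hWi : Integrable W volume :=
    (integrable_indicator_iff hUo.measurableSet).2 (integrable_restrict_of_memLp hb hw)
  have hηm : Measurable fun y => ENNReal.ofReal (η y) := by fun_prop
  have hηi : Integrable η volume := hη.integrable_of_hasCompactSupport hc
  -- The weight `η` defines a probability measure, so Cauchy–Schwarz bounds the squared error of the
  -- average by the average of the squared errors.
  set P : Measure (Pt n) := volume.withDensity fun y => ENNReal.ofReal (η y) with hP
  have hP1 : P univ = 1 := by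
    rw [hP, withDensity_apply _ MeasurableSet.univ, setLIntegral_univ,
      ← ofReal_integral_eq_lintegral_ofReal hηi (ae_of_all _ hη0), hη1, ENNReal.ofReal_one]
  have hPf : IsFiniteMeasure P := ⟨by rw [hP1]; exact ENNReal.one_lt_top⟩
  have hmeas : Measurable fun p : Pt n × Pt n => ‖W (l • p.1 + (1 - l) • p.2) - W p.1‖ₑ := by
    have h1 : StronglyMeasurable fun p : Pt n × Pt n => W (l • p.1 + (1 - l) • p.2) :=
      hWm.comp_measurable (by fun_prop)
    have h2 : StronglyMeasurable fun p : Pt n × Pt n => W p.1 := hWm.comp_measurable (by fun_prop)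
    exact (h1.sub h2).enorm
  have hmx : ∀ x, Measurable fun y => ‖W (l • x + (1 - l) • y) - W x‖ₑ :=
    fun x => ((hWm.comp_measurable (by fun_prop : Measurable fun y : Pt n =>
      l • x + (1 - l) • y)).sub stronglyMeasurable_const).enorm
  have hpt : ∀ x ∈ U, ‖(regAvg η l W - w) x‖ₑ ^ 2 ≤
      ∫⁻ y, ‖W (l • x + (1 - l) • y) - W x‖ₑ ^ 2 ∂P := by
    intro x hx
    have hi1 : Integrable (fun y => η y • W (l • x + (1 - l) • y)) volume :=
      ((hWi.comp_add_left (l • x)).comp_smul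
        h0).locallyIntegrable.integrable_smul_left_of_hasCompactSupport hη hc
    have hi2 : Integrable (fun y => η y • W x) volume := hηi.smul_const _
    have h1 : (regAvg η l W - w) x = ∫ y, η y • (W (l • x + (1 - l) • y) - W x) := by
      simp only [smul_sub]
      rw [integral_sub hi1 hi2, integral_smul_const, hη1, one_smul, Pi.sub_apply, regAvg, hW,
        indicator_of_mem hx]
    have h2 : ‖(regAvg η l W - w) x‖ₑ ≤ ∫⁻ y, ‖W (l • x + (1 - l) • y) - W x‖ₑ ∂P := by
      rw [h1, hP, lintegral_withDensity_eq_lintegral_mul _ hηm (hmx x)]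
      refine (enorm_integral_le_lintegral_enorm _).trans (lintegral_mono fun y => ?_)
      rw [enorm_smul, Real.enorm_of_nonneg (hη0 y)]
      rfl
    exact (pow_le_pow_left' h2 2).trans
      (sq_lintegral_le hP1.le (hmx x).aemeasurable)
  have hsq : eLpNorm (regAvg η l W - w) 2 (volume.restrict U) ^ 2 ≤ M ^ 2 := by
    rw [eLpNorm_two_sq]
    calc _ ≤ ∫⁻ x in U, ∫⁻ y, ‖W (l • x + (1 - l) • y) - W x‖ₑ ^ 2 ∂P :=
          setLIntegral_mono' hUo.measurableSet hpt
      _ = ∫⁻ y, (∫⁻ x in U, ‖W (l • x + (1 - l) • y) - W x‖ₑ ^ 2) ∂P :=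
          lintegral_lintegral_swap (hmeas.pow_const 2).aemeasurable
      _ ≤ ∫⁻ y, M ^ 2 ∂P := by
          refine lintegral_mono_ae ((ae_withDensity_iff hηm).2 (ae_of_all _ fun y hy => ?_))
          have hyU : y ∈ U := by
            refine hs (subset_tsupport _ fun h => hy ?_)
            rw [h, ENNReal.ofReal_zero]
          rw [← eLpNorm_two_sq]
          exact pow_le_pow_left' (hM y hyU) 2
      _ = M ^ 2 := by rw [lintegral_const, hP1, mul_one]
  exact (ENNReal.pow_le_pow_left_iff two_ne_zero).1 hsq

/-- In `L²`, `W` is close to a continuous `g` with compact support. Composition with `x ↦ l x + (1 -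
l) y` scales `L²` norms by a bounded factor for `l > 1/2`, and moves points of `U` by at most a
multiple of `1 - l`, so uniform continuity handles `g`, uniformly in `y`. -/
theorem tendsto_regAvg (hUo : IsOpen U) (hb : Bornology.IsBounded U)
    (hη : Continuous η) (hc : HasCompactSupport η) (hη0 : ∀ y, 0 ≤ η y) (hη1 : ∫ y, η y = 1)
    (hs : tsupport η ⊆ U) {w : Pt n → E} (hwm : StronglyMeasurable w)
    (hw : MemLp w 2 (volume.restrict U)) :
    Tendsto (fun l => eLpNorm (regAvg η l (U.indicator w) - w) 2 (volume.restrict U))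
      (𝓝[<] 1) (𝓝 0) := by
  rw [ENNReal.tendsto_nhds_zero]
  intro ε hε
  have hvol : volume U ≠ ⊤ := hb.measure_lt_top.ne
  have hW : MemLp (U.indicator w) 2 volume := (memLp_indicator_iff_restrict hUo.measurableSet).2 hw
  set W := U.indicator w with hWdef
  have hWm : StronglyMeasurable W := hwm.indicator hUo.measurableSet
  -- The factor `2 ^ n` absorbs the Jacobian `l^(-n)` of the contraction.
  set δ : ℝ≥0∞ := ε / 3 / 2 ^ n with hδ
  have hδ0 : δ ≠ 0 := by
    refine (ENNReal.div_pos (ENNReal.div_pos hε.ne' (by simp)).ne' (by simp)).ne'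
  obtain ⟨g, hgc, hgδ, hg, hgm⟩ := hW.exists_hasCompactSupport_eLpNorm_sub_le (by simp) hδ0
  have h3 : ε / 3 ≠ 0 := (ENNReal.div_pos hε.ne' (by simp)).ne'
  -- A pointwise bound `τ` on `U` gives an `L²` bound `τ |U|^(1/2)`.
  obtain ⟨τ, hτ, hτε⟩ := ENNReal.exists_nnreal_pos_mul_lt
    (a := volume U ^ ((2 : ℝ≥0∞).toReal⁻¹)) (by simp [hvol]) h3
  obtain ⟨κ, hκ, hgκ⟩ := Metric.uniformContinuous_iff.1 (hgc.uniformContinuous_of_continuous hg) τ hτ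
  obtain ⟨h, hh⟩ := Metric.isBounded_iff.1 hb
  have hev : ∀ᶠ l in 𝓝[<] (1 : ℝ), 1 / 2 < l ∧ (1 - l) * (|h| + 1) < κ ∧ l < 1 := by
    have h1 : ∀ᶠ l in 𝓝[<] (1 : ℝ), 1 / 2 < l :=
      eventually_nhdsWithin_of_eventually_nhds (lt_mem_nhds (by norm_num))
    have h2 : ∀ᶠ l in 𝓝[<] (1 : ℝ), (1 - l) * (|h| + 1) < κ := by
      refine eventually_nhdsWithin_of_eventually_nhds ?_
      have : Tendsto (fun l : ℝ => (1 - l) * (|h| + 1)) (𝓝 1) (𝓝 ((1 - 1) * (|h| + 1))) :=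
        (Continuous.tendsto (by fun_prop) 1)
      rw [sub_self, zero_mul] at this
      exact this.eventually (gt_mem_nhds hκ)
    filter_upwards [h1, h2, self_mem_nhdsWithin] with l a b c using ⟨a, b, c⟩
  filter_upwards [hev] with l ⟨hl2, hlκ, hl1⟩
  refine eLpNorm_regAvg_sub_le hUo hb hη hc hη0 hη1 hs hwm hw hl1 fun y hy => ?_
  have hl0 : 0 < l := by linarith
  have hgsm : StronglyMeasurable g := hg.stronglyMeasurable
  have haff : Measurable fun x : Pt n => l • x + (1 - l) • y := by fun_prop
  -- the three contributions
  have hA : eLpNorm (fun x => (W - g) (l • x + (1 - l) • y)) 2 (volume.restrict U) ≤ ε / 3 := by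
    have hm : Measurable fun x => ‖(W - g) x‖ₑ ^ 2 := (hWm.sub hgsm).enorm.pow_const 2
    have hsq : eLpNorm (fun x => (W - g) (l • x + (1 - l) • y)) 2 (volume.restrict U) ^ 2 ≤
        (ε / 3) ^ 2 := by
      calc _ ≤ eLpNorm (fun x => (W - g) (l • x + (1 - l) • y)) 2 volume ^ 2 := by
            gcongr
            exact Measure.restrict_le_self
        _ = ∫⁻ x, ‖(W - g) ((1 - l) • y + l • x)‖ₑ ^ 2 := by
            rw [eLpNorm_two_sq]
            simp only [add_comm]
        _ = ENNReal.ofReal ((l ^ n)⁻¹) * ∫⁻ x, ‖(W - g) x‖ₑ ^ 2 :=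
            lintegral_comp_affine hl0 _ hm
        _ ≤ 2 ^ n * δ ^ 2 := by
            rw [← eLpNorm_two_sq, ← inv_pow, ENNReal.ofReal_pow (inv_nonneg.2 hl0.le)]
            gcongr
            rw [← ENNReal.ofReal_ofNat]
            refine ENNReal.ofReal_le_ofReal ?_
            rw [inv_le_comm₀ hl0 (by norm_num)]
            linarith
        _ ≤ (2 ^ n * δ) ^ 2 := by
            rw [mul_pow]
            refine mul_le_mul_left ?_ _
            exact le_self_pow (one_le_pow₀ (by norm_num : (1 : ℝ≥0∞) ≤ 2)) two_ne_zero
        _ = _ := by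
            rw [hδ, ENNReal.mul_div_cancel (by simp) (by simp)]
    exact (ENNReal.pow_le_pow_left_iff two_ne_zero).1 hsq
  have hB : eLpNorm (fun x => g (l • x + (1 - l) • y) - g x) 2 (volume.restrict U) ≤ ε / 3 := by
    refine (eLpNorm_le_of_ae_bound (C := τ) ?_).trans ?_
    · filter_upwards [ae_restrict_mem hUo.measurableSet] with x hx
      rw [← dist_eq_norm]
      refine (hgκ ?_).le
      rw [dist_eq_norm, show l • x + (1 - l) • y - x = (1 - l) • (y - x) by module, norm_smul,
        Real.norm_of_nonneg (by linarith)]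
      refine lt_of_le_of_lt ?_ hlκ
      have h1 : ‖y - x‖ ≤ |h| + 1 := by
        rw [← dist_eq_norm]
        exact (hh hy hx).trans ((le_abs_self h).trans (by linarith))
      exact mul_le_mul_of_nonneg_left h1 (by linarith)
    · rw [Measure.restrict_apply_univ, ENNReal.ofReal_coe_nnreal, mul_comm]
      exact hτε.le
  have hC : eLpNorm (W - g) 2 (volume.restrict U) ≤ ε / 3 := by
    refine (eLpNorm_mono_measure _ Measure.restrict_le_self).trans (hgδ.trans ?_)
    exact ENNReal.div_le_of_le_mul (le_mul_of_one_le_right zero_le (one_le_pow₀ (by norm_num)))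
  have hdec : (fun x => W (l • x + (1 - l) • y) - W x) =
      ((fun x => (W - g) (l • x + (1 - l) • y)) + fun x => g (l • x + (1 - l) • y) - g x) -
        (W - g) := by
    ext x
    simp only [Pi.add_apply, Pi.sub_apply]
    abel
  have hm1 : StronglyMeasurable fun x => (W - g) (l • x + (1 - l) • y) :=
    (hWm.sub hgsm).comp_measurable haff
  have hm2 : StronglyMeasurable fun x => g (l • x + (1 - l) • y) - g x :=
    (hgsm.comp_measurable haff).sub hgsm
  rw [hdec]
  calc _ ≤ eLpNorm _ 2 _ + eLpNorm _ 2 _ :=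
        eLpNorm_sub_le (hm1.add hm2).aestronglyMeasurable (hWm.sub hgsm).aestronglyMeasurable
          (by norm_num)
    _ ≤ (eLpNorm _ 2 _ + eLpNorm _ 2 _) + eLpNorm _ 2 _ := by
        gcongr
        exact eLpNorm_add_le hm1.aestronglyMeasurable hm2.aestronglyMeasurable (by norm_num)
    _ ≤ ε / 3 + ε / 3 + ε / 3 := by gcongr
    _ = ε := ENNReal.add_thirds ε

/-- Smooth functions are dense in `H¹(U)` for a bounded open convex set `U`. -/
theorem HasWeakGrad.exists_smooth_approx (hUo : IsOpen U) (hU : Convex ℝ U)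
    (hb : Bornology.IsBounded U) (hne : U.Nonempty) {v : Pt n → E} {G : Fin n → Pt n → E}
    (hv : HasWeakGrad U v G) :
    ∃ φ : ℕ → Pt n → E, (∀ i, ContDiff ℝ ∞ (φ i)) ∧
      Tendsto (fun i => eLpNorm (φ i - v) 2 (volume.restrict U)) atTop (𝓝 0) ∧
      ∀ j, Tendsto (fun i => eLpNorm ((fun x => fderiv ℝ (φ i) x (stdVec j)) - G j) 2
        (volume.restrict U)) atTop (𝓝 0) := by
  obtain ⟨c, hcU⟩ := hne
  obtain ⟨ρ, hρ, hball⟩ := Metric.isOpen_iff.1 hUo c hcU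
  let f : ContDiffBump c := ⟨ρ / 4, ρ / 2, by linarith, by linarith⟩
  set η : Pt n → ℝ := f.normed volume with hηdef
  have hη : ContDiff ℝ ∞ η := f.contDiff_normed
  have hηc : HasCompactSupport η := f.hasCompactSupport_normed
  have hη0 : ∀ y, 0 ≤ η y := f.nonneg_normed
  -- Unit mass makes the averages reproduce constants, as the error formula requires.
  have hη1 : ∫ y, η y = 1 := f.integral_normed
  have hηs : tsupport η ⊆ U := by
    rw [hηdef, f.tsupport_normed_eq]
    exact (Metric.closedBall_subset_ball (by change ρ / 2 < ρ; linarith)).trans hball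
  set v' := hv.memLp.1.mk v with hv'
  have hvv : v =ᵐ[volume.restrict U] v' := hv.memLp.1.ae_eq_mk
  set G' : Fin n → Pt n → E := fun j => (hv.memLp_grad j).1.mk (G j) with hG'
  have hGG : ∀ j, G j =ᵐ[volume.restrict U] G' j := fun j => (hv.memLp_grad j).1.ae_eq_mk
  have hv2 : HasWeakGrad U v' G' := hv.congr hvv hGG
  let l : ℕ → ℝ := fun i => 1 - 1 / ((i : ℝ) + 1)
  have hl1 : ∀ i, l i < 1 := fun i => by
    have : (0 : ℝ) < 1 / ((i : ℝ) + 1) := by positivity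
    simp only [l]; linarith
  have hl0 : ∀ i, 0 ≤ l i := fun i => by
    have : 1 / ((i : ℝ) + 1) ≤ 1 := by
      rw [div_le_one (by positivity)]
      have : (0 : ℝ) ≤ i := i.cast_nonneg
      linarith
    simp only [l]; linarith
  have hlim1 : Tendsto l atTop (𝓝 1) := by
    have := (tendsto_one_div_add_atTop_nhds_zero_nat (𝕜 := ℝ)).const_sub 1
    simpa [l] using this
  have hlim : Tendsto l atTop (𝓝[<] 1) :=
    tendsto_nhdsWithin_iff.2 ⟨hlim1, Eventually.of_forall hl1⟩
  have hW : LocallyIntegrable (U.indicator v') volume :=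
    ((integrable_indicator_iff hUo.measurableSet).2
      (integrable_restrict_of_memLp hb hv2.memLp)).locallyIntegrable
  refine ⟨fun i => regAvg η (l i) (U.indicator v'), fun i => contDiff_regAvg hη hηc (hl1 i) hW,
    ?_, fun j => ?_⟩
  · have := (tendsto_regAvg hUo hb hη.continuous hηc hη0 hη1 hηs
      hv.memLp.1.stronglyMeasurable_mk hv2.memLp).comp hlim
    refine this.congr fun i => eLpNorm_congr_ae ?_
    filter_upwards [hvv] with x hx
    simp [hx, hv']
  · have h1 := (tendsto_regAvg hUo hb hη.continuous hηc hη0 hη1 hηs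
      (hv.memLp_grad j).1.stronglyMeasurable_mk (hv2.memLp_grad j)).comp hlim
    -- Differentiating the contracted average produces a factor `l`, so besides the regularization
    -- error of `G` there is a remainder `(1 - l) G`.
    have h2 : Tendsto (fun i => ENNReal.ofReal (1 - l i) *
        eLpNorm (G' j) 2 (volume.restrict U)) atTop (𝓝 0) := by
      have h3 : Tendsto (fun i => ENNReal.ofReal (1 - l i)) atTop (𝓝 0) := by
        have := ENNReal.tendsto_ofReal (hlim1.const_sub 1)
        simpa using this
      have := ENNReal.Tendsto.mul_const (b := eLpNorm (G' j) 2 (volume.restrict U)) h3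
        (Or.inr (hv2.memLp_grad j).eLpNorm_ne_top)
      simpa using this
    have h4 := h1.add h2
    rw [add_zero] at h4
    refine tendsto_of_tendsto_of_tendsto_of_le_of_le tendsto_const_nhds h4 (fun i => zero_le)
      fun i => ?_
    have hreg : ContDiff ℝ ∞ (regAvg η (l i) (U.indicator (G' j))) :=
      contDiff_regAvg hη hηc (hl1 i) ((integrable_indicator_iff hUo.measurableSet).2
        (integrable_restrict_of_memLp hb (hv2.memLp_grad j))).locallyIntegrable
    have h5 : (fun x => fderiv ℝ (regAvg η (l i) (U.indicator v')) x (stdVec j)) - G j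
        =ᵐ[volume.restrict U] l i • (regAvg η (l i) (U.indicator (G' j)) - G' j) -
          (1 - l i) • G' j := by
      filter_upwards [ae_restrict_mem hUo.measurableSet, hGG j] with x hx hGx
      have := hv2.fderiv_regAvg hUo hU hb hη hηc hηs (hl0 i) (hl1 i) hx j
      simp only [Pi.sub_apply, Pi.smul_apply]
      rw [this, hGx]
      module
    dsimp only
    rw [eLpNorm_congr_ae h5]
    have hm1 : AEStronglyMeasurable (regAvg η (l i) (U.indicator (G' j)) - G' j)
        (volume.restrict U) :=
      hreg.continuous.aestronglyMeasurable.sub (hv2.memLp_grad j).1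
    refine (eLpNorm_sub_le (hm1.const_smul _) ((hv2.memLp_grad j).1.const_smul _)
      (by norm_num)).trans ?_
    rw [eLpNorm_const_smul, eLpNorm_const_smul, Real.enorm_of_nonneg (hl0 i),
      Real.enorm_of_nonneg (by linarith [hl1 i])]
    gcongr
    refine mul_le_of_le_one_left zero_le ?_
    rw [ENNReal.ofReal_le_one]
    exact (hl1 i).le

end Density

/-! ### Commuting iterated derivatives -/

section PartialDeriv

variable {V F : Type*} [NormedAddCommGroup V] [NormedSpace ℝ V] [NormedAddCommGroup F]
  [NormedSpace ℝ F]

/-- Iterated directional derivatives. -/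
def dirDerivs (l : List V) (f : V → F) : V → F := l.foldr (fun d g y => fderiv ℝ g y d) f

theorem contDiff_dirDeriv {f : V → F} (hf : ContDiff ℝ ∞ f) (d : V) :
    ContDiff ℝ ∞ fun y => fderiv ℝ f y d :=
  (hf.fderiv_right (m := ∞) (by simp)).clm_apply contDiff_const

theorem contDiff_dirDerivs {f : V → F} (hf : ContDiff ℝ ∞ f) (l : List V) :
    ContDiff ℝ ∞ (dirDerivs l f) := by
  induction l with
  | nil => exact hf
  | cons d l ih => exact contDiff_dirDeriv ih d

theorem dirDeriv_comm {f : V → F} (hf : ContDiff ℝ ∞ f) (a b : V) :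
    (fun y => fderiv ℝ (fun y => fderiv ℝ f y b) y a) =
      fun y => fderiv ℝ (fun y => fderiv ℝ f y a) y b := by
  ext y
  have hd : DifferentiableAt ℝ (fderiv ℝ f) y :=
    (hf.fderiv_right (m := ∞) (by simp)).differentiable (by simp) y
  have h : ∀ c d : V, fderiv ℝ (fun y => fderiv ℝ f y c) y d = fderiv ℝ (fderiv ℝ f) y d c := by
    intro c d
    rw [fderiv_clm_apply hd (differentiableAt_const c)]
    simp
  rw [h, h]
  exact (hf.contDiffAt.isSymmSndFDerivAt (by
    rw [minSmoothness_of_isRCLikeNormedField]; exact WithTop.coe_le_coe.2 (le_top : (2 : ℕ∞) ≤ ⊤))) a b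

theorem dirDerivs_perm {l l' : List V} (h : l.Perm l') {f : V → F} (hf : ContDiff ℝ ∞ f) :
    dirDerivs l f = dirDerivs l' f := by
  induction h with
  | nil => rfl
  | cons d _ ih =>
    change (fun y => fderiv ℝ (dirDerivs _ f) y d) = fun y => fderiv ℝ (dirDerivs _ f) y d
    rw [ih]
  | swap a b l => exact dirDeriv_comm (contDiff_dirDerivs hf l) b a
  | trans _ _ ih1 ih2 => exact ih1.trans ih2

theorem iteratedFDeriv_eq_dirDerivs {f : V → F} (hf : ContDiff ℝ ∞ f) {i : ℕ} (v : Fin i → V) :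
    (fun x => iteratedFDeriv ℝ i f x v) = dirDerivs (List.ofFn v) f := by
  induction i with
  | zero =>
    ext x
    simp [dirDerivs]
  | succ i ih =>
    rw [List.ofFn_succ]
    change _ = fun y => fderiv ℝ (dirDerivs (List.ofFn fun j => v j.succ) f) y (v 0)
    rw [← ih (fun j => v j.succ)]
    ext x
    have hd : DifferentiableAt ℝ (iteratedFDeriv ℝ i f) x :=
      (hf.iteratedFDeriv_right (m := ∞) (i := i) (by
        rw [← WithTop.coe_natCast, ← WithTop.coe_add]; simp)).differentiable (by simp) x
    rw [iteratedFDeriv_succ_apply_left, fderiv_continuousMultilinear_apply_const_apply hd]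
    rfl

end PartialDeriv

section CoordinateDeriv

variable {n : ℕ} {F : Type*} [NormedAddCommGroup F] [NormedSpace ℝ F]

/-- The partial derivative `∂_{α₁} ⋯ ∂_{αᵢ}`. -/
def pd {i : ℕ} (α : Fin i → Fin n) (f : Pt n → F) (x : Pt n) : F :=
  iteratedFDeriv ℝ i f x fun a => stdVec (α a)

theorem pd_eq_dirDerivs {f : Pt n → F} (hf : ContDiff ℝ ∞ f) {i : ℕ} (α : Fin i → Fin n) :
    pd α f = dirDerivs (List.ofFn fun a => stdVec (α a)) f :=
  iteratedFDeriv_eq_dirDerivs hf _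

theorem contDiff_pd {f : Pt n → F} (hf : ContDiff ℝ ∞ f) {i : ℕ} (α : Fin i → Fin n) :
    ContDiff ℝ ∞ (pd α f) := by
  rw [pd_eq_dirDerivs hf]
  exact contDiff_dirDerivs hf _

theorem pd_comp_perm {f : Pt n → F} (hf : ContDiff ℝ ∞ f) {i : ℕ} (α : Fin i → Fin n)
    (σ : Equiv.Perm (Fin i)) : pd (α ∘ σ) f = pd α f := by
  rw [pd_eq_dirDerivs hf, pd_eq_dirDerivs hf]
  exact dirDerivs_perm (Equiv.Perm.ofFn_comp_perm σ fun a => stdVec (α a)) hf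

theorem pd_cons {f : Pt n → F} (hf : ContDiff ℝ ∞ f) {i : ℕ} (j : Fin n) (α : Fin i → Fin n) :
    pd (Fin.cons j α : Fin (i + 1) → Fin n) f = fun x => fderiv ℝ (pd α f) x (stdVec j) := by
  rw [pd_eq_dirDerivs hf, pd_eq_dirDerivs hf, List.ofFn_succ]
  rfl

/-- As partial derivatives commute, the new one may also be taken first. This is the order in which
weak derivatives meet a test function. -/
theorem pd_cons' {f : Pt n → F} (hf : ContDiff ℝ ∞ f) {i : ℕ} (j : Fin n) (α : Fin i → Fin n) :
    pd (Fin.cons j α : Fin (i + 1) → Fin n) f = pd α fun x => fderiv ℝ f x (stdVec j) := by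
  rw [pd_eq_dirDerivs hf, pd_eq_dirDerivs (contDiff_dirDeriv hf _), List.ofFn_succ]
  have h : dirDerivs (List.ofFn fun a => stdVec (α a)) (fun x => fderiv ℝ f x (stdVec j)) =
      dirDerivs ((List.ofFn fun a => stdVec (α a)) ++ [stdVec j]) f := by
    simp [dirDerivs, List.foldr_append]
  rw [h]
  exact dirDerivs_perm (List.perm_append_singleton _ _).symm hf

theorem pd_zero_length (α : Fin 0 → Fin n) (f : Pt n → F) : pd α f = f := by
  ext x
  simp [pd]

theorem pd_add {f g : Pt n → F} (hf : ContDiff ℝ ∞ f) (hg : ContDiff ℝ ∞ g) {i : ℕ}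
    (α : Fin i → Fin n) : pd α (f + g) = pd α f + pd α g := by
  ext x
  have hf' : ContDiffAt ℝ i f x := (contDiff_infty.1 hf i).contDiffAt
  have hg' : ContDiffAt ℝ i g x := (contDiff_infty.1 hg i).contDiffAt
  rw [pd, iteratedFDeriv_add_apply hf' hg']
  rfl

theorem pd_zero {i : ℕ} (α : Fin i → Fin n) : pd α (0 : Pt n → F) = 0 := by
  ext x
  simp [pd]

end CoordinateDeriv

/-! ### Polynomials with prescribed mean derivatives -/

section MeanPolynomial

variable {n : ℕ} {E : Type*} [NormedAddCommGroup E] [NormedSpace ℝ E]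

/-- A homogeneous polynomial with prescribed derivatives of top order. -/
theorem exists_homogeneous {i : ℕ} (c : (Fin i → Fin n) → E)
    (hc : ∀ α (σ : Equiv.Perm (Fin i)), c (α ∘ σ) = c α) :
    ∃ p ∈ polySpan n i E, (∀ α, pd α p = fun _ => c α) ∧
      ∀ k, i < k → ∀ α : Fin k → Fin n, pd α p = 0 := by
  classical
  -- The polynomial is `x ↦ A(x, …, x)`. Its derivative along `β` is the sum of `A` over the `i!`
  -- permutations of `β`; in each term only `α = β ∘ σ` survives, and the symmetry of `c` makes it
  -- `c β / i!`.
  let A : ContinuousMultilinearMap ℝ (fun _ : Fin i => Pt n) E :=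
    ((i.factorial : ℝ)⁻¹) • ∑ α : Fin i → Fin n,
      ((ContinuousMultilinearMap.mkPiAlgebra ℝ (Fin i) ℝ).compContinuousLinearMap
        fun a => EuclideanSpace.proj (𝕜 := ℝ) (α a)).smulRight (c α)
  have hA : ∀ v, A v = ((i.factorial : ℝ)⁻¹) • ∑ α : Fin i → Fin n, (∏ a, (v a) (α a)) • c α := by
    intro v
    simp [A]
  set p : Pt n → E := fun x => A fun _ => x with hp
  have hmem : p ∈ polySpan n i E := by
    have : p = ((i.factorial : ℝ)⁻¹) • ∑ α : Fin i → Fin n, fun x : Pt n =>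
        MvPolynomial.eval (fun i => x i) (∏ a, MvPolynomial.X (α a)) • c α := by
      ext x
      simp [hp, hA]
    rw [this]
    refine Submodule.smul_mem _ _ (Submodule.sum_mem _ fun α _ =>
      Submodule.subset_span ⟨_, ?_, _, rfl⟩)
    refine (MvPolynomial.totalDegree_finsetProd _ _).trans ?_
    simp
  have hps := contDiff_of_mem_polySpan hmem
  have htop : ∀ α, pd α p = fun _ => c α := by
    intro β
    ext x
    rw [pd, hp, ContinuousMultilinearMap.iteratedFDeriv_comp_diagonal]
    have h1 : ∀ σ : Equiv.Perm (Fin i), A (fun a => stdVec (β (σ a))) =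
        ((i.factorial : ℝ)⁻¹) • c β := by
      intro σ
      rw [hA, Finset.sum_eq_single (β ∘ σ)]
      · simp [hc]
      · intro α _ hα
        have : ∃ a, α a ≠ β (σ a) := by
          by_contra h
          push Not at h
          exact hα (funext h)
        obtain ⟨a, ha⟩ := this
        rw [Finset.prod_eq_zero (Finset.mem_univ a), zero_smul]
        simp [ha]
      · simp
    rw [Finset.sum_congr rfl fun σ _ => h1 σ, Finset.sum_const, Finset.card_univ,
      Fintype.card_perm, Fintype.card_fin, ← Nat.cast_smul_eq_nsmul ℝ, smul_smul,
      mul_inv_cancel₀ (by exact_mod_cast i.factorial_ne_zero), one_smul]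
  refine ⟨p, hmem, htop, ?_⟩
  intro k hk
  induction k, hk using Nat.le_induction with
  | base =>
    intro α
    rw [← Fin.cons_self_tail α, pd_cons hps, htop]
    ext x
    simp
  | succ k hk ih =>
    intro α
    rw [← Fin.cons_self_tail α, pd_cons hps, ih]
    ext x
    simp

theorem integrableOn_of_contDiff {U : Set (Pt n)} (hb : Bornology.IsBounded U)
    (hUm : MeasurableSet U) {f : Pt n → E} (hf : ContDiff ℝ ∞ f) :
    Integrable f (volume.restrict U) :=
  integrable_restrict_of_memLp hb (memLp_of_continuous hb hUm hf.continuous)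

/-- A polynomial whose derivatives have prescribed integrals. -/
theorem exists_poly_integral_pd_eq [CompleteSpace E] {U : Set (Pt n)} (hUo : IsOpen U)
    (hb : Bornology.IsBounded U) (hne : U.Nonempty) (M : ℕ)
    (c : (i : ℕ) → (Fin i → Fin n) → E)
    (hc : ∀ i < M, ∀ α (σ : Equiv.Perm (Fin i)), c i (α ∘ σ) = c i α) :
    ∃ q ∈ polySpan n M E, (∀ i < M, ∀ α, ∫ x in U, pd α q x = c i α) ∧
      ∀ i, M ≤ i → ∀ α : Fin i → Fin n, pd α q = 0 := by
  induction M generalizing c with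
  | zero => exact ⟨0, Submodule.zero_mem _, by simp, fun i _ α => pd_zero α⟩
  | succ M ih =>
    have hvol : volume.real U ≠ 0 :=
      (ENNReal.toReal_pos (hUo.measure_pos volume hne).ne' hb.measure_lt_top.ne).ne'
    -- Top order is matched first: the derivatives of `p` of order `M` are constants with the right
    -- integral. The lower orders are then corrected by a polynomial whose derivatives of order `M`
    -- vanish.
    obtain ⟨p, hp, hptop, hphigh⟩ := exists_homogeneous (fun α => (volume.real U)⁻¹ • c M α)
      (fun α σ => by rw [hc M (Nat.lt_succ_self M)])
    have hps := contDiff_of_mem_polySpan hp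
    obtain ⟨q, hq, hqint, hqhigh⟩ := ih (fun i α => c i α - ∫ x in U, pd α p x) (by
      intro i hi α σ
      rw [hc i (hi.trans (Nat.lt_succ_self M)), pd_comp_perm hps])
    have hqs := contDiff_of_mem_polySpan hq
    refine ⟨p + q, polySpan_mono (Nat.le_succ M) (Submodule.add_mem _ hp hq), ?_, ?_⟩
    · intro i hi α
      rw [pd_add hps hqs]
      simp only [Pi.add_apply]
      rw [integral_add (integrableOn_of_contDiff hb hUo.measurableSet (contDiff_pd hps α))
        (integrableOn_of_contDiff hb hUo.measurableSet (contDiff_pd hqs α))]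
      rcases Nat.lt_succ_iff_lt_or_eq.1 hi with h | h
      · rw [hqint i h, add_sub_cancel]
      · subst h
        rw [hptop, hqhigh i le_rfl]
        simp [smul_smul, mul_inv_cancel₀ hvol]
    · intro i hi α
      rw [pd_add hps hqs, hphigh i hi, hqhigh i (by omega), add_zero]

end MeanPolynomial

/-! ### Poincaré inequality on convex sets -/

section Poincare

variable {n : ℕ} {E : Type*} [NormedAddCommGroup E] [NormedSpace ℝ E] {U : Set (Pt n)}

theorem enorm_sub_sq_le {E : Type*} [NormedAddCommGroup E] (a b : E) : ‖a - b‖ₑ ^ 2 ≤ 2 * (‖a‖ₑ ^ 2 + ‖b‖ₑ ^ 2) :=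
  (pow_le_pow_left' (enorm_sub_le (a := a) (b := b)) 2).trans (add_sq_le_two_mul _ _)

theorem lintegral_lintegral_enorm_sub_sq_le {E : Type*} [NormedAddCommGroup E]
    (hvol : volume U ≠ ⊤) (R : Pt n → E) :
    ∫⁻ x in U, ∫⁻ y in U, ‖R x - R y‖ₑ ^ 2 ≤ 4 * volume U * ∫⁻ x in U, ‖R x‖ₑ ^ 2 := by
  calc _ ≤ ∫⁻ x in U, (2 * volume U * ‖R x‖ₑ ^ 2 + 2 * ∫⁻ y in U, ‖R y‖ₑ ^ 2) := by
        refine lintegral_mono fun x => ?_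
        refine (lintegral_mono fun y => enorm_sub_sq_le (R x) (R y)).trans (le_of_eq ?_)
        rw [lintegral_const_mul' _ _ (by simp), lintegral_add_left measurable_const,
          setLIntegral_const]
        ring
    _ = _ := by
        rw [lintegral_add_right _ measurable_const, setLIntegral_const,
          lintegral_const_mul' _ _ (ENNReal.mul_ne_top (by simp) hvol)]
        ring

/-- For a function of mean zero the `L²` norm is bounded by the double integral of squared
differences. -/
theorem volume_mul_lintegral_le_of_integral_eq_zero [CompleteSpace E]
    (hb : Bornology.IsBounded U) (hne : volume U ≠ 0) {R : Pt n → E}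
    (hR : MemLp R 2 (volume.restrict U)) (h0 : ∫ x in U, R x = 0) :
    volume U * ∫⁻ x in U, ‖R x‖ₑ ^ 2 ≤ ∫⁻ x in U, ∫⁻ y in U, ‖R x - R y‖ₑ ^ 2 := by
  have hi := integrable_restrict_of_memLp hb hR
  have hvol : volume U ≠ ⊤ := hb.measure_lt_top.ne
  have hfin : IsFiniteMeasure ((volume : Measure (Pt n)).restrict U) :=
    ⟨by simpa using hb.measure_lt_top⟩
  rw [← lintegral_const_mul' _ _ hvol]
  refine lintegral_mono fun x => ?_
  -- The mean-zero condition enters here: integrating `R x - R y` over `y` leaves `|U| R x`.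
  -- Cauchy–Schwarz then gives the claim after cancelling one factor `|U|`.
  have h1 : volume.real U • R x = ∫ y in U, (R x - R y) := by
    rw [integral_sub (integrable_const _) hi, h0, sub_zero, setIntegral_const]
  have h2 : volume U * ‖R x‖ₑ ≤ ∫⁻ y in U, ‖R x - R y‖ₑ := by
    have := enorm_integral_le_lintegral_enorm (μ := volume.restrict U) fun y => R x - R y
    rw [← h1, enorm_smul, Real.enorm_of_nonneg measureReal_nonneg, ofReal_measureReal hvol] at this
    exact this
  have h3 : (volume U * ‖R x‖ₑ) ^ 2 ≤ volume U * ∫⁻ y in U, ‖R x - R y‖ₑ ^ 2 := by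
    refine (pow_le_pow_left' h2 2).trans ?_
    have := sq_lintegral_le_mul (μ := volume.restrict U) (f := fun y => ‖R x - R y‖ₑ)
      ((aestronglyMeasurable_const.sub hR.1).enorm)
    simpa using this
  rw [mul_pow, sq (volume U), mul_assoc] at h3
  exact (ENNReal.mul_le_mul_iff_right hne hvol).1 h3

variable [FiniteDimensional ℝ E]

/-- The Poincaré inequality on a bounded convex open set. -/
theorem HasWeakGrad.poincare (hUo : IsOpen U) (hU : Convex ℝ U)
    (hb : Bornology.IsBounded U) (hne : U.Nonempty) {h : ℝ}
    (hdiam : ∀ x ∈ U, ∀ y ∈ U, dist x y ≤ h) {w : Pt n → E} {G : Fin n → Pt n → E}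
    (hw : HasWeakGrad U w G) (h0 : ∫ x in U, w x = 0) :
    eLpNorm w 2 (volume.restrict U) ≤
      2 ^ (n + 1) * ENNReal.ofReal h * ∑ j, eLpNorm (G j) 2 (volume.restrict U) := by
  have hvol : volume U ≠ ⊤ := hb.measure_lt_top.ne
  have hvol0 : volume U ≠ 0 := (hUo.measure_pos volume hne).ne'
  obtain ⟨φ, hφ, hφ0, hφ1⟩ := hw.exists_smooth_approx hUo hU hb hne
  -- The double integral for `w` is split into those for `φ i` and `φ i - w`. The former falls under
  -- the smooth inequality, the latter costs `8 = 2 * 4` times `‖φ i - w‖²` and vanishes in the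
  -- limit.
  have key : ∀ i, eLpNorm w 2 (volume.restrict U) ^ 2 ≤
      2 ^ (n + 1) * (ENNReal.ofReal h *
        ∑ j, (eLpNorm ((fun x => fderiv ℝ (φ i) x (stdVec j)) - G j) 2 (volume.restrict U) +
          eLpNorm (G j) 2 (volume.restrict U))) ^ 2 +
      8 * eLpNorm (φ i - w) 2 (volume.restrict U) ^ 2 := by
    intro i
    have hφ1' : ContDiff ℝ 1 (φ i) := (hφ i).of_le (by simp)
    have hc := (hφ i).continuous
    have hm2 : Measurable fun p : Pt n × Pt n => ‖φ i p.1 - φ i p.2‖ₑ ^ 2 := by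
      have : Continuous fun p : Pt n × Pt n => φ i p.1 - φ i p.2 := by fun_prop
      exact this.enorm.measurable.pow_const 2
    have hm1 : ∀ x, Measurable fun y => ‖φ i x - φ i y‖ₑ ^ 2 := fun x => by
      have : Continuous fun y => φ i x - φ i y := by fun_prop
      exact this.enorm.measurable.pow_const 2
    have h1 := volume_mul_lintegral_le_of_integral_eq_zero hb hvol0 hw.memLp h0
    have h2 := lintegral_lintegral_sub_sq_le hU hUo.measurableSet hdiam hφ1'
    have h3 := lintegral_lintegral_enorm_sub_sq_le hvol (φ i - w)
    have h4 : ∫⁻ x in U, ∫⁻ y in U, ‖w x - w y‖ₑ ^ 2 ≤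
        2 * (∫⁻ x in U, ∫⁻ y in U, ‖φ i x - φ i y‖ₑ ^ 2) +
        2 * ∫⁻ x in U, ∫⁻ y in U, ‖(φ i - w) x - (φ i - w) y‖ₑ ^ 2 := by
      rw [← mul_add, ← lintegral_add_left hm2.lintegral_prod_right',
        ← lintegral_const_mul' _ _ (by simp)]
      refine lintegral_mono fun x => ?_
      rw [← lintegral_add_left (hm1 x), ← lintegral_const_mul' _ _ (by simp)]
      refine lintegral_mono fun y => ?_
      have := enorm_sub_sq_le (φ i x - φ i y) ((φ i - w) x - (φ i - w) y)
      rwa [show φ i x - φ i y - ((φ i - w) x - (φ i - w) y) = w x - w y by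
        simp only [Pi.sub_apply]; abel] at this
    have h5 : volume U * ∫⁻ x in U, ‖w x‖ₑ ^ 2 ≤
        volume U * (2 ^ (n + 1) * (ENNReal.ofReal h ^ 2 * ∫⁻ x in U, ‖gradSum (φ i) x‖ₑ ^ 2) +
          8 * ∫⁻ x in U, ‖(φ i - w) x‖ₑ ^ 2) := by
      refine (h1.trans h4).trans ?_
      calc _ ≤ 2 * (2 ^ n * volume U *
              (ENNReal.ofReal h ^ 2 * ∫⁻ x in U, ‖gradSum (φ i) x‖ₑ ^ 2)) +
            2 * (4 * volume U * ∫⁻ x in U, ‖(φ i - w) x‖ₑ ^ 2) := by gcongr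
        _ = _ := by ring
    rw [ENNReal.mul_le_mul_iff_right hvol0 hvol] at h5
    rw [eLpNorm_two_sq, eLpNorm_two_sq]
    refine h5.trans ?_
    gcongr
    rw [← eLpNorm_two_sq, ← mul_pow]
    gcongr
    refine (eLpNorm_gradSum_le hφ1' _).trans (Finset.sum_le_sum fun j _ => ?_)
    have := eLpNorm_add_le (p := 2) (f := (fun x => fderiv ℝ (φ i) x (stdVec j)) - G j)
      (g := G j) (μ := volume.restrict U)
      ((continuous_fderiv_stdVec hφ1' j).aestronglyMeasurable.sub (hw.memLp_grad j).1)
      (hw.memLp_grad j).1 (by norm_num)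
    rwa [sub_add_cancel] at this
  have hlim : Tendsto (fun i => 2 ^ (n + 1) * (ENNReal.ofReal h *
        ∑ j, (eLpNorm ((fun x => fderiv ℝ (φ i) x (stdVec j)) - G j) 2 (volume.restrict U) +
          eLpNorm (G j) 2 (volume.restrict U))) ^ 2 +
      8 * eLpNorm (φ i - w) 2 (volume.restrict U) ^ 2) atTop
      (𝓝 (2 ^ (n + 1) * (ENNReal.ofReal h *
        ∑ j, eLpNorm (G j) 2 (volume.restrict U)) ^ 2 + 8 * 0 ^ 2)) := by
    have hfin : ∀ j, eLpNorm (G j) 2 (volume.restrict U) ≠ ⊤ := fun j =>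
      (hw.memLp_grad j).eLpNorm_ne_top
    have hs : Tendsto (fun i => ∑ j, (eLpNorm ((fun x => fderiv ℝ (φ i) x (stdVec j)) - G j) 2
        (volume.restrict U) + eLpNorm (G j) 2 (volume.restrict U))) atTop
        (𝓝 (∑ j, eLpNorm (G j) 2 (volume.restrict U))) := by
      refine tendsto_finsetSum _ fun j _ => ?_
      simpa using (hφ1 j).add_const (eLpNorm (G j) 2 (volume.restrict U))
    have hsfin : ∑ j, eLpNorm (G j) 2 (volume.restrict U) ≠ ⊤ :=
      ENNReal.sum_ne_top.2 fun j _ => hfin j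
    refine Tendsto.add ?_ ?_
    · refine ENNReal.Tendsto.const_mul (ENNReal.Tendsto.pow
        (ENNReal.Tendsto.const_mul hs (Or.inr (by simp)))) (Or.inr (by simp))
    · exact ENNReal.Tendsto.const_mul (ENNReal.Tendsto.pow hφ0) (Or.inr (by simp))
  have hle := ge_of_tendsto' hlim key
  have hsq : eLpNorm w 2 (volume.restrict U) ^ 2 ≤
      (2 ^ (n + 1) * ENNReal.ofReal h * ∑ j, eLpNorm (G j) 2 (volume.restrict U)) ^ 2 := by
    refine hle.trans ?_
    rw [mul_assoc, mul_pow (2 ^ (n + 1) : ℝ≥0∞)]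
    simp only [ne_eq, OfNat.ofNat_ne_zero, not_false_eq_true, zero_pow, mul_zero, add_zero]
    -- The constant `2^(n+1)` is replaced by its square, so that both sides are squares and the root
    -- leaves an integer power.
    refine mul_le_mul_left ?_ _
    exact le_self_pow (one_le_pow₀ (by norm_num : (1 : ℝ≥0∞) ≤ 2)) two_ne_zero
  exact (ENNReal.pow_le_pow_left_iff two_ne_zero).1 hsq

end Poincare

/-! ### Weak derivatives of higher order -/

section Jets

variable {n k : ℕ} {U : Set (Pt n)}

theorem ae_eq_of_forall_integral_eq {E : Type*} [NormedAddCommGroup E] [NormedSpace ℝ E]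
    [CompleteSpace E] (hU : IsOpen U) (hb : Bornology.IsBounded U) {f g : Pt n → E}
    (hf : MemLp f 2 (volume.restrict U)) (hg : MemLp g 2 (volume.restrict U))
    (h : ∀ φ : Pt n → ℝ, ContDiff ℝ ∞ φ → HasCompactSupport φ → tsupport φ ⊆ U →
      ∫ x in U, φ x • f x = ∫ x in U, φ x • g x) : f =ᵐ[volume.restrict U] g := by
  have hint := integrable_restrict_of_memLp hb (hf.sub hg)
  have := hU.ae_eq_zero_of_integral_contDiff_smul_eq_zero (f := f - g) (μ := volume)
    (IntegrableOn.locallyIntegrableOn hint) (by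
      intro φ hφ hc hs
      rw [← setIntegral_eq_of_tsupport_subset (U := U)
        ((tsupport_smul_subset_left φ (f - g)).trans hs)]
      simp only [Pi.sub_apply, smul_sub]
      rw [integral_sub (integrable_smul_of_memLp hb hf hφ.continuous hc)
        (integrable_smul_of_memLp hb hg hφ.continuous hc), h φ hφ hc hs, sub_self])
  rw [EventuallyEq, ae_restrict_iff' hU.measurableSet]
  filter_upwards [this] with x hx hxU
  exact sub_eq_zero.1 (hx hxU)

variable {m : ℕ} {v : Form n k} {D : (i : ℕ) → (Fin i → Fin n) → Form n k}

theorem IsWeakJet.ae_eq_zero_order (hD : IsWeakJet U m v D) (hU : IsOpen U)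
    (hb : Bornology.IsBounded U) (α : Fin 0 → Fin n) : D 0 α =ᵐ[volume.restrict U] v := by
  refine ae_eq_of_forall_integral_eq hU hb (hD.memL2_deriv 0 (Nat.zero_le m) α) hD.memL2 ?_
  intro φ hφ hc hs
  have := hD.eq 0 (Nat.zero_le m) α φ hφ hc hs
  simpa using this.symm

/-- The identity of order `i` tested with `∂ⱼφ` and the identity of order `i + 1` tested with `φ`
have the same left side; the common sign `(-1)^i` cancels. -/
theorem IsWeakJet.hasWeakGrad (hD : IsWeakJet U m v D) {i : ℕ} (hi : i < m)
    (α : Fin i → Fin n) :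
    HasWeakGrad U (D i α) fun j => D (i + 1) (Fin.cons j α : Fin (i + 1) → Fin n) := by
  refine ⟨hD.memL2_deriv i hi.le α, fun j => hD.memL2_deriv (i + 1) hi _, ?_⟩
  intro j φ hφ hc hs
  have h1 := hD.eq i hi.le α (fun x => fderiv ℝ φ x (stdVec j)) (contDiff_dirDeriv hφ _)
    (hc.fderiv_apply ℝ _) ((tsupport_fderiv_apply_subset ℝ _).trans hs)
  have h2 := hD.eq (i + 1) hi (Fin.cons j α : Fin (i + 1) → Fin n) φ hφ hc hs
  have h3 : (fun x => (iteratedFDeriv ℝ (i + 1) φ x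
      fun a => stdVec ((Fin.cons j α : Fin (i + 1) → Fin n) a)) • v x) =
      fun x => (iteratedFDeriv ℝ i (fun x => fderiv ℝ φ x (stdVec j)) x
        fun a => stdVec (α a)) • v x := by
    ext1 x
    exact congrArg (· • v x) (congrFun (pd_cons' hφ j α) x)
  rw [h3, h1, pow_succ, mul_smul] at h2
  have h4 := smul_right_injective (Alt (Pt n) k) (pow_ne_zero i (by norm_num : (-1 : ℝ) ≠ 0)) h2
  exact h4.trans (by ext; simp)

/-- The symmetry is inherited from the test functions. It makes the means of the weak derivatives
symmetric, as needed to realise them by a polynomial. -/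
theorem IsWeakJet.comp_perm (hD : IsWeakJet U m v D) (hU : IsOpen U)
    (hb : Bornology.IsBounded U) {i : ℕ} (hi : i ≤ m) (α : Fin i → Fin n)
    (σ : Equiv.Perm (Fin i)) : D i (α ∘ σ) =ᵐ[volume.restrict U] D i α := by
  refine ae_eq_of_forall_integral_eq hU hb (hD.memL2_deriv i hi _) (hD.memL2_deriv i hi _) ?_
  intro φ hφ hc hs
  have h1 := hD.eq i hi α φ hφ hc hs
  have h2 := hD.eq i hi (α ∘ σ) φ hφ hc hs
  have h3 : (fun x => (iteratedFDeriv ℝ i φ x fun a => stdVec ((α ∘ σ) a)) • v x) =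
      fun x => (iteratedFDeriv ℝ i φ x fun a => stdVec (α a)) • v x := by
    ext1 x
    exact congrArg (· • v x) (congrFun (pd_comp_perm hφ α σ) x)
  rw [h3, h1] at h2
  exact (smul_right_injective (Alt (Pt n) k) (pow_ne_zero i (by norm_num : (-1 : ℝ) ≠ 0)) h2).symm

end Jets

/-! ### Bramble–Hilbert lemma of real order -/

section BrambleHilbert

variable {n k : ℕ}

/-- The simplex contains a ball whose radius is at least its diameter divided by `max γ 1`. -/
theorem exists_volume_cell_ge (hn : 0 < n) (γ : ℝ) : ∃ c : ℝ, 0 < c ∧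
    ∀ K : Finset (Pt n), IsRegularSimplex γ K →
      ENNReal.ofReal (c * cellDiam K ^ n) ≤ volume (cell K) := by
  refine ⟨((max γ 1) ^ n)⁻¹ * volume.real (Metric.ball (0 : Pt n) 1), ?_, fun K hK => ?_⟩
  · have : 0 < volume.real (Metric.ball (0 : Pt n) 1) :=
      ENNReal.toReal_pos (Metric.measure_ball_pos volume _ one_pos).ne' measure_ball_lt_top.ne
    positivity
  · have hh := hK.cellDiam_pos hn
    obtain ⟨c, ρ, hρ, hb, h⟩ := hK.ball
    refine le_trans ?_ (measure_mono (ball_subset_cell hb))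
    rw [Measure.addHaar_ball_of_pos _ _ hρ, finrank_euclideanSpace_fin,
      ← ofReal_measureReal (measure_ball_lt_top (x := (0 : Pt n)) (r := 1)).ne,
      ← ENNReal.ofReal_mul (by positivity)]
    refine ENNReal.ofReal_le_ofReal ?_
    rw [mul_right_comm, ← inv_pow, ← mul_pow]
    gcongr
    rw [inv_mul_le_iff₀ (by positivity)]
    exact h.trans (mul_le_mul_of_nonneg_right (le_max_left _ _) hρ.le)

variable (n k) in
/-- The double integral of squared differences of a form is bounded by its Slobodeckij seminorm. -/
theorem exists_diff_le_slobodeckij (hn : 0 < n) (γ θ : ℝ) (hθ : 0 ≤ θ) : ∃ C : ℝ, 0 < C ∧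
    ∀ K : Finset (Pt n), IsRegularSimplex γ K → ∀ w : Form n k,
      ∫⁻ x in cell K, ∫⁻ y in cell K, ‖w x - w y‖ₑ ^ 2 ≤
        volume (cell K) * (ENNReal.ofReal (C * cellDiam K ^ θ) ^ 2 *
          slobodeckijSq (cell K) θ w) := by
  obtain ⟨c, hc, hcl⟩ := exists_eLpNorm_le_l2Norm (Pt n) k
  obtain ⟨b, hb, hvol⟩ := exists_volume_cell_ge hn γ
  rcases eq_or_lt_of_le hθ with rfl | hθ
  · refine ⟨2 * c, by positivity, fun K hK w => ?_⟩
    refine (lintegral_lintegral_enorm_sub_sq_le isBounded_cell.measure_lt_top.ne w).trans ?_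
    rw [slobodeckijSq, if_pos rfl, Real.rpow_zero, mul_one, ← eLpNorm_two_sq, ENNReal.ofReal_mul
      (by norm_num), ENNReal.ofReal_ofNat, mul_pow]
    have := pow_le_pow_left' (hcl (volume.restrict (cell K)) w) 2
    rw [mul_pow] at this
    calc _ = volume (cell K) * (4 * eLpNorm w 2 (volume.restrict (cell K)) ^ 2) := by ring
      _ ≤ volume (cell K) * (4 * (ENNReal.ofReal c ^ 2 *
          l2Norm (volume.restrict (cell K)) w ^ 2)) := by gcongr
      _ = _ := by rw [← mul_assoc (4 : ℝ≥0∞)]; norm_num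
  · have hpt : ∀ α : Alt (Pt n) k, ‖α‖ₑ ^ 2 ≤ ENNReal.ofReal c ^ 2 * ENNReal.ofReal (altInner α α) := by
      intro α
      -- A point mass turns the comparison of `L²` norms into a pointwise one.
      have := hcl (Measure.dirac (0 : Unit)) fun _ => α
      rw [l2Norm_eq_eLpNorm, eLpNorm_const _ (by norm_num) (by simp), eLpNorm_const _ (by norm_num)
        (by simp)] at this
      simp only [measure_univ, ENNReal.one_rpow, mul_one] at this
      have := pow_le_pow_left' this 2
      rwa [mul_pow, ← ofReal_norm (altEval _ _ α), ← ENNReal.ofReal_pow (norm_nonneg _),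
        ← altInner_self] at this
    refine ⟨(c ^ 2 * b⁻¹) ^ (1 / 2 : ℝ), by positivity, fun K hK w => ?_⟩
    have hh := hK.cellDiam_pos hn
    set h := cellDiam K
    have hsq : ENNReal.ofReal ((c ^ 2 * b⁻¹) ^ (1 / 2 : ℝ) * h ^ θ) ^ 2 =
        ENNReal.ofReal (c ^ 2 * b⁻¹ * h ^ (2 * θ)) := by
      rw [← ENNReal.ofReal_pow (by positivity), mul_pow, ← Real.rpow_natCast, ← Real.rpow_mul
        (by positivity), ← Real.rpow_natCast (h ^ θ), ← Real.rpow_mul hh.le]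
      norm_num
      rw [mul_comm θ]
    have h1 : ∫⁻ x in cell K, ∫⁻ y in cell K, ‖w x - w y‖ₑ ^ 2 ≤
        ENNReal.ofReal (c ^ 2 * h ^ ((n : ℝ) + 2 * θ)) * slobodeckijSq (cell K) θ w := by
      rw [slobodeckijSq, if_neg hθ.ne', ← lintegral_const_mul' _ _ (by simp)]
      refine setLIntegral_mono' isOpen_cell.measurableSet fun x hx => ?_
      rw [← lintegral_const_mul' _ _ (by simp)]
      refine setLIntegral_mono' isOpen_cell.measurableSet fun y hy => ?_
      -- On the diagonal the Slobodeckij quotient takes its default value; the numerator is zero, so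
      -- the bound is trivial there.
      rcases eq_or_ne x y with rfl | hxy
      · exact (hpt _).trans (by simp [altInner])
      · refine (hpt _).trans ?_
        have hd : 0 < ‖x - y‖ := norm_pos_iff.2 (sub_ne_zero.2 hxy)
        have hdh : ‖x - y‖ ≤ h := by
          rw [← dist_eq_norm]
          exact dist_le_cellDiam (interior_subset hx) (interior_subset hy)
        rw [← ENNReal.ofReal_pow hc.le, ← ENNReal.ofReal_mul (by positivity),
          ← ENNReal.ofReal_mul (by positivity)]
        refine ENNReal.ofReal_le_ofReal ?_
        have h0 : 0 ≤ altInner (w x - w y) (w x - w y) := by rw [altInner_self]; positivity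
        rw [mul_assoc, mul_div_assoc']
        gcongr
        rw [le_div_iff₀ (by positivity), mul_comm]
        gcongr
    -- One factor `h^n` of `h^(n + 2θ)` is traded for the volume by shape regularity.
    refine h1.trans ?_
    rw [hsq, ← mul_assoc]
    gcongr
    refine le_trans ?_ (mul_le_mul_left (hvol K hK) _)
    rw [← ENNReal.ofReal_mul (by positivity)]
    refine ENNReal.ofReal_le_ofReal (le_of_eq ?_)
    rw [Real.rpow_add hh, Real.rpow_natCast]
    field_simp
    rfl

/-- The Bramble–Hilbert lemma: approximation of a form by polynomials on a shape-regular simplex. -/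
theorem exists_poly_approx (n k : ℕ) (hn : 0 < n) (γ : ℝ) (m : ℕ) (hm : 1 ≤ m) (θ : ℝ)
    (hθ : 0 ≤ θ) : ∃ C : ℝ, 0 < C ∧
    ∀ K : Finset (Pt n), IsRegularSimplex γ K → ∀ (v : Form n k)
      (D : (i : ℕ) → (Fin i → Fin n) → Form n k), IsWeakJet (cell K) m v D →
      ∃ q ∈ polySpan n (m + 1) (Alt (Pt n) k), ∃ G, HasWeakGrad (cell K) (v - q) G ∧
        eLpNorm (v - q) 2 (volume.restrict (cell K)) +
          ENNReal.ofReal (cellDiam K) * ∑ j, eLpNorm (G j) 2 (volume.restrict (cell K)) ≤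
        ENNReal.ofReal (C * cellDiam K ^ (m + θ)) *
          (∑ α : Fin m → Fin n, slobodeckijSq (cell K) θ (D m α)) ^ (1 / 2 : ℝ) := by
  obtain ⟨C, hC, hslob⟩ := exists_diff_le_slobodeckij n k hn γ θ hθ
  refine ⟨2 * (2 ^ (n + 1)) ^ m * (n ^ m * C), by positivity, fun K hK v D hD => ?_⟩
  have hh := hK.cellDiam_pos hn
  set h := cellDiam K with hhdef
  set U := cell K with hUdef
  have hU : IsOpen U := isOpen_cell
  have hb : Bornology.IsBounded U := isBounded_cell
  have hne : U.Nonempty := by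
    obtain ⟨c, ρ, hρ, hball, -⟩ := hK.ball
    exact ⟨c, ball_subset_cell hball (Metric.mem_ball_self hρ)⟩
  have hvol : volume U ≠ ⊤ := hb.measure_lt_top.ne
  have hvol0 : volume U ≠ 0 := (hU.measure_pos volume hne).ne'
  have hdiam : ∀ x ∈ U, ∀ y ∈ U, dist x y ≤ h := fun x hx y hy =>
    dist_le_cellDiam (interior_subset hx) (interior_subset hy)
  -- The bound `m + 1` matches the means of orders `0, …, m` inclusive, and makes all derivatives of
  -- `q` of order `m + 1` vanish.
  obtain ⟨q, hq, hqint, hqhigh⟩ := exists_poly_integral_pd_eq hU hb hne (m + 1)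
    (fun i α => ∫ x in U, D i α x) (fun i hi α σ =>
      integral_congr_ae (hD.comp_perm hU hb (Nat.lt_succ_iff.1 hi) α σ))
  have hqs := contDiff_of_mem_polySpan hq
  set R : (i : ℕ) → (Fin i → Fin n) → Form n k := fun i α => D i α - pd α q with hR
  have hRmem : ∀ i ≤ m, ∀ α, MemLp (R i α) 2 (volume.restrict U) := fun i hi α =>
    (hD.memL2_deriv i hi α).sub
      (memLp_of_continuous hb hU.measurableSet (contDiff_pd hqs α).continuous)
  have hRint : ∀ i ≤ m, ∀ α, ∫ x in U, R i α x = 0 := by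
    intro i hi α
    simp only [hR, Pi.sub_apply]
    rw [integral_sub (integrable_restrict_of_memLp hb (hD.memL2_deriv i hi α))
      (integrableOn_of_contDiff hb hU.measurableSet (contDiff_pd hqs α)),
      hqint i (Nat.lt_succ_of_le hi), sub_self]
  have hRgrad : ∀ i < m, ∀ α : Fin i → Fin n,
      HasWeakGrad U (R i α) fun j => R (i + 1) (Fin.cons j α : Fin (i + 1) → Fin n) := by
    intro i hi α
    have h1 := (hD.hasWeakGrad hi α).sub hb (hasWeakGrad_of_contDiff hb hU.measurableSet
      ((contDiff_pd hqs α).of_le (by simp)))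
    simp only [hR, pd_cons hqs]
    exact h1
  set N : ℕ → ℝ≥0∞ := fun i => ∑ α : Fin i → Fin n, eLpNorm (R i α) 2 (volume.restrict U) with hN
  have hcons : ∀ i, ∑ α : Fin i → Fin n, ∑ j, eLpNorm (R (i + 1)
      (Fin.cons j α : Fin (i + 1) → Fin n)) 2 (volume.restrict U) = N (i + 1) := by
    intro i
    rw [hN, Finset.sum_comm, ← Fintype.sum_prod_type']
    exact Fintype.sum_equiv (Fin.consEquiv fun _ => Fin n) _ _ fun _ => rfl
  have hstep : ∀ i < m, N i ≤ 2 ^ (n + 1) * ENNReal.ofReal h * N (i + 1) := by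
    intro i hi
    rw [← hcons, Finset.mul_sum]
    exact Finset.sum_le_sum fun α _ =>
      (hRgrad i hi α).poincare hU convex_cell hb hne hdiam (hRint i hi.le α)
  -- Every remainder of order at most `m` has mean zero, so the Poincaré inequality can be repeated
  -- up to order `m`, one factor of `h` per step.
  have hiter : ∀ d i, i + d = m → N i ≤ (2 ^ (n + 1) * ENNReal.ofReal h) ^ d * N m := by
    intro d
    induction d with
    | zero => rintro i rfl; simp
    | succ d ih =>
      intro i hi
      refine (hstep i (by omega)).trans ?_
      rw [pow_succ' (2 ^ (n + 1) * ENNReal.ofReal h), mul_assoc _ _ (N m)]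
      exact mul_le_mul_right (ih (i + 1) (by omega)) _
  set Q : ℝ≥0∞ := (∑ α : Fin m → Fin n, slobodeckijSq U θ (D m α)) ^ (1 / 2 : ℝ) with hQ
  have htop : ∀ α : Fin m → Fin n, eLpNorm (R m α) 2 (volume.restrict U) ≤
      ENNReal.ofReal (C * h ^ θ) * Q := by
    intro α
    -- The derivatives of `q` of order `m` are constants and drop out of differences, so the
    -- remainder has the differences of `D m α` itself.
    have hconst : ∀ x y, pd α q x = pd α q y := by
      refine is_const_of_fderiv_eq_zero ((contDiff_pd hqs α).differentiable (by simp)) fun x => ?_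
      ext1 d
      have h1 := norm_fderiv_le_gradSum (pd α q) x d
      have h2 : gradSum (pd α q) x = 0 := by
        refine Finset.sum_eq_zero fun j _ => ?_
        have := congrFun (pd_cons hqs j α) x
        rw [hqhigh (m + 1) le_rfl] at this
        rw [← this]
        simp
      rw [h2, mul_zero] at h1
      simpa using norm_le_zero_iff.1 h1
    have h1 := volume_mul_lintegral_le_of_integral_eq_zero hb hvol0 (hRmem m le_rfl α)
      (hRint m le_rfl α)
    have h2 : ∀ x y, R m α x - R m α y = D m α x - D m α y := by
      intro x y
      simp only [hR, Pi.sub_apply]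
      rw [hconst x y]
      abel
    simp only [h2] at h1
    have h3 := h1.trans (hslob K hK (D m α))
    rw [ENNReal.mul_le_mul_iff_right hvol0 hvol, ← eLpNorm_two_sq] at h3
    have h4 : slobodeckijSq U θ (D m α) ≤ Q ^ 2 := by
      rw [hQ, ← ENNReal.rpow_natCast, ← ENNReal.rpow_mul]
      norm_num
      exact Finset.single_le_sum (f := fun α => slobodeckijSq U θ (D m α))
        (fun _ _ => zero_le) (Finset.mem_univ α)
    refine (ENNReal.pow_le_pow_left_iff two_ne_zero).1 (h3.trans ?_)
    rw [mul_pow]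
    gcongr
  have hNm : N m ≤ ENNReal.ofReal (n ^ m * C * h ^ θ) * Q := by
    calc N m ≤ ∑ _α : Fin m → Fin n, ENNReal.ofReal (C * h ^ θ) * Q :=
          Finset.sum_le_sum fun α _ => htop α
      _ = _ := by
          rw [Finset.sum_const, Finset.card_univ, Fintype.card_fun, Fintype.card_fin,
            Fintype.card_fin, nsmul_eq_mul, mul_assoc ((n : ℝ) ^ m),
            ENNReal.ofReal_mul (p := (n : ℝ) ^ m) (by positivity), mul_assoc, ENNReal.ofReal_pow (by positivity)]
          simp
  have hα0 : (default : Fin 0 → Fin n) = Fin.elim0 := Subsingleton.elim _ _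
  refine ⟨q, hq, fun j => R 1 (Fin.cons j Fin.elim0 : Fin 1 → Fin n), ?_, ?_⟩
  · refine (hRgrad 0 hm Fin.elim0).congr ?_ fun j => EventuallyEq.rfl
    filter_upwards [hD.ae_eq_zero_order hU hb Fin.elim0] with x hx
    simp [hR, hx, pd_zero_length]
  · have hN0 : eLpNorm (v - q) 2 (volume.restrict U) = N 0 := by
      rw [hN]
      simp only [Finset.univ_unique, Finset.sum_singleton]
      refine eLpNorm_congr_ae ?_
      filter_upwards [hD.ae_eq_zero_order hU hb default] with x hx
      simp [hR, hx, pd_zero_length]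
    have hN1 : ∑ j, eLpNorm (R 1 (Fin.cons j Fin.elim0 : Fin 1 → Fin n)) 2 (volume.restrict U) =
        N 1 := by
      rw [← hcons 0]
      simp only [Finset.univ_unique, Finset.sum_singleton, hα0]
    rw [hN0, hN1]
    have e1 := hiter m 0 (by omega)
    have e2 := hiter (m - 1) 1 (by omega)
    -- The gradient takes one Poincaré step fewer; the weight `h` in front restores the missing
    -- power of `h`, and the missing factor `2^(n+1) ≥ 1` is added for free.
    have e3 : ENNReal.ofReal h * N 1 ≤ (2 ^ (n + 1) * ENNReal.ofReal h) ^ m * N m := by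
      calc _ ≤ (2 ^ (n + 1) * ENNReal.ofReal h) *
            ((2 ^ (n + 1) * ENNReal.ofReal h) ^ (m - 1) * N m) := by
            gcongr
            exact le_mul_of_one_le_left zero_le (one_le_pow₀ (by norm_num))
        _ = _ := by rw [← mul_assoc, ← pow_succ', Nat.sub_add_cancel hm]
    calc N 0 + ENNReal.ofReal h * N 1 ≤ 2 * ((2 ^ (n + 1) * ENNReal.ofReal h) ^ m * N m) := by
          rw [two_mul]; exact add_le_add e1 e3
      _ ≤ 2 * ((2 ^ (n + 1) * ENNReal.ofReal h) ^ m *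
          (ENNReal.ofReal (n ^ m * C * h ^ θ) * Q)) := by gcongr
      _ = _ := by
          rw [← mul_assoc, ← mul_assoc, Real.rpow_add hh, Real.rpow_natCast]
          congr 1
          rw [← ENNReal.ofReal_ofNat, ← ENNReal.ofReal_pow (by norm_num),
            ← ENNReal.ofReal_mul (by positivity), ← ENNReal.ofReal_pow (by positivity),
            ← ENNReal.ofReal_mul (by positivity), ← ENNReal.ofReal_mul (by positivity)]
          congr 1
          ring

end BrambleHilbert

/-! ### First-order Sobolev seminorm and weak gradients -/

section FirstOrder

variable {n k : ℕ} {U : Set (Pt n)} {v : Form n k} {G : Fin n → Form n k}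

theorem sum_sq_le_sq_sum {ι : Type*} (s : Finset ι) (a : ι → ℝ≥0∞) :
    ∑ i ∈ s, a i ^ 2 ≤ (∑ i ∈ s, a i) ^ 2 := by
  classical
  induction s using Finset.induction_on with
  | empty => simp
  | insert i s hi ih =>
    rw [Finset.sum_insert hi, Finset.sum_insert hi]
    exact (add_le_add_right ih _).trans (add_sq_le_sq_add _ _)

theorem rpow_half_le_iff {a b : ℝ≥0∞} : a ^ (1 / 2 : ℝ) ≤ b ↔ a ≤ b ^ 2 := by
  rw [one_div, ENNReal.rpow_inv_le_iff (by norm_num)]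
  norm_num

theorem rpow_half_sum_sq_le {ι : Type*} (s : Finset ι) (a : ι → ℝ≥0∞) :
    (∑ i ∈ s, a i ^ 2) ^ (1 / 2 : ℝ) ≤ ∑ i ∈ s, a i :=
  rpow_half_le_iff.2 (sum_sq_le_sq_sum s a)

theorem le_rpow_half_sum_sq {ι : Type*} {s : Finset ι} (a : ι → ℝ≥0∞) {i : ι} (hi : i ∈ s) :
    a i ≤ (∑ i ∈ s, a i ^ 2) ^ (1 / 2 : ℝ) := by
  rw [one_div, ENNReal.le_rpow_inv_iff (by norm_num)]
  norm_num
  exact Finset.single_le_sum (f := fun i => a i ^ 2) (fun _ _ => zero_le) hi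

theorem rpow_half_sq (a : ℝ≥0∞) : (a ^ (1 / 2 : ℝ)) ^ 2 = a := by
  rw [← ENNReal.rpow_natCast, ← ENNReal.rpow_mul]
  norm_num

/-- The jet of order one that consists of a form and its weak gradient. -/
def gradJet (v : Form n k) (G : Fin n → Form n k) : (i : ℕ) → (Fin i → Fin n) → Form n k
  | 0, _ => v
  | _ + 1, α => G (α 0)

theorem HasWeakGrad.isWeakJet (h : HasWeakGrad U v G) : IsWeakJet U 1 v (gradJet v G) := by
  refine ⟨h.memLp, fun i hi α => ?_, fun i hi α φ hφ hc hs => ?_⟩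
  · cases i with
    | zero => exact h.memLp
    | succ i => exact h.memLp_grad _
  · obtain rfl | rfl : i = 0 ∨ i = 1 := by omega
    · simp [gradJet]
    · simp only [iteratedFDeriv_one_apply, pow_one, gradJet]
      rw [h.eq (α 0) φ hφ hc hs]
      ext
      simp

theorem sobolevSeminorm_one : sobolevSeminorm U 1 v =
    ⨅ (D : (i : ℕ) → (Fin i → Fin n) → Form n k) (_ : IsWeakJet U 1 v D),
      (∑ α : Fin 1 → Fin n, l2Norm (volume.restrict U) (D 1 α) ^ 2) ^ (1 / 2 : ℝ) := by
  unfold sobolevSeminorm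
  rw [Nat.floor_one]
  simp [slobodeckijSq]

theorem HasWeakGrad.sobolevSeminorm_one_le (h : HasWeakGrad U v G) :
    sobolevSeminorm U 1 v ≤ ∑ α : Fin 1 → Fin n, l2Norm (volume.restrict U) (G (α 0)) := by
  rw [sobolevSeminorm_one]
  exact (iInf₂_le _ h.isWeakJet).trans (rpow_half_sum_sq_le _ _)

theorem IsWeakJet.hasWeakGrad_one {m : ℕ} {D : (i : ℕ) → (Fin i → Fin n) → Form n k}
    (hD : IsWeakJet U m v D) (hm : 1 ≤ m)
    (hU : IsOpen U) (hb : Bornology.IsBounded U) :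
    HasWeakGrad U v fun j => D 1 (Fin.cons j Fin.elim0 : Fin 1 → Fin n) :=
  (hD.hasWeakGrad hm Fin.elim0).congr (hD.ae_eq_zero_order hU hb _) fun _ => EventuallyEq.rfl

/-- The seminorm is an infimum over jets, but uniqueness of weak gradients gives all jets the same
first derivatives almost everywhere. -/
theorem HasWeakGrad.l2Norm_le_sobolevSeminorm (h : HasWeakGrad U v G) (hU : IsOpen U)
    (hb : Bornology.IsBounded U) (j : Fin n) :
    l2Norm (volume.restrict U) (G j) ≤ sobolevSeminorm U 1 v := by
  rw [sobolevSeminorm_one]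
  refine le_iInf₂ fun D hD => ?_
  rw [l2Norm_congr_ae (h.unique hU hb (hD.hasWeakGrad_one le_rfl hU hb) j)]
  exact le_rpow_half_sum_sq (fun α => l2Norm (volume.restrict U) (D 1 α)) (Finset.mem_univ _)

theorem MemSobolev.exists_hasWeakGrad (h : MemSobolev U 1 v) (hU : IsOpen U)
    (hb : Bornology.IsBounded U) : ∃ G, HasWeakGrad U v G := by
  rw [MemSobolev, sobolevSeminorm_one] at h
  simp only [iInf_lt_iff] at h
  obtain ⟨D, hD, -⟩ := h
  exact ⟨_, hD.hasWeakGrad_one le_rfl hU hb⟩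

end FirstOrder

/-! ### Elementary facts on `L²` norms -/

section LpBasics

theorem tendsto_zero_of_le_const_mul {a b : ℕ → ℝ≥0∞} {c : ℝ≥0∞} (hc : c ≠ ⊤)
    (hb : Tendsto b atTop (𝓝 0)) (h : ∀ i, a i ≤ c * b i) : Tendsto a atTop (𝓝 0) := by
  refine tendsto_of_tendsto_of_tendsto_of_le_of_le tendsto_const_nhds ?_ (fun _ => zero_le) h
  simpa using ENNReal.Tendsto.const_mul hb (Or.inr hc)

variable {X E : Type*} [MeasurableSpace X] [NormedAddCommGroup E] {μ : Measure X}

theorem tendsto_eLpNorm_sub {a b : ℕ → X → E} (ha : ∀ i, AEStronglyMeasurable (a i) μ)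
    (hb : ∀ i, AEStronglyMeasurable (b i) μ)
    (h : Tendsto (fun i => eLpNorm (a i) 2 μ) atTop (𝓝 0))
    (h' : Tendsto (fun i => eLpNorm (b i) 2 μ) atTop (𝓝 0)) :
    Tendsto (fun i => eLpNorm (a i - b i) 2 μ) atTop (𝓝 0) := by
  refine tendsto_of_tendsto_of_tendsto_of_le_of_le tendsto_const_nhds ?_ (fun _ => zero_le)
    fun i => eLpNorm_sub_le (ha i) (hb i) (by norm_num)
  simpa using h.add h'

theorem eLpNorm_le_sub_add {a b : X → E} (ha : AEStronglyMeasurable a μ)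
    (hb : AEStronglyMeasurable b μ) :
    eLpNorm a 2 μ ≤ eLpNorm (a - b) 2 μ + eLpNorm b 2 μ := by
  simpa using eLpNorm_add_le (p := 2) (ha.sub hb) hb (by norm_num)

theorem memLp_restrict_of_continuous [TopologicalSpace X] [OpensMeasurableSpace X]
    [SecondCountableTopology X] [T2Space X] {S : Set X} (hS : IsCompact S)
    (hμ : IsFiniteMeasure (μ.restrict S)) {w : X → E} (hw : Continuous w) :
    MemLp w 2 (μ.restrict S) := by
  obtain ⟨M, hM⟩ := hS.exists_bound_of_continuousOn hw.continuousOn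
  refine MemLp.of_bound hw.aestronglyMeasurable M ?_
  filter_upwards [ae_restrict_mem hS.isClosed.measurableSet] with x hx
  exact hM x hx

end LpBasics

/-! ### Traces on one facet as limits of smooth functions -/

section FacetTrace

variable {n : ℕ} {K : Finset (Pt n)} {z : Pt n}
  {E F : Type*} [NormedAddCommGroup E] [NormedSpace ℝ E] [NormedAddCommGroup F] [NormedSpace ℝ F]
  {L : E →L[ℝ] F} {v w : Pt n → E} {G H : Fin n → Pt n → E} {g g' : Pt n → F}

theorem IsRegularSimplex.isFiniteMeasure_facetMeasure {γ : ℝ} (hK : IsRegularSimplex γ K)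
    (hn : 0 < n) (hz : z ∈ K) : IsFiniteMeasure (facetMeasure K z) := by
  obtain ⟨c, ρ, hρ, hball, -⟩ := hK.ball
  exact TanTrace.isFiniteMeasure_facetMeasure hn hK.card hρ hball hz

theorem memLp_facetMeasure {A : Type*} [NormedAddCommGroup A]
    [IsFiniteMeasure (facetMeasure K z)] {f : Pt n → A}
    (hf : Continuous f) : MemLp f 2 (facetMeasure K z) :=
  memLp_restrict_of_continuous (isCompact_facet z)
    (inferInstanceAs (IsFiniteMeasure (facetMeasure K z))) hf

/-- `g` is the image under `L` of the trace on the facet of `K` opposite to `z` of the function `v`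
with weak gradient `G`. -/
structure HasFacetTrace (K : Finset (Pt n)) (z : Pt n) (L : E →L[ℝ] F) (v : Pt n → E)
    (G : Fin n → Pt n → E) (g : Pt n → F) : Prop where
  hasWeakGrad : HasWeakGrad (cell K) v G
  memLp : MemLp g 2 (facetMeasure K z)
  approx : ∃ φ : ℕ → Pt n → E, (∀ i, ContDiff ℝ ∞ (φ i)) ∧
    Tendsto (fun i => eLpNorm (φ i - v) 2 (volume.restrict (cell K))) atTop (𝓝 0) ∧
    (∀ j, Tendsto (fun i => eLpNorm ((fun x => fderiv ℝ (φ i) x (stdVec j)) - G j) 2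
      (volume.restrict (cell K))) atTop (𝓝 0)) ∧
    Tendsto (fun i => eLpNorm ((fun x => L (φ i x)) - g) 2 (facetMeasure K z)) atTop (𝓝 0)

/-- Linearity is what allows the trace inequality to be applied to `v - vh` minus a polynomial. -/
theorem HasFacetTrace.sub [IsFiniteMeasure (facetMeasure K z)]
    (h : HasFacetTrace K z L v G g) (h' : HasFacetTrace K z L w H g') :
    HasFacetTrace K z L (v - w) (fun j => G j - H j) (g - g') := by
  obtain ⟨hv, hg, φ, hφ, h0, h1, hb⟩ := h
  obtain ⟨hw, hg', ψ, hψ, h0', h1', hb'⟩ := h'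
  have hder : ∀ {f : Pt n → E}, ContDiff ℝ ∞ f → ∀ j,
      Continuous fun x => fderiv ℝ f x (stdVec j) := fun hf j =>
    continuous_fderiv_stdVec (hf.of_le (by simp)) j
  refine ⟨hv.sub isBounded_cell hw, hg.sub hg', fun i => φ i - ψ i, fun i => (hφ i).sub (hψ i),
    ?_, fun j => ?_, ?_⟩
  · refine (tendsto_eLpNorm_sub (fun i => (hφ i).continuous.aestronglyMeasurable.sub hv.memLp.1)
      (fun i => (hψ i).continuous.aestronglyMeasurable.sub hw.memLp.1) h0 h0').congr fun i => ?_
    rw [sub_sub_sub_comm]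
  · refine (tendsto_eLpNorm_sub
      (fun i => (hder (hφ i) j).aestronglyMeasurable.sub (hv.memLp_grad j).1)
      (fun i => (hder (hψ i) j).aestronglyMeasurable.sub (hw.memLp_grad j).1)
      (h1 j) (h1' j)).congr fun i => ?_
    rw [sub_sub_sub_comm]
    congr 2
    ext1 x
    rw [fderiv_sub ((hφ i).differentiable (by simp) x) ((hψ i).differentiable (by simp) x)]
    rfl
  · refine (tendsto_eLpNorm_sub
      (fun i => (L.continuous.comp (hφ i).continuous).aestronglyMeasurable.sub hg.1)
      (fun i => (L.continuous.comp (hψ i).continuous).aestronglyMeasurable.sub hg'.1)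
      hb hb').congr fun i => ?_
    congr 1
    ext1 x
    simp only [Pi.sub_apply, Function.comp_apply, map_sub]
    abel

theorem hasFacetTrace_of_contDiff [IsFiniteMeasure (facetMeasure K z)] {q : Pt n → E}
    (hq : ContDiff ℝ ∞ q) :
    HasFacetTrace K z L q (fun j x => fderiv ℝ q x (stdVec j)) (fun x => L (q x)) := by
  refine ⟨hasWeakGrad_of_contDiff isBounded_cell isOpen_cell.measurableSet
    (hq.of_le (by simp)), memLp_facetMeasure (L.continuous.comp hq.continuous), fun _ => q,
    fun _ => hq, ?_, fun j => ?_, ?_⟩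
  all_goals simp

-- The smooth trace inequality passes to the limit along whichever sequence defines the trace, so it
-- bounds every admissible `g`. Taking `L` to be a contraction keeps the constant independent of the
-- facet.
variable (E) in
theorem exists_hasFacetTrace_le [FiniteDimensional ℝ E] (hn : 0 < n) (γ : ℝ) :
    ∃ C : ℝ, 0 < C ∧ ∀ K : Finset (Pt n), IsRegularSimplex γ K → ∀ z ∈ K,
      ∀ (F : Type) [NormedAddCommGroup F] [NormedSpace ℝ F] (L : E →L[ℝ] F), (∀ x, ‖L x‖ ≤ ‖x‖) →
      ∀ (v : Pt n → E) (G : Fin n → Pt n → E) (g : Pt n → F), HasFacetTrace K z L v G g →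
      ENNReal.ofReal (cellDiam K ^ (1 / 2 : ℝ)) * eLpNorm g 2 (facetMeasure K z) ≤
        ENNReal.ofReal C * (eLpNorm v 2 (volume.restrict (cell K)) +
          ENNReal.ofReal (cellDiam K) * ∑ j, eLpNorm (G j) 2 (volume.restrict (cell K))) := by
  obtain ⟨C, hC, hle⟩ := exists_smooth_facet_le (n := n) (E := E) hn γ
  refine ⟨C, hC, fun K hK z hz F _ _ L hL v G g h => ?_⟩
  obtain ⟨hv, hg, φ, hφ, h0, h1, hb⟩ := h
  set μ := (volume : Measure (Pt n)).restrict (cell K)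
  set s := ENNReal.ofReal (cellDiam K ^ (1 / 2 : ℝ))
  set h := ENNReal.ofReal (cellDiam K)
  have key : ∀ i, s * eLpNorm g 2 (facetMeasure K z) ≤
      s * eLpNorm ((fun x => L (φ i x)) - g) 2 (facetMeasure K z) +
      ENNReal.ofReal C * ((eLpNorm (φ i - v) 2 μ + eLpNorm v 2 μ) +
        h * ∑ j, (eLpNorm ((fun x => fderiv ℝ (φ i) x (stdVec j)) - G j) 2 μ +
          eLpNorm (G j) 2 μ)) := by
    intro i
    have e1 : eLpNorm g 2 (facetMeasure K z) ≤
        eLpNorm ((fun x => L (φ i x)) - g) 2 (facetMeasure K z) +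
          eLpNorm (φ i) 2 (facetMeasure K z) := by
      refine (eLpNorm_le_sub_add hg.1
        (L.continuous.comp (hφ i).continuous).aestronglyMeasurable).trans ?_
      rw [eLpNorm_sub_comm]
      exact add_le_add le_rfl (eLpNorm_mono fun x => hL _)
    refine (mul_le_mul_right e1 s).trans ?_
    rw [mul_add]
    refine add_le_add le_rfl ((hle K hK z hz (φ i) ((hφ i).of_le (by simp))).trans ?_)
    refine mul_le_mul_right (add_le_add
      (eLpNorm_le_sub_add (hφ i).continuous.aestronglyMeasurable hv.memLp.1)
      (mul_le_mul_right (Finset.sum_le_sum fun j _ => eLpNorm_le_sub_add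
        (continuous_fderiv_stdVec ((hφ i).of_le (by simp)) j).aestronglyMeasurable
        (hv.memLp_grad j).1) _)) _
  refine ge_of_tendsto' (x := atTop) ?_ key
  have t1 := ENNReal.Tendsto.const_mul (a := s) hb (Or.inr ENNReal.ofReal_ne_top)
  have t2 := tendsto_finsetSum Finset.univ fun j _ => (h1 j).add_const (eLpNorm (G j) 2 μ)
  have t3 := ENNReal.Tendsto.const_mul (a := h) t2 (Or.inr ENNReal.ofReal_ne_top)
  have t4 := ENNReal.Tendsto.const_mul (a := ENNReal.ofReal C)
    ((h0.add_const (eLpNorm v 2 μ)).add t3) (Or.inr ENNReal.ofReal_ne_top)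
  simpa using t1.add t4

end FacetTrace

/-! ### Tangential traces as facet traces -/

section TanTraces

variable {n k : ℕ} {K : Finset (Pt n)} {z : Pt n}

/-- Restriction of alternating forms to the vectors tangent to a facet. -/
def restrictFacet {n : ℕ} (K : Finset (Pt n)) (z : Pt n) (k : ℕ) :
    Alt (Pt n) k →L[ℝ] Alt (facetDir K z) k :=
  ContinuousAlternatingMap.compContinuousLinearMapCLM (facetDir K z).subtypeL

theorem norm_restrictFacet_le (α : Alt (Pt n) k) : ‖restrictFacet K z k α‖ ≤ ‖α‖ :=
  norm_restrict_le _ α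

theorem IsTanTrace.hasFacetTrace {v : Form n k} {G : Fin n → Form n k} {g : BdryForm K k}
    (h : IsTanTrace K v g) (hG : HasWeakGrad (cell K) v G) (hz : z ∈ K) :
    HasFacetTrace K z (restrictFacet K z k) v G (g z) := by
  obtain ⟨hg, φ, hφ, h0, h1, hb⟩ := h
  obtain ⟨c, -, hc⟩ := exists_eLpNorm_le_l2Norm (Pt n) k
  obtain ⟨c', -, hc'⟩ := exists_eLpNorm_le_l2Norm (facetDir K z) k
  refine ⟨hG, hg z hz, φ, hφ,
    tendsto_zero_of_le_const_mul ENNReal.ofReal_ne_top h0 fun i => hc _ _, fun j => ?_,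
    tendsto_zero_of_le_const_mul (c := ENNReal.ofReal c') ENNReal.ofReal_ne_top hb
      fun i => (hc' _ _).trans ?_⟩
  · refine tendsto_zero_of_le_const_mul (c := ENNReal.ofReal c) ENNReal.ofReal_ne_top h1
      fun i => (hc _ _).trans ?_
    refine mul_le_mul_right ?_ _
    exact ((hasWeakGrad_of_contDiff isBounded_cell isOpen_cell.measurableSet
      ((hφ i).of_le (by simp))).sub isBounded_cell hG).l2Norm_le_sobolevSeminorm isOpen_cell
        isBounded_cell j
  · refine mul_le_mul_right ?_ _
    exact le_rpow_half_sum_sq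
      (fun z => l2Norm (facetMeasure K z) ((pullbackBdry K (φ i) - g) z)) hz

end TanTraces

/-! ### Existence of tangential traces -/

section Existence

theorem exists_tendsto_eLpNorm {X F : Type*} [MeasurableSpace X] [NormedAddCommGroup F]
    [CompleteSpace F] {μ : Measure X} {f : ℕ → X → F} (hf : ∀ i, MemLp (f i) 2 μ)
    {b : ℕ → ℝ≥0∞} (hb : Tendsto b atTop (𝓝 0))
    (h : ∀ i j, eLpNorm (f i - f j) 2 μ ≤ b i + b j) :
    ∃ g, MemLp g 2 μ ∧ Tendsto (fun i => eLpNorm (f i - g) 2 μ) atTop (𝓝 0) := by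
  have : Fact ((1 : ℝ≥0∞) ≤ 2) := ⟨by norm_num⟩
  have hc : CauchySeq fun i => (hf i).toLp (f i) := by
    refine EMetric.cauchySeq_iff.2 fun ε hε => ?_
    obtain ⟨N, hN⟩ := eventually_atTop.1 (hb.eventually_lt_const (ENNReal.half_pos hε.ne'))
    refine ⟨N, fun i hi j hj => ?_⟩
    rw [Lp.edist_toLp_toLp]
    calc _ ≤ b i + b j := h i j
      _ < ε / 2 + ε / 2 := ENNReal.add_lt_add (hN i hi) (hN j hj)
      _ = ε := ENNReal.add_halves ε
  obtain ⟨g, hg⟩ := cauchySeq_tendsto_of_complete hc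
  refine ⟨g, Lp.memLp g, ?_⟩
  rw [tendsto_iff_edist_tendsto_0] at hg
  refine hg.congr fun i => ?_
  rw [Lp.edist_def]
  exact eLpNorm_congr_ae ((hf i).coeFn_toLp.sub EventuallyEq.rfl)

variable {n : ℕ} {K : Finset (Pt n)} {z : Pt n} {γ : ℝ}

/-- The smooth trace inequality applied to `φ i - φ i'` makes the boundary values Cauchy in `L²` of
the facet. Dividing by `h_K^{1/2}` is harmless since the simplex is fixed. -/
theorem exists_tendsto_facet {E F : Type*} [NormedAddCommGroup E] [NormedSpace ℝ E]
    [FiniteDimensional ℝ E] [NormedAddCommGroup F] [NormedSpace ℝ F] [CompleteSpace F]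
    (hn : 0 < n) (hK : IsRegularSimplex γ K) (hz : z ∈ K) (L : E →L[ℝ] F)
    (hL : ∀ x, ‖L x‖ ≤ ‖x‖) {v : Pt n → E} {G : Fin n → Pt n → E}
    (hv : HasWeakGrad (cell K) v G) {φ : ℕ → Pt n → E} (hφ : ∀ i, ContDiff ℝ ∞ (φ i))
    (h0 : Tendsto (fun i => eLpNorm (φ i - v) 2 (volume.restrict (cell K))) atTop (𝓝 0))
    (h1 : ∀ j, Tendsto (fun i => eLpNorm ((fun x => fderiv ℝ (φ i) x (stdVec j)) - G j) 2
      (volume.restrict (cell K))) atTop (𝓝 0)) :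
    ∃ g, MemLp g 2 (facetMeasure K z) ∧
      Tendsto (fun i => eLpNorm ((fun x => L (φ i x)) - g) 2 (facetMeasure K z)) atTop (𝓝 0) := by
  obtain ⟨C, -, hle⟩ := exists_smooth_facet_le (n := n) (E := E) hn γ
  have := hK.isFiniteMeasure_facetMeasure hn hz
  have hs0 : ENNReal.ofReal (cellDiam K ^ (1 / 2 : ℝ)) ≠ 0 := by
    have := hK.cellDiam_pos hn
    simp only [ne_eq, ENNReal.ofReal_eq_zero, not_le]
    positivity
  have hsfin : ENNReal.ofReal (cellDiam K ^ (1 / 2 : ℝ)) ≠ ⊤ := ENNReal.ofReal_ne_top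
  set s := ENNReal.ofReal (cellDiam K ^ (1 / 2 : ℝ))
  set h := ENNReal.ofReal (cellDiam K) with hh
  set μ := (volume : Measure (Pt n)).restrict (cell K) with hμ
  have hder : ∀ i j, Continuous fun x => fderiv ℝ (φ i) x (stdVec j) := fun i j =>
    continuous_fderiv_stdVec ((hφ i).of_le (by simp)) j
  refine exists_tendsto_eLpNorm
    (fun i => memLp_facetMeasure (L.continuous.comp (hφ i).continuous))
    (b := fun i => s⁻¹ * (ENNReal.ofReal C * (eLpNorm (φ i - v) 2 μ +
      h * ∑ j, eLpNorm ((fun x => fderiv ℝ (φ i) x (stdVec j)) - G j) 2 μ))) ?_ fun i i' => ?_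
  · have t2 := tendsto_finsetSum Finset.univ fun j _ => h1 j
    have t3 := ENNReal.Tendsto.const_mul (a := h) t2 (Or.inr ENNReal.ofReal_ne_top)
    have t4 := ENNReal.Tendsto.const_mul (a := ENNReal.ofReal C) (h0.add t3)
      (Or.inr ENNReal.ofReal_ne_top)
    have t5 := ENNReal.Tendsto.const_mul (a := s⁻¹) t4 (Or.inr (ENNReal.inv_ne_top.2 hs0))
    simpa using t5
  · have e1 : eLpNorm ((L ∘ φ i) - (L ∘ φ i')) 2 (facetMeasure K z) ≤
        eLpNorm (φ i - φ i') 2 (facetMeasure K z) := by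
      refine eLpNorm_mono fun x => ?_
      simpa using hL (φ i x - φ i' x)
    have e2 := hle K hK z hz (φ i - φ i') (((hφ i).sub (hφ i')).of_le (by simp))
    have e3 : ∀ {a b c : Pt n → E}, AEStronglyMeasurable a μ → AEStronglyMeasurable b μ →
        AEStronglyMeasurable c μ →
        eLpNorm (a - b) 2 μ ≤ eLpNorm (a - c) 2 μ + eLpNorm (b - c) 2 μ := by
      intro a b c ha hb hc
      simpa using eLpNorm_sub_le (p := 2) (ha.sub hc) (hb.sub hc) (by norm_num)
    have e4 : ∀ j, eLpNorm (fun x => fderiv ℝ (φ i - φ i') x (stdVec j)) 2 μ ≤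
        eLpNorm ((fun x => fderiv ℝ (φ i) x (stdVec j)) - G j) 2 μ +
        eLpNorm ((fun x => fderiv ℝ (φ i') x (stdVec j)) - G j) 2 μ := by
      intro j
      refine le_trans (le_of_eq ?_) (e3 (hder i j).aestronglyMeasurable
        (hder i' j).aestronglyMeasurable (hv.memLp_grad j).1)
      congr 1
      ext1 x
      rw [fderiv_sub ((hφ i).differentiable (by simp) x) ((hφ i').differentiable (by simp) x)]
      rfl
    have e5 := e2.trans (mul_le_mul_right (add_le_add
      (e3 (hφ i).continuous.aestronglyMeasurable (hφ i').continuous.aestronglyMeasurable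
        hv.memLp.1) (mul_le_mul_right (Finset.sum_le_sum fun j _ => e4 j) h)) (ENNReal.ofReal C))
    rw [← mul_add, ← mul_add, ← hμ] at *
    refine e1.trans ?_
    rw [← ENNReal.mul_le_iff_le_inv hs0 hsfin]
    refine e5.trans (le_of_eq ?_)
    rw [Finset.sum_add_distrib]
    ring

theorem HasWeakGrad.exists_isTanTrace {k : ℕ} {v : Form n k} {G : Fin n → Form n k}
    (hv : HasWeakGrad (cell K) v G) (hn : 0 < n) (hK : IsRegularSimplex γ K) :
    ∃ g : BdryForm K k, IsTanTrace K v g := by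
  classical
  have hne : (cell K).Nonempty := by
    obtain ⟨c, ρ, hρ, hball, -⟩ := hK.ball
    exact ⟨c, ball_subset_cell hball (Metric.mem_ball_self hρ)⟩
  obtain ⟨φ, hφ, h0, h1⟩ :=
    hv.exists_smooth_approx isOpen_cell convex_cell isBounded_cell hne
  have hex : ∀ z, ∃ g : Pt n → Alt (facetDir K z) k, z ∈ K → MemLp g 2 (facetMeasure K z) ∧
      Tendsto (fun i => eLpNorm (pullbackBdry K (φ i) z - g) 2 (facetMeasure K z))
        atTop (𝓝 0) := by
    intro z
    by_cases hz : z ∈ K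
    · obtain ⟨g, hg⟩ := exists_tendsto_facet (F := Alt (facetDir K z) k) hn hK hz (restrictFacet K z k)
        norm_restrictFacet_le hv hφ h0 h1
      exact ⟨g, fun _ => hg⟩
    · exact ⟨0, fun h => absurd h hz⟩
  choose g hg using hex
  have hl2 : ∀ w : Form n k, l2Norm (volume.restrict (cell K)) w ≤
      ENNReal.ofReal (n ^ k : ℕ) * eLpNorm w 2 (volume.restrict (cell K)) := fun w =>
    l2Norm_le_eLpNorm _ w (by simp)
  refine ⟨g, fun z hz => (hg z hz).1, φ, hφ,
    tendsto_zero_of_le_const_mul (c := ENNReal.ofReal (n ^ k : ℕ)) ENNReal.ofReal_ne_top h0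
      fun i => hl2 _, ?_, ?_⟩
  · have t := tendsto_finsetSum (Finset.univ : Finset (Fin 1 → Fin n)) fun α _ => h1 (α 0)
    simp only [Finset.sum_const_zero] at t
    refine tendsto_zero_of_le_const_mul (c := ENNReal.ofReal (n ^ k : ℕ)) ENNReal.ofReal_ne_top t
      fun i => ?_
    refine ((hasWeakGrad_of_contDiff isBounded_cell isOpen_cell.measurableSet
      ((hφ i).of_le (by simp))).sub isBounded_cell hv).sobolevSeminorm_one_le.trans ?_
    rw [Finset.mul_sum]
    exact Finset.sum_le_sum fun α _ => hl2 _
  · have t := tendsto_finsetSum K fun z hz => (hg z hz).2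
    simp only [Finset.sum_const_zero] at t
    refine tendsto_zero_of_le_const_mul (c := ENNReal.ofReal (n ^ k : ℕ)) ENNReal.ofReal_ne_top t
      fun i => ?_
    refine (rpow_half_sum_sq_le _ _).trans ?_
    rw [Finset.mul_sum]
    refine Finset.sum_le_sum fun z _ => l2Norm_le_eLpNorm _ _ ?_
    simpa using (facetDir K z).finrank_le

end Existence

/-! ### The local estimate -/

section LocalEstimate

variable {n : ℕ}

/-- The splitting at the heart of the proof. On `K`, `v - vh - (q - qh)` equals `v - q` almost
everywhere and falls under the trace inequality; the polynomial `q - qh` falls under the inverse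
inequality, and its norm on `K` is bounded by those of `v - vh` and `v - q`. -/
theorem exists_facet_error_le (E : Type*) [NormedAddCommGroup E] [NormedSpace ℝ E]
    [FiniteDimensional ℝ E] (hn : 0 < n) (γ : ℝ) (R : ℕ) :
    ∃ C : ℝ, 0 < C ∧ ∀ K : Finset (Pt n), IsRegularSimplex γ K → ∀ z ∈ K,
      ∀ (F : Type) [NormedAddCommGroup F] [NormedSpace ℝ F] (L : E →L[ℝ] F), (∀ x, ‖L x‖ ≤ ‖x‖) →
      ∀ (v vh : Pt n → E) (G H : Fin n → Pt n → E) (g gh : Pt n → F),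
        HasFacetTrace K z L v G g → HasFacetTrace K z L vh H gh →
      ∀ qh ∈ polySpan n R E, vh =ᵐ[volume.restrict (cell K)] qh →
      ∀ q ∈ polySpan n R E, ∀ G', HasWeakGrad (cell K) (v - q) G' →
      ENNReal.ofReal (cellDiam K ^ (1 / 2 : ℝ)) * eLpNorm (g - gh) 2 (facetMeasure K z) ≤
        ENNReal.ofReal C * (eLpNorm (v - vh) 2 (volume.restrict (cell K)) +
          (eLpNorm (v - q) 2 (volume.restrict (cell K)) +
            ENNReal.ofReal (cellDiam K) *
              ∑ j, eLpNorm (G' j) 2 (volume.restrict (cell K)))) := by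
  obtain ⟨C₁, hC₁, h₁⟩ := exists_hasFacetTrace_le (n := n) E hn γ
  obtain ⟨C₂, hC₂, h₂⟩ := exists_poly_facet_le (n := n) (E := E) hn R γ
  refine ⟨C₁ + C₂, by positivity,
    fun K hK z hz F _ _ L hL v vh G H g gh hv hvh qh hqh hae q hq G' hG' => ?_⟩
  have := hK.isFiniteMeasure_facetMeasure hn hz
  have hp := (polySpan n R E).sub_mem hq hqh
  have hps := contDiff_of_mem_polySpan hp
  have ht := (hv.sub hvh).sub (hasFacetTrace_of_contDiff (L := L) hps)
  have hvq : v - vh - (q - qh) =ᵐ[volume.restrict (cell K)] v - q := by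
    filter_upwards [hae] with x hx
    simp only [Pi.sub_apply, hx]
    abel
  have hgrad := fun j => (ht.hasWeakGrad.congr hvq fun _ => EventuallyEq.rfl).unique isOpen_cell
    isBounded_cell hG' j
  have b₁ := h₁ K hK z hz F L hL _ _ _ ht
  rw [eLpNorm_congr_ae hvq, Finset.sum_congr rfl fun j _ => eLpNorm_congr_ae (hgrad j)] at b₁
  have b₂ := h₂ K hK z hz _ hp
  have hpn : eLpNorm (q - qh) 2 (volume.restrict (cell K)) ≤
      eLpNorm (v - vh) 2 (volume.restrict (cell K)) +
        eLpNorm (v - q) 2 (volume.restrict (cell K)) := by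
    rw [← eLpNorm_congr_ae hvq]
    refine le_trans (le_of_eq ?_) (eLpNorm_sub_le (p := 2)
      (hv.hasWeakGrad.memLp.sub hvh.hasWeakGrad.memLp).1 ht.hasWeakGrad.memLp.1 (by norm_num))
    rw [sub_sub_cancel]
  have hg : eLpNorm (g - gh) 2 (facetMeasure K z) ≤
      eLpNorm (g - gh - fun x => L ((q - qh) x)) 2 (facetMeasure K z) +
        eLpNorm (q - qh) 2 (facetMeasure K z) :=
    (eLpNorm_le_sub_add (hv.memLp.sub hvh.memLp).1
      (L.continuous.comp hps.continuous).aestronglyMeasurable).trans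
      (add_le_add le_rfl (eLpNorm_mono fun x => hL _))
  refine (mul_le_mul_right hg _).trans ?_
  rw [mul_add, ENNReal.ofReal_add hC₁.le hC₂.le, add_mul]
  refine add_le_add (b₁.trans (mul_le_mul_right le_add_self _))
    (b₂.trans (mul_le_mul_right (hpn.trans (add_le_add le_rfl le_self_add)) _))

/-- The local estimate of the tangential traces on the boundary of a shape-regular simplex. -/
theorem exists_scaledBdryNorm_le (k : ℕ) (hn : 0 < n) (γ : ℝ) (R : ℕ) {t : ℝ} (ht : 1 ≤ t) :
    ∃ C : ℝ, 0 < C ∧ ∀ K : Finset (Pt n), IsRegularSimplex γ K → ∀ v vh : Form n k,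
      ∀ qh ∈ polySpan n R (Alt (Pt n) k), vh =ᵐ[volume.restrict (cell K)] qh →
      ∀ g gh : BdryForm K k, IsTanTrace K v g → IsTanTrace K vh gh →
      scaledBdryNorm K (g - gh) ≤ ENNReal.ofReal C *
        (l2Norm (volume.restrict (cell K)) (v - vh) +
          ENNReal.ofReal (cellDiam K ^ t) * sobolevSeminorm (cell K) t v) := by
  set m := ⌊t⌋₊ with hm
  have hm1 : 1 ≤ m := Nat.one_le_floor_iff _ |>.2 ht
  have hθ : 0 ≤ t - m := sub_nonneg.2 (Nat.floor_le (zero_le_one.trans ht))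
  obtain ⟨c, hc, hcl⟩ := exists_eLpNorm_le_l2Norm (Pt n) k
  obtain ⟨C₁, hC₁, h₁⟩ := exists_poly_approx n k hn γ m hm1 (t - m) hθ
  -- The degree covers both the discrete form (`R`) and the Bramble–Hilbert polynomial (`m + 1`).
  obtain ⟨C₀, hC₀, h₀⟩ := exists_facet_error_le (n := n) (Alt (Pt n) k) hn γ (max R (m + 1))
  -- Here `n + 1` counts the facets, and `n ^ k` and `c` convert between the two norms on forms.
  refine ⟨(n + 1) * (n ^ k * (C₀ * (c + C₁))), by positivity,
    fun K hK v vh qh hqh hae g gh hg hgh => ?_⟩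
  have hh := hK.cellDiam_pos hn
  have key : ∀ D, IsWeakJet (cell K) m v D → scaledBdryNorm K (g - gh) ≤
      ENNReal.ofReal ((n + 1) * (n ^ k * (C₀ * (c + C₁)))) *
        (l2Norm (volume.restrict (cell K)) (v - vh) + ENNReal.ofReal (cellDiam K ^ t) *
          (∑ α : Fin m → Fin n, slobodeckijSq (cell K) (t - m) (D m α)) ^ (1 / 2 : ℝ)) := by
    intro D hD
    obtain ⟨q, hq, G', hG', hle⟩ := h₁ K hK v D hD
    set Q := (∑ α : Fin m → Fin n, slobodeckijSq (cell K) (t - m) (D m α)) ^ (1 / 2 : ℝ)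
    have hqh' := (hasWeakGrad_of_contDiff (U := cell K) isBounded_cell isOpen_cell.measurableSet
      ((contDiff_of_mem_polySpan hqh).of_le (by simp))).congr hae.symm fun _ => EventuallyEq.rfl
    have hz : ∀ z ∈ K, ENNReal.ofReal (cellDiam K ^ (1 / 2 : ℝ)) *
        l2Norm (facetMeasure K z) ((g - gh) z) ≤ ENNReal.ofReal (n ^ k * (C₀ * (c + C₁))) *
          (l2Norm (volume.restrict (cell K)) (v - vh) + ENNReal.ofReal (cellDiam K ^ t) * Q) := by
      intro z hz
      have e1 := h₀ K hK z hz (Alt (facetDir K z) k) (restrictFacet K z k) norm_restrictFacet_le v vh _ _ _ _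
        (hg.hasFacetTrace (hD.hasWeakGrad_one hm1 isOpen_cell isBounded_cell) hz)
        (hgh.hasFacetTrace hqh' hz) qh (polySpan_mono (le_max_left _ _) hqh) hae q
        (polySpan_mono (le_max_right _ _) hq) G' hG'
      have e2 : l2Norm (facetMeasure K z) ((g - gh) z) ≤
          ENNReal.ofReal (n ^ k : ℕ) * eLpNorm (g z - gh z) 2 (facetMeasure K z) :=
        l2Norm_le_eLpNorm _ _ (by simpa using (facetDir K z).finrank_le)
      rw [add_sub_cancel] at hle
      calc _ ≤ ENNReal.ofReal (cellDiam K ^ (1 / 2 : ℝ)) *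
            (ENNReal.ofReal (n ^ k : ℕ) * eLpNorm (g z - gh z) 2 (facetMeasure K z)) :=
            mul_le_mul_right e2 _
        _ = ENNReal.ofReal (n ^ k : ℕ) * (ENNReal.ofReal (cellDiam K ^ (1 / 2 : ℝ)) *
            eLpNorm (g z - gh z) 2 (facetMeasure K z)) := by ring
        _ ≤ ENNReal.ofReal (n ^ k : ℕ) * (ENNReal.ofReal C₀ *
            (ENNReal.ofReal c * l2Norm (volume.restrict (cell K)) (v - vh) +
              ENNReal.ofReal (C₁ * cellDiam K ^ t) * Q)) :=
            mul_le_mul_right (e1.trans (mul_le_mul_right (add_le_add (hcl _ _) hle) _)) _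
        _ ≤ ENNReal.ofReal (n ^ k : ℕ) * (ENNReal.ofReal C₀ *
            (ENNReal.ofReal (c + C₁) * l2Norm (volume.restrict (cell K)) (v - vh) +
              ENNReal.ofReal (c + C₁) * (ENNReal.ofReal (cellDiam K ^ t) * Q))) := by
            rw [ENNReal.ofReal_mul hC₁.le, mul_assoc (ENNReal.ofReal C₁)]
            refine mul_le_mul_right (mul_le_mul_right (add_le_add
              (mul_le_mul_left (ENNReal.ofReal_le_ofReal (by linarith)) _)
              (mul_le_mul_left (ENNReal.ofReal_le_ofReal (by linarith)) _)) _) _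
        _ = _ := by
            rw [ENNReal.ofReal_mul (by positivity), ENNReal.ofReal_mul hC₀.le]
            push_cast
            ring
    calc scaledBdryNorm K (g - gh) ≤ ∑ z ∈ K, ENNReal.ofReal (cellDiam K ^ (1 / 2 : ℝ)) *
          l2Norm (facetMeasure K z) ((g - gh) z) := by
          rw [← Finset.mul_sum]
          exact mul_le_mul_right (rpow_half_sum_sq_le _ _) _
      _ ≤ _ := Finset.sum_le_sum hz
      _ = _ := by
          rw [Finset.sum_const, hK.card, nsmul_eq_mul, ENNReal.ofReal_mul (p := (n : ℝ) + 1)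
            (by positivity), mul_assoc]
          congr 1
          rw [← Nat.cast_succ, ENNReal.ofReal_natCast]
  -- The bound holds for each jet. To take the infimum over jets inside, the factors must be finite
  -- and nonzero, as the infimum may be `∞`.
  have hC : ENNReal.ofReal ((n + 1) * (n ^ k * (C₀ * (c + C₁)))) ≠ 0 := by
    simp only [ne_eq, ENNReal.ofReal_eq_zero, not_le]
    positivity
  have hht : ENNReal.ofReal (cellDiam K ^ t) ≠ 0 := by
    simp only [ne_eq, ENNReal.ofReal_eq_zero, not_le]
    positivity
  unfold sobolevSeminorm
  simp only [ENNReal.mul_iInf_of_ne hC ENNReal.ofReal_ne_top,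
    ENNReal.mul_iInf_of_ne hht ENNReal.ofReal_ne_top, ENNReal.add_iInf]
  exact le_iInf₂ key

end LocalEstimate

/-! ### Summation over the mesh -/

section Global

variable {n k : ℕ} {Ω U : Set (Pt n)} {T : Finset (Finset (Pt n))}

/-- Test functions supported in `U` vanish with their derivatives outside it, so integrals over `U`
and `Ω` agree. -/
theorem IsWeakJet.mono {m : ℕ} {v : Form n k} {D : (i : ℕ) → (Fin i → Fin n) → Form n k}
    (h : IsWeakJet Ω m v D) (hΩ : MeasurableSet Ω) (hU : U ⊆ Ω) : IsWeakJet U m v D := by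
  have hμ : (volume : Measure (Pt n)).restrict U ≤ volume.restrict Ω :=
    Measure.restrict_mono_set _ hU
  refine ⟨h.memL2.mono_measure hμ, fun i hi α => (h.memL2_deriv i hi α).mono_measure hμ,
    fun i hi α φ hφ hc hs => ?_⟩
  have h0 : ∀ x ∉ U, φ x = 0 := fun x hx => image_eq_zero_of_notMem_tsupport fun h => hx (hs h)
  have h1 : ∀ x ∉ U, iteratedFDeriv ℝ i φ x = 0 := fun x hx =>
    image_eq_zero_of_notMem_tsupport fun h => hx (hs (tsupport_iteratedFDeriv_subset i h))
  rw [← setIntegral_eq_of_subset_of_forall_sdiff_eq_zero hΩ hU,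
    ← setIntegral_eq_of_subset_of_forall_sdiff_eq_zero hΩ hU]
  · exact h.eq i hi α φ hφ hc (hs.trans hU)
  · intro x hx
    rw [h0 x hx.2]
    ext
    simp
  · intro x hx
    rw [h1 x hx.2]
    ext
    simp

theorem sum_setLIntegral_le {s : Finset (Finset (Pt n))} (hsub : ∀ K ∈ s, cell K ⊆ Ω)
    (hd : (s : Set (Finset (Pt n))).PairwiseDisjoint cell) (f : Pt n → ℝ≥0∞) :
    ∑ K ∈ s, ∫⁻ x in cell K, f x ≤ ∫⁻ x in Ω, f x := by
  rw [← lintegral_biUnion_finset hd fun K _ => isOpen_cell.measurableSet]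
  exact lintegral_mono_set (iUnion₂_subset hsub)

theorem sum_l2Norm_sq_le (hsub : ∀ K ∈ T, cell K ⊆ Ω)
    (hd : (T : Set (Finset (Pt n))).PairwiseDisjoint cell) (v : Form n k) :
    ∑ K ∈ T, l2Norm (volume.restrict (cell K)) v ^ 2 ≤ l2Norm (volume.restrict Ω) v ^ 2 := by
  simp only [l2Norm, rpow_half_sq]
  exact sum_setLIntegral_le hsub hd _

/-- The squares `K × K` are disjoint subsets of `Ω × Ω`; interactions between different cells are
discarded. -/
theorem sum_slobodeckijSq_le (hsub : ∀ K ∈ T, cell K ⊆ Ω)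
    (hd : (T : Set (Finset (Pt n))).PairwiseDisjoint cell) (θ : ℝ) (v : Form n k) :
    ∑ K ∈ T, slobodeckijSq (cell K) θ v ≤ slobodeckijSq Ω θ v := by
  unfold slobodeckijSq
  split_ifs
  · exact sum_l2Norm_sq_le hsub hd v
  · refine le_trans (Finset.sum_le_sum fun K hK => ?_) (sum_setLIntegral_le hsub hd _)
    exact lintegral_mono fun x => lintegral_mono_set (hsub K hK)

/-- Each jet on `Ω` restricts to a competitor on every cell, and the squared seminorms of its top
derivatives are superadditive over the cells. -/
theorem sum_sobolevSeminorm_sq_le (hΩ : MeasurableSet Ω) (hsub : ∀ K ∈ T, cell K ⊆ Ω)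
    (hd : (T : Set (Finset (Pt n))).PairwiseDisjoint cell) (t : ℝ) (v : Form n k) :
    ∑ K ∈ T, sobolevSeminorm (cell K) t v ^ 2 ≤ sobolevSeminorm Ω t v ^ 2 := by
  refine rpow_half_le_iff.1 (le_iInf₂ fun D hD => ?_)
  refine ENNReal.rpow_le_rpow ?_ (by norm_num)
  calc _ ≤ ∑ K ∈ T, ∑ α : Fin ⌊t⌋₊ → Fin n, slobodeckijSq (cell K) (t - ⌊t⌋₊) (D ⌊t⌋₊ α) := by
        refine Finset.sum_le_sum fun K hK => ?_
        rw [← rpow_half_sq (∑ α : Fin ⌊t⌋₊ → Fin n, _)]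
        exact pow_le_pow_left' (iInf₂_le D (hD.mono hΩ (hsub K hK))) 2
    _ ≤ _ := by
        rw [Finset.sum_comm]
        exact Finset.sum_le_sum fun α _ => sum_slobodeckijSq_le hsub hd _ _

theorem IsMesh.pairwiseDisjoint_cell (hT : IsMesh Ω T) (hn : 0 < n) :
    (T : Set (Finset (Pt n))).PairwiseDisjoint cell := fun K hK L hL hKL =>
  disjoint_cell hn (hT.card K hK) (hT.card L hL) hKL (hT.conforming K hK L hL)

theorem IsMesh.isRegularSimplex {γ : ℝ} (hT : IsMesh Ω T) (hγ : IsShapeRegular γ T)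
    {K : Finset (Pt n)} (hK : K ∈ T) : IsRegularSimplex γ K :=
  ⟨hT.card K hK, hγ K hK⟩

theorem cellDiam_le_meshSize {K : Finset (Pt n)} (hK : K ∈ T) : cellDiam K ≤ meshSize T :=
  le_csSup (T.finite_toSet.image _).bddAbove (mem_image_of_mem _ hK)

theorem TraceEstimate.mono {C C' t : ℝ} {v vh : Form n k} (h : TraceEstimate Ω T C t v vh)
    (hC : C ≤ C') : TraceEstimate Ω T C' t v vh :=
  ⟨h.1, h.2, fun K hK g gh hg hgh => (h.3 K hK g gh hg hgh).trans
    (mul_le_mul_left (ENNReal.ofReal_le_ofReal hC) _),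
    fun g gh hg hgh => (h.4 g gh hg hgh).trans
    (mul_le_mul_left (ENNReal.ofReal_le_ofReal hC) _)⟩

/-- The trace estimates for any form that is in `H¹` on each simplex and any finite element form
with polynomial coefficients of bounded degree. -/
theorem exists_traceEstimate (n k : ℕ) (hn : 0 < n) (γ : ℝ) (R : ℕ) {t : ℝ} (ht : 1 ≤ t) :
    ∃ C : ℝ, 0 < C ∧ ∀ (Ω : Set (Pt n)) (T : Finset (Finset (Pt n))), IsOpen Ω → IsMesh Ω T →
      IsShapeRegular γ T → ∀ W : Set (Form n k), W ⊆ polySpan n R (Alt (Pt n) k) →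
      ∀ v : Form n k, (∀ K ∈ T, MemSobolev (cell K) 1 v) → ∀ vh ∈ feSpace Ω T W,
        TraceEstimate Ω T C t v vh := by
  obtain ⟨C, hC, hloc⟩ := exists_scaledBdryNorm_le k hn γ R ht
  -- Squaring the local bound costs `(a + b)² ≤ 2 (a² + b²)`, and returning from `a² + b²` to `(a +
  -- b)²` costs nothing; `2 ≤ 2²` gives the clean factor 2.
  refine ⟨2 * C, by positivity, fun Ω T hΩ hT hγ W hW v hv vh hvh => ?_⟩
  have hle : ∀ K ∈ T, ∀ g gh : BdryForm K k, IsTanTrace K v g → IsTanTrace K vh gh →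
      scaledBdryNorm K (g - gh) ≤ ENNReal.ofReal C *
        (l2Norm (volume.restrict (cell K)) (v - vh) +
          ENNReal.ofReal (cellDiam K ^ t) * sobolevSeminorm (cell K) t v) := by
    intro K hK g gh hg hgh
    obtain ⟨qh, hqh, hae⟩ := hvh.2 K hK
    exact hloc K (hT.isRegularSimplex hγ hK) v vh qh (hW hqh) hae g gh hg hgh
  refine ⟨fun K hK => ?_, fun K hK => ?_, fun K hK g gh hg hgh => ?_, fun g gh hg hgh => ?_⟩
  · obtain ⟨G, hG⟩ := (hv K hK).exists_hasWeakGrad isOpen_cell isBounded_cell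
    exact hG.exists_isTanTrace hn (hT.isRegularSimplex hγ hK)
  · obtain ⟨qh, hqh, hae⟩ := hvh.2 K hK
    exact ((hasWeakGrad_of_contDiff (U := cell K) isBounded_cell isOpen_cell.measurableSet
      ((contDiff_of_mem_polySpan (hW hqh)).of_le (by simp))).congr hae.symm
        fun _ => EventuallyEq.rfl).exists_isTanTrace hn (hT.isRegularSimplex hγ hK)
  · exact (hle K hK g gh hg hgh).trans
      (mul_le_mul_left (ENNReal.ofReal_le_ofReal (by linarith)) _)
  · set a := ENNReal.ofReal (meshSize T ^ t)
    set A := l2Norm (volume.restrict Ω) (v - vh)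
    set S := sobolevSeminorm Ω t v
    have hd := hT.pairwiseDisjoint_cell hn
    have h1 : ∀ K ∈ T, scaledBdryNorm K (g K - gh K) ^ 2 ≤ ENNReal.ofReal C ^ 2 *
        (2 * (l2Norm (volume.restrict (cell K)) (v - vh) ^ 2 +
          a ^ 2 * sobolevSeminorm (cell K) t v ^ 2)) := by
      intro K hK
      refine (pow_le_pow_left' (hle K hK _ _ (hg K hK) (hgh K hK)) 2).trans ?_
      rw [mul_pow]
      refine mul_le_mul_right ((add_sq_le_two_mul _ _).trans
        (mul_le_mul_right (add_le_add le_rfl ?_) _)) _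
      rw [mul_pow]
      refine mul_le_mul_left (pow_le_pow_left' (ENNReal.ofReal_le_ofReal ?_) 2) _
      exact Real.rpow_le_rpow Metric.diam_nonneg (cellDiam_le_meshSize hK)
        (zero_le_one.trans ht)
    refine rpow_half_le_iff.2 ?_
    calc _ ≤ ∑ K ∈ T, ENNReal.ofReal C ^ 2 *
        (2 * (l2Norm (volume.restrict (cell K)) (v - vh) ^ 2 +
          a ^ 2 * sobolevSeminorm (cell K) t v ^ 2)) := Finset.sum_le_sum h1
      _ = ENNReal.ofReal C ^ 2 * (2 * (∑ K ∈ T, l2Norm (volume.restrict (cell K)) (v - vh) ^ 2 +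
          a ^ 2 * ∑ K ∈ T, sobolevSeminorm (cell K) t v ^ 2)) := by
          rw [← Finset.mul_sum, ← Finset.mul_sum, Finset.sum_add_distrib, ← Finset.mul_sum]
      _ ≤ ENNReal.ofReal C ^ 2 * (2 * (A ^ 2 + a ^ 2 * S ^ 2)) :=
          mul_le_mul_right (mul_le_mul_right (add_le_add (sum_l2Norm_sq_le hT.cell_subset hd _)
            (mul_le_mul_right
              (sum_sobolevSeminorm_sq_le hΩ.measurableSet hT.cell_subset hd t v) _)) _) _
      _ ≤ ENNReal.ofReal C ^ 2 * (2 ^ 2 * (A + a * S) ^ 2) := by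
          rw [← mul_pow a]
          exact mul_le_mul_right (mul_le_mul' (by norm_num) (add_sq_le_sq_add _ _)) _
      _ = _ := by
          rw [ENNReal.ofReal_mul (by norm_num), ENNReal.ofReal_ofNat]
          ring

theorem polyForms_subset_polySpan_succ (r : ℕ) :
    polyForms n r k ⊆ polySpan n (r + 1) (Alt (Pt n) k) :=
  (polyForms_subset_polySpan r).trans (polySpan_mono r.le_succ)

end Global

end TanTrace

end

/-! ### The estimates for the Hodge–Laplace variables -/

theorem mainTheorem6 (n r : ℕ) (hn : 0 < n) (γ s : ℝ) (hs : 0 ≤ s) :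
    -- forms of degree `k = j + 1`
    (∀ j : ℕ, ∃ C : ℝ, 0 < C ∧
      ∀ (Ω : Set (TanTrace.Pt n)) (T : Finset (Finset (TanTrace.Pt n))),
        IsOpen Ω → TanTrace.IsMesh Ω T → TanTrace.IsShapeRegular γ T →
      ∀ (W' : Set (TanTrace.Form n j)) (W : Set (TanTrace.Form n (j + 1))),
        (W' = TanTrace.polyForms n (r + 1) j ∨ W' = TanTrace.polyFormsMinus n (r + 1) j) →
        ((1 ≤ r ∧ W = TanTrace.polyForms n r (j + 1)) ∨
          W = TanTrace.polyFormsMinus n (r + 1) (j + 1)) →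
      ∀ (f : TanTrace.Form n (j + 1))
        (σ : TanTrace.Form n j) (u p : TanTrace.Form n (j + 1))
        (σh : TanTrace.Form n j) (uh ph : TanTrace.Form n (j + 1)),
        TanTrace.MemL2 Ω f →
        TanTrace.IsMixedSolution Ω (TanTrace.HLambda Ω j) (TanTrace.HLambda Ω (j + 1)) f σ u p →
        TanTrace.IsMixedSolution Ω (TanTrace.feSpace Ω T W') (TanTrace.feSpace Ω T W)
          f σh uh ph →
        (∀ K ∈ T, TanTrace.MemSobolev (TanTrace.cell K) 1 σ) →
        (∀ K ∈ T, TanTrace.MemSobolev (TanTrace.cell K) 1 u) →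
        (W' = TanTrace.polyForms n (r + 1) j → s ≤ (r : ℝ) + 1 →
          TanTrace.TraceEstimate Ω T C (s + 1) σ σh) ∧
        (W' = TanTrace.polyFormsMinus n (r + 1) j → s ≤ (r : ℝ) →
          TanTrace.TraceEstimate Ω T C (s + 1) σ σh) ∧
        (W = TanTrace.polyFormsMinus n 1 (j + 1) →
          TanTrace.TraceEstimate Ω T C 1 u uh) ∧
        (s ≤ (r : ℝ) - 1 →
          TanTrace.TraceEstimate Ω T C (s + 2) u uh)) ∧
    -- forms of degree `k = 0`
    (∃ C : ℝ, 0 < C ∧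
      ∀ (Ω : Set (TanTrace.Pt n)) (T : Finset (Finset (TanTrace.Pt n))),
        IsOpen Ω → TanTrace.IsMesh Ω T → TanTrace.IsShapeRegular γ T →
      ∀ (W : Set (TanTrace.Form n 0)),
        ((1 ≤ r ∧ W = TanTrace.polyForms n r 0) ∨ W = TanTrace.polyFormsMinus n (r + 1) 0) →
      ∀ (f u p uh ph : TanTrace.Form n 0),
        TanTrace.MemL2 Ω f →
        TanTrace.IsMixedSolutionZero Ω (TanTrace.HLambda Ω 0) f u p →
        TanTrace.IsMixedSolutionZero Ω (TanTrace.feSpace Ω T W) f uh ph →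
        (∀ K ∈ T, TanTrace.MemSobolev (TanTrace.cell K) 1 u) →
        (W = TanTrace.polyFormsMinus n 1 0 →
          TanTrace.TraceEstimate Ω T C 1 u uh) ∧
        (s ≤ (r : ℝ) - 1 →
          TanTrace.TraceEstimate Ω T C (s + 2) u uh)) := by
  have hsub : ∀ {k : ℕ} {W : Set (TanTrace.Form n k)},
      ((1 ≤ r ∧ W = TanTrace.polyForms n r k) ∨ W = TanTrace.polyFormsMinus n (r + 1) k) →
      W ⊆ TanTrace.polySpan n (r + 1) (TanTrace.Alt (TanTrace.Pt n) k) := by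
    rintro k W (⟨-, rfl⟩ | rfl)
    · exact TanTrace.polyForms_subset_polySpan_succ r
    · exact TanTrace.polyFormsMinus_subset_polySpan r
  have hs1 : 1 ≤ s + 1 := by linarith
  have hs2 : 1 ≤ s + 2 := by linarith
  refine ⟨fun j => ?_, ?_⟩
  · obtain ⟨C₁, hC₁, h₁⟩ := TanTrace.exists_traceEstimate n j hn γ (r + 1) hs1
    obtain ⟨C₂, hC₂, h₂⟩ := TanTrace.exists_traceEstimate n (j + 1) hn γ (r + 1) le_rfl
    obtain ⟨C₃, hC₃, h₃⟩ := TanTrace.exists_traceEstimate n (j + 1) hn γ (r + 1) hs2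
    -- The three constants belong to the orders `s + 1` for `σ`, and `1` and `s + 2` for `u`; their
    -- sum serves all cases.
    refine ⟨C₁ + C₂ + C₃, by positivity, fun Ω T hΩ hT hγ W' W hW' hW f σ u p σh uh ph _ _ hh
      hσ hu => ?_⟩
    have hW'sub : W' ⊆ TanTrace.polySpan n (r + 1) (TanTrace.Alt (TanTrace.Pt n) j) := by
      rcases hW' with rfl | rfl
      · exact TanTrace.polyForms_subset_polySpan (r + 1)
      · exact TanTrace.polyFormsMinus_subset_polySpan r
    have e₁ := (h₁ Ω T hΩ hT hγ W' hW'sub σ hσ σh hh.sigma_mem).mono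
      (show C₁ ≤ C₁ + C₂ + C₃ by linarith)
    have e₂ := (h₂ Ω T hΩ hT hγ W (hsub hW) u hu uh hh.u_mem).mono
      (show C₂ ≤ C₁ + C₂ + C₃ by linarith)
    have e₃ := (h₃ Ω T hΩ hT hγ W (hsub hW) u hu uh hh.u_mem).mono
      (show C₃ ≤ C₁ + C₂ + C₃ by linarith)
    exact ⟨fun _ _ => e₁, fun _ _ => e₁, fun _ => e₂, fun _ => e₃⟩
  · obtain ⟨C₂, hC₂, h₂⟩ := TanTrace.exists_traceEstimate n 0 hn γ (r + 1) le_rfl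
    obtain ⟨C₃, hC₃, h₃⟩ := TanTrace.exists_traceEstimate n 0 hn γ (r + 1) hs2
    refine ⟨C₂ + C₃, by positivity, fun Ω T hΩ hT hγ W hW f u p uh ph _ _ hh hu => ?_⟩
    have e₂ := (h₂ Ω T hΩ hT hγ W (hsub hW) u hu uh hh.u_mem).mono
      (show C₂ ≤ C₂ + C₃ by linarith)
    have e₃ := (h₃ Ω T hΩ hT hγ W (hsub hW) u hu uh hh.u_mem).mono
      (show C₃ ≤ C₂ + C₃ by linarith)
    exact ⟨fun _ => e₂, fun _ => e₃⟩
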